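/- **Definitions.** An *allowable sequence* on $N$ points is a doubly infinite sequence $\Pi=\{\pi_i\}_{i\in\mathbb Z}$ of permutations of the points for which there is an integer $h\ge 1$ (the length of a halfperiod) such that: $\pi_{i+h}$ is the reversal of $\pi_i$ for every $i$; each $\pi_{i+1}$ is obtained from $\pi_i$ (a *move*) by reversing one or more disjoint substrings of at least two consecutive elements (the *switches* of the move); and any two points take part in a common switch exactly once in a halfperiod. A switch is *crossing* if it reverses a centered substring. $\Pi$ is *even-near-critical* if $N$ is even and $h=N$; it is *centrally symmetric* if every point $p$ has a conjugate $\overline p$ whose position in each $\pi_i$ is the mirror image of the position of $p$; it is in *noncentral general position* if every non-crossing switch reverses exactly two points. Its *central signature* is $(d_1,\dots,d_t)$ if, in the halfperiod $\pi_0,\dots,\pi_h$, there are exactly $t$ crossing switches and the $j$-th of them reverses $2d_j$ points. For positive integers $d_1,\dots,d_t$ with $t\ge2$, $\mathrm{DC}^{cs}_{ncgen}(d_1,\dots,d_t)$ denotes the even-near-critical centrally symmetric allowable sequence in noncentral general position with central signature $(d_1,\dots,d_t)$, whose first move (from $\pi_0$ to $\pi_1$) contains a crossing switch and whose points are labelled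 so that $\pi_0=(1,2,\dots,n,\overline n,\dots,\overline 2,\overline 1)$. The *circular sequence* of a finite set of points in $\mathbb R^2$ is the sequence of the orders in which the points project to a directed line that rotates counterclockwise. An allowable sequence $\Pi$ is *(geometrically) realizable* if, after labelling the points and choosing the initial direction suitably, it is the circular sequence of some set $P$ of points in $\mathbb R^2$; such a $P$ is a *realization* of $\Pi$. Two subsets of $\mathbb R^2$ are *affinely equivalent* if an invertible affine map of the plane takes one onto the other. For integers $r\ge 1$ and $s,t\ge0$, put $$\mathrm{TC}(r,s;t)=\Big\{(\pm1,k),\ \big(0,\tfrac r2\pm i\big),\ \big(0,\tfrac r2\pm(j-\tfrac12)\big)\ :\ 0\le k\le r,\ 0\le i\le s,\ 1\le j\le t\Big\},\qquad \mathrm{TC}^*(r,s;t)=\mathrm{TC}(r,s;t)\setminus\{(0,\tfrac r2)\}.$$ **Theorem.** Let $t\ge 3$, let $d_1,\dots,d_t$ be positive integers, and suppose that for some $i$, with indices taken modulo $t$, $d_i\ge 2$ and $d_{i+1}=d_{i+2}=1$. Then $\mathrm{DC}^{cs}_{ncgen}(d_1,\dots,d_t)$ is geometrically realizable if and only if $t=3$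 (in particular, for $t=3$ such a sequence exists). Furthermore, every realization of it is affinely equivalent to the tricolumnar array $\mathrm{TC}^*(1,d_i;0)$, that is, to $$\{(\pm1,0),\ (\pm1,1)\}\ \cup\ \{(0,\tfrac12\pm k): 1\le k\le d_i\}.$$ -/

import Mathlib

/-- An allowable sequence on `N` points (labelled by `Fin N`): a doubly infinite sequence of
permutations in which every move reverses one or more disjoint substrings of consecutive elements,
shifting by the halfperiod length `h` reverses every permutation, and any two points are switched
exactly once in a halfperiod.

`perm i p` is the (zero-based) position of the point `p` in the `i`-th permutation.
A pair `(a, b) ∈ switches i` is a switch of the move from `perm i` to `perm (i + 1)`; it reverses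
the substring occupying the positions `a, a + 1, …, b`. -/
structure AllowableSequence (N : ℕ) where
  perm : ℤ → Equiv.Perm (Fin N)
  switches : ℤ → Finset (Fin N × Fin N)
  h : ℕ
  h_pos : 0 < h
  perm_add_h : ∀ (i : ℤ) (p : Fin N), perm (i + h) p = (perm i p).rev
  switches_nonempty : ∀ i : ℤ, (switches i).Nonempty
  switches_lt : ∀ i : ℤ, ∀ I ∈ switches i, I.1 < I.2
  switches_disjoint : ∀ i : ℤ, ∀ I ∈ switches i, ∀ J ∈ switches i, I ≠ J →
    Disjoint (Finset.Icc I.1 I.2) (Finset.Icc J.1 J.2)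
  perm_succ_of_mem : ∀ i : ℤ, ∀ I ∈ switches i, ∀ p : Fin N,
    perm i p ∈ Finset.Icc I.1 I.2 →
      (perm i p : ℕ) + (perm (i + 1) p : ℕ) = (I.1 : ℕ) + (I.2 : ℕ)
  perm_succ_of_notMem : ∀ (i : ℤ) (p : Fin N),
    (∀ I ∈ switches i, perm i p ∉ Finset.Icc I.1 I.2) → perm (i + 1) p = perm i p
  switch_once : ∀ (a : ℤ) (p q : Fin N), p ≠ q →
    ∃! i : ℤ, a ≤ i ∧ i < a + h ∧
      ∃ I ∈ switches i, perm i p ∈ Finset.Icc I.1 I.2 ∧ perm i q ∈ Finset.Icc I.1 I.2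

/-- The substring in the positions `I.1, …, I.2` is centered. Switches reversing a centered
substring are the crossing switches. -/
def IsCentered {N : ℕ} (I : Fin N × Fin N) : Prop :=
  I.2 = I.1.rev

namespace AllowableSequence

variable {N : ℕ}

/-- Every point `p` has a conjugate `q`, at the mirror position of `p` in every permutation. -/
def CentrallySymmetric (S : AllowableSequence N) : Prop :=
  ∀ p : Fin N, ∃ q : Fin N, ∀ i : ℤ, S.perm i q = (S.perm i p).rev

/-- All switches, except perhaps for the crossing switches, are transpositions. -/
def NoncentralGeneralPosition (S : AllowableSequence N) : Prop :=
  ∀ i : ℤ, ∀ I ∈ S.switches i, ¬ IsCentered I → (I.2 : ℕ) = (I.1 : ℕ) + 1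

/-- An even number of points, and a halfperiod whose length equals the number of points. -/
def EvenNearCritical (S : AllowableSequence N) : Prop :=
  Even N ∧ S.h = N

/-- `d = (d 0, …, d (t - 1))` is the central signature: the crossing switches in the halfperiod
starting at the permutation of index `0` occur in the moves `m 0 < ⋯ < m (t - 1)`, and the `j`-th
of them reverses `2 * d j` points. (A move contains at most one crossing switch.) -/
def HasCentralSignature (S : AllowableSequence N) {t : ℕ} (d : Fin t → ℕ) : Prop :=
  ∃ m : Fin t → ℕ, StrictMono m ∧ (∀ j, m j < S.h) ∧
    (∀ j, ∃ I ∈ S.switches (m j), IsCentered I ∧ (Finset.Icc I.1 I.2).card = 2 * d j) ∧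
    (∀ i : ℕ, i < S.h → (∃ I ∈ S.switches i, IsCentered I) → ∃ j, m j = i)

/-- `S` is the even-near-critical centrally symmetric allowable sequence in noncentral general
position with central signature `d` whose first move contains a crossing switch, with the points
labelled by their positions in the permutation of index `0`. In this labelling the conjugate of the
point `p` is `p.rev`; the labels `0, …, n - 1, n, …, 2 * n - 1` stand for the points
`1, …, n` followed by the conjugates of `n, …, 1`. -/
structure IsDC (S : AllowableSequence N) {t : ℕ} (d : Fin t → ℕ) : Prop where
  evenNearCritical : S.EvenNearCritical
  centrallySymmetric : S.CentrallySymmetric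
  noncentralGeneralPosition : S.NoncentralGeneralPosition
  centralSignature : S.HasCentralSignature d
  perm_zero : S.perm 0 = 1
  first_move : ∃ I ∈ S.switches 0, IsCentered I

end AllowableSequence

/-- The coordinate of the orthogonal projection of `x` to the directed line through the origin with
direction `(cos φ, sin φ)`. -/
noncomputable def proj (φ : ℝ) (x : ℝ × ℝ) : ℝ :=
  x.1 * Real.cos φ + x.2 * Real.sin φ

/-- `σ` is the circular sequence of the labelled points `v`: the angles at which two of the points
have the same projection are `⋯ < θ (-1) < θ 0 < θ 1 < ⋯`, and for the directed lines with an angle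
strictly between `θ i` and `θ (i + 1)` the projections of the points appear in the order given by
the permutation `σ i` (`σ i p` being the position of `p`). -/
def IsCircularSequence {N : ℕ} (v : Fin N → ℝ × ℝ) (σ : ℤ → Equiv.Perm (Fin N)) : Prop :=
  ∃ θ : ℤ → ℝ, StrictMono θ ∧
    Set.range θ = {φ : ℝ | ∃ p q : Fin N, p ≠ q ∧ proj φ (v p) = proj φ (v q)} ∧
    ∀ (i : ℤ) (φ : ℝ), θ i < φ → φ < θ (i + 1) →
      ∀ p q : Fin N, proj φ (v p) < proj φ (v q) ↔ σ i p < σ i q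

/-- The point set `P` is a geometric realization of `S`: for a suitable labelling of its points,
its circular sequence is `S`. -/
def Realizes {N : ℕ} (P : Set (ℝ × ℝ)) (S : AllowableSequence N) : Prop :=
  ∃ v : Fin N → ℝ × ℝ, Function.Injective v ∧ Set.range v = P ∧ IsCircularSequence v S.perm

def GeometricallyRealizable {N : ℕ} (S : AllowableSequence N) : Prop :=
  ∃ P : Set (ℝ × ℝ), Realizes P S

def AffinelyEquivalent (P Q : Set (ℝ × ℝ)) : Prop :=
  ∃ e : (ℝ × ℝ) ≃ᵃ[ℝ] (ℝ × ℝ), e '' P = Q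

/-- The tricolumnar array `TC(r, s; t)`. -/
def tricolumnarArray (r s t : ℕ) : Set (ℝ × ℝ) :=
  {x | (∃ k : ℕ, k ≤ r ∧ (x = (1, (k : ℝ)) ∨ x = (-1, (k : ℝ)))) ∨
    (∃ i : ℕ, i ≤ s ∧ (x = (0, (r : ℝ) / 2 + i) ∨ x = (0, (r : ℝ) / 2 - i))) ∨
    (∃ j : ℕ, 1 ≤ j ∧ j ≤ t ∧
      (x = (0, (r : ℝ) / 2 + ((j : ℝ) - 1 / 2)) ∨ x = (0, (r : ℝ) / 2 - ((j : ℝ) - 1 / 2))))}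

/-- The array `TC*(r, s; t)`: the tricolumnar array without its center of symmetry. -/
def tricolumnarArrayStar (r s t : ℕ) : Set (ℝ × ℝ) :=
  tricolumnarArray r s t \ {(0, (r : ℝ) / 2)}

/-! Positions are measured by odd integers symmetric about the centre. A point is switched with its
conjugate once in a halfperiod, and only in a crossing move, so the central blocks cover all points:
N ≤ Σ 2d_j. Ungar's argument (`Flips.add_le`) puts consecutive crossings of 2d and 2e points at
least d + e moves apart, and the gaps add up to h. Since h = N, every gap is exact
(`Crosses.next_eq`).

With D = d_i, four consecutive crossings thus occur in the moves T, T+D+1, T+D+3 and T+D+4+e, of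
sizes D, 1, 1, e (`Pattern`). Let a_1, …, a_D be the block points on the positive side after the
first crossing, let y, z, w be the points at coordinate 1 before the other three, and let a prime
denote conjugation. There is no time to spare, so y walks straight inwards and is switched with a_j
in the move T+D+1-j, while z follows one place behind.

In a realization, two pairs of points span parallel lines if and only if they are switched in the
same move (`HasDirections`). The block is collinear, and y a_j ∥ y' a_j', z a_j ∥ z' a_j', z y' ∥ y
z' force a common centre of symmetry (`central_of_parallel`). Further, y y' ∥ z a_1 and y a_j ∥ z
a_{j+1}. If t ≠ 3, the fourth crossing precedes the return of the block at T+h, and y y' ∥ w a_2, z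
y' ∥ w a_1, z z' ∥ w y' are inconsistent with this (`no_fourth`). If t = 3, the fourth crossing is
that return, and z z' ∥ a_1 y' turns the configuration into the array (`Frame.eq_of_t_eq_three`).

Conversely, for t = 3 the time at which two points are switched depends only on their positions
after the move T, so the sequence is unique up to labels and shift (`Pattern.coord_eq_int`). The
circular sequence of the array, started at a suitable crossing, has the required signature
(`exists_isDC`), hence it is the given sequence. -/

namespace AllowableSequence

/-! ### Centred coordinates and the effect of a move on the order of two points. -/

variable {N : ℕ} (S : AllowableSequence N)

/-- The position of `p` in the `i`-th permutation, doubled and measured from the center. -/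
def coord (i : ℤ) (p : Fin N) : ℤ := 2 * ((S.perm i p : ℕ) : ℤ) + 1 - N

/-- The points `p` and `q` take part in a common switch of the `i`-th move. -/
def Swaps (i : ℤ) (p q : Fin N) : Prop :=
  ∃ I ∈ S.switches i, S.perm i p ∈ Finset.Icc I.1 I.2 ∧ S.perm i q ∈ Finset.Icc I.1 I.2

variable {S}

theorem coord_inj {i : ℤ} {p q : Fin N} (h : S.coord i p = S.coord i q) : p = q := by
  unfold coord at h
  exact (S.perm i).injective (Fin.ext (by omega))

theorem coord_lt_iff {i : ℤ} {p q : Fin N} :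
    S.coord i p < S.coord i q ↔ S.perm i p < S.perm i q := by
  unfold coord
  rw [Fin.lt_def]
  omega

theorem abs_coord_lt (i : ℤ) (p : Fin N) : |S.coord i p| < N := by
  unfold coord
  have := (S.perm i p).isLt
  rw [abs_lt]
  omega

theorem coord_emod_two (hN : Even N) (i : ℤ) (p : Fin N) : S.coord i p % 2 = 1 := by
  obtain ⟨k, rfl⟩ := hN
  unfold coord
  omega

theorem exists_coord_eq (hN : Even N) (i : ℤ) {x : ℤ} (hx : x % 2 = 1) (hxN : |x| < N) :
    ∃ p, S.coord i p = x := by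
  obtain ⟨k, rfl⟩ := hN
  rw [abs_lt] at hxN
  refine ⟨(S.perm i).symm ⟨((x + (k + k : ℕ) - 1) / 2).toNat, by omega⟩, ?_⟩
  unfold coord
  rw [Equiv.apply_symm_apply]
  dsimp only
  omega

theorem coord_add_h (i : ℤ) (p : Fin N) : S.coord (i + S.h) p = -S.coord i p := by
  unfold coord
  rw [S.perm_add_h, Fin.val_rev]
  have := (S.perm i p).isLt
  omega

theorem perm_succ_mem {i : ℤ} {I : Fin N × Fin N} (hI : I ∈ S.switches i) {p : Fin N}
    (hp : S.perm i p ∈ Finset.Icc I.1 I.2) : S.perm (i + 1) p ∈ Finset.Icc I.1 I.2 := by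
  have h := S.perm_succ_of_mem i I hI p hp
  simp only [Finset.mem_Icc, Fin.le_def] at hp ⊢
  omega

/-- Treats moving and resting points alike: a point outside all switches gets the one-place interval
at its position. -/
theorem exists_interval (i : ℤ) (p : Fin N) :
    ∃ J : Fin N × Fin N, S.perm i p ∈ Finset.Icc J.1 J.2 ∧
      S.perm (i + 1) p ∈ Finset.Icc J.1 J.2 ∧
      ∀ I ∈ S.switches i, I ≠ J → Disjoint (Finset.Icc I.1 I.2) (Finset.Icc J.1 J.2) := by
  by_cases h : ∃ I ∈ S.switches i, S.perm i p ∈ Finset.Icc I.1 I.2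
  · obtain ⟨I, hI, hp⟩ := h
    exact ⟨I, hp, perm_succ_mem hI hp, fun J hJ hne => S.switches_disjoint i J hJ I hI hne⟩
  · push Not at h
    refine ⟨(S.perm i p, S.perm i p), by simp, ?_, ?_⟩
    · rw [S.perm_succ_of_notMem i p h]
      simp
    · intro I hI _
      simpa using h I hI

/-- Unless both points rest, they lie in disjoint intervals, each of which the move maps to itself.
-/
theorem perm_succ_lt_iff_of_not_swaps {i : ℤ} {p q : Fin N} (h : ¬ S.Swaps i p q) :
    S.perm (i + 1) p < S.perm (i + 1) q ↔ S.perm i p < S.perm i q := by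
  have key : ∀ p q : Fin N, ¬ S.Swaps i p q → (∃ I ∈ S.switches i,
      S.perm i p ∈ Finset.Icc I.1 I.2) →
      (S.perm (i + 1) p < S.perm (i + 1) q ↔ S.perm i p < S.perm i q) := by
    intro p q h ⟨I, hI, hp⟩
    obtain ⟨J, hq, hq', hJ⟩ := S.exists_interval i q
    have hne : I ≠ J := by
      rintro rfl
      exact h ⟨I, hI, hp, hq⟩
    have hp' := perm_succ_mem hI hp
    have hd := Finset.disjoint_left.1 (hJ I hI hne)
    have h1 := hd (a := I.1)
    have h2 := hd (a := I.2)
    have h3 := hd (a := J.1)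
    have h4 := hd (a := J.2)
    simp only [Finset.mem_Icc, Fin.le_def, Fin.lt_def] at *
    omega
  by_cases h1 : ∃ I ∈ S.switches i, S.perm i p ∈ Finset.Icc I.1 I.2
  · exact key p q h h1
  · by_cases h2 : ∃ I ∈ S.switches i, S.perm i q ∈ Finset.Icc I.1 I.2
    · have h' : ¬ S.Swaps i q p := fun ⟨I, hI, ha, hb⟩ => h ⟨I, hI, hb, ha⟩
      rcases eq_or_ne p q with rfl | hpq
      · simp
      have := key q p h' h2
      have e1 : S.perm i p ≠ S.perm i q := fun e => hpq ((S.perm i).injective e)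
      have e2 : S.perm (i + 1) p ≠ S.perm (i + 1) q := fun e => hpq ((S.perm (i + 1)).injective e)
      rw [← not_le, ← not_le, not_iff_not, e1.symm.le_iff_lt, e2.symm.le_iff_lt]
      exact this
    · push Not at h1 h2
      rw [S.perm_succ_of_notMem i p h1, S.perm_succ_of_notMem i q h2]

theorem perm_succ_lt_iff_of_swaps {i : ℤ} {p q : Fin N} (h : S.Swaps i p q) :
    S.perm (i + 1) p < S.perm (i + 1) q ↔ S.perm i q < S.perm i p := by
  obtain ⟨I, hI, hp, hq⟩ := h
  have h1 := S.perm_succ_of_mem i I hI p hp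
  have h2 := S.perm_succ_of_mem i I hI q hq
  rw [Fin.lt_def, Fin.lt_def]
  omega

/-- Two points are switched in a move if and only if the move changes their order. -/
theorem swaps_iff {i : ℤ} {p q : Fin N} (hpq : p ≠ q) :
    S.Swaps i p q ↔ (S.coord i p < S.coord i q ↔ S.coord (i + 1) q < S.coord (i + 1) p) := by
  simp only [coord_lt_iff]
  have e1 : S.perm i p ≠ S.perm i q := fun e => hpq ((S.perm i).injective e)
  constructor
  · intro h
    have h' : S.Swaps i q p := by
      obtain ⟨I, hI, hp, hq⟩ := h
      exact ⟨I, hI, hq, hp⟩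
    exact (perm_succ_lt_iff_of_swaps h').symm
  · intro h
    by_contra hn
    have h' : ¬ S.Swaps i q p := fun ⟨I, hI, ha, hb⟩ => hn ⟨I, hI, hb, ha⟩
    rw [perm_succ_lt_iff_of_not_swaps h'] at h
    rcases lt_or_gt_of_ne e1 with h1 | h1
    · exact lt_asymm h1 (h.1 h1)
    · exact lt_asymm h1 (h.2 h1)

theorem Swaps.symm {i : ℤ} {p q : Fin N} (h : S.Swaps i p q) : S.Swaps i q p := by
  obtain ⟨I, hI, hp, hq⟩ := h
  exact ⟨I, hI, hq, hp⟩

theorem Swaps.of_lt {i : ℤ} {p q : Fin N} (h : S.coord i p < S.coord i q)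
    (h' : S.coord (i + 1) q < S.coord (i + 1) p) : S.Swaps i p q :=
  (swaps_iff (by rintro rfl; exact lt_irrefl _ h)).2 (by tauto)

theorem Swaps.eq_of_lt {i j : ℤ} {p q : Fin N} (hpq : p ≠ q) (hi : S.Swaps i p q)
    (hj : S.Swaps j p q) (hij : i ≤ j) (hjh : j < i + S.h) : i = j := by
  have h := S.switch_once i p q hpq
  exact h.unique ⟨le_rfl, by have := S.h_pos; omega, hi⟩ ⟨hij, hjh, hj⟩

/-! ### The shape of a single move. -/

/-- In the `i`-th move the `2 * d` central points are reversed, and every other point stays or is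
transposed with a neighbor on the same side of the center. -/
structure Flips (S : AllowableSequence N) (i : ℤ) (d : ℕ) : Prop where
  inner : ∀ p, |S.coord i p| < 2 * d → S.coord (i + 1) p = -S.coord i p
  outer : ∀ p, 2 * d < |S.coord i p| → S.coord (i + 1) p = S.coord i p ∨
    ∃ q, 2 * d < |S.coord i q| ∧ (0 < S.coord i p ↔ 0 < S.coord i q) ∧
      (S.coord i q = S.coord i p + 2 ∨ S.coord i q = S.coord i p - 2) ∧
      S.coord (i + 1) p = S.coord i q ∧ S.coord (i + 1) q = S.coord i p

theorem Flips.add_h {i : ℤ} {d : ℕ} (h : S.Flips i d) (hN : Even N) : S.Flips (i + S.h) d := by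
  have e : i + S.h + 1 = i + 1 + S.h := by ring
  constructor
  · intro p
    rw [e, coord_add_h, coord_add_h, abs_neg]
    intro hp
    rw [h.inner p hp]
  · intro p
    simp only [e, coord_add_h, abs_neg, neg_inj]
    intro hp
    rcases h.outer p hp with h1 | ⟨q, h1, h2, h3, h4, h5⟩
    · exact Or.inl h1
    · have o1 := S.coord_emod_two hN i p
      have o2 := S.coord_emod_two hN i q
      exact Or.inr ⟨q, h1, by omega, by omega, h4, h5⟩

theorem Flips.sub_h {i : ℤ} {d : ℕ} (h : S.Flips (i + S.h) d) (hN : Even N) : S.Flips i d := by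
  have e : i + S.h + 1 = i + 1 + S.h := by ring
  constructor
  · intro p hp
    have := h.inner p
    rw [e, coord_add_h, coord_add_h, abs_neg] at this
    have := this hp
    omega
  · intro p hp
    have := h.outer p
    simp only [e, coord_add_h, abs_neg, neg_inj] at this
    rcases this hp with h1 | ⟨q, h1, h2, h3, h4, h5⟩
    · exact Or.inl h1
    · have o1 := S.coord_emod_two hN i p
      have o2 := S.coord_emod_two hN i q
      exact Or.inr ⟨q, h1, by omega, by omega, h4, h5⟩

theorem Flips.add_mul_h {i : ℤ} {d : ℕ} (h : S.Flips i d) (hN : Even N) (k : ℤ) :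
    S.Flips (i + k * S.h) d := by
  induction k with
  | zero => simpa using h
  | succ k ih =>
    have := ih.add_h hN
    convert this using 1
    ring
  | pred k ih =>
    apply Flips.sub_h _ hN
    convert ih using 1
    ring

theorem Icc_card {I : Fin N × Fin N} :
    (Finset.Icc I.1 I.2).card = (I.2 : ℕ) + 1 - (I.1 : ℕ) := by
  simp

theorem coord_succ_of_transposition {i : ℤ} {I : Fin N × Fin N} (hI : I ∈ S.switches i)
    (hI2 : (I.2 : ℕ) = (I.1 : ℕ) + 1) {p : Fin N} (hp : S.perm i p ∈ Finset.Icc I.1 I.2) :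
    ∃ q, S.perm i q ∈ Finset.Icc I.1 I.2 ∧
      (S.coord i q = S.coord i p + 2 ∨ S.coord i q = S.coord i p - 2) ∧
      S.coord (i + 1) p = S.coord i q ∧ S.coord (i + 1) q = S.coord i p := by
  have h1 := S.perm_succ_of_mem i I hI p hp
  have key : ∀ q, S.perm i q ∈ Finset.Icc I.1 I.2 → S.perm i q ≠ S.perm i p →
      ∃ q, S.perm i q ∈ Finset.Icc I.1 I.2 ∧
      (S.coord i q = S.coord i p + 2 ∨ S.coord i q = S.coord i p - 2) ∧
      S.coord (i + 1) p = S.coord i q ∧ S.coord (i + 1) q = S.coord i p := by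
    intro q hq hne
    have h2 := S.perm_succ_of_mem i I hI q hq
    refine ⟨q, hq, ?_⟩
    rw [Ne, Fin.ext_iff] at hne
    simp only [Finset.mem_Icc, Fin.le_def] at hp hq
    unfold coord
    omega
  by_cases h : S.perm i p = I.1
  · refine key ((S.perm i).symm I.2) ?_ ?_
    · rw [Equiv.apply_symm_apply, Finset.mem_Icc, Fin.le_def, Fin.le_def]
      omega
    · rw [Equiv.apply_symm_apply, h, Ne, Fin.ext_iff]
      omega
  · refine key ((S.perm i).symm I.1) ?_ ?_
    · rw [Equiv.apply_symm_apply, Finset.mem_Icc, Fin.le_def, Fin.le_def]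
      omega
    · rw [Equiv.apply_symm_apply]
      exact fun e => h e.symm

/-- The only adjacent positions on different sides of the centre form a centered substring, so a
transposition that is not crossing stays on one side. -/
theorem NoncentralGeneralPosition.flips_zero (hS : S.NoncentralGeneralPosition) (hN : Even N)
    {i : ℤ} (h : ¬ ∃ I ∈ S.switches i, IsCentered I) : S.Flips i 0 := by
  constructor
  · intro p hp
    have := abs_nonneg (S.coord i p)
    simp at hp
    omega
  · intro p _
    by_cases hp : ∃ I ∈ S.switches i, S.perm i p ∈ Finset.Icc I.1 I.2
    · obtain ⟨I, hI, hp⟩ := hp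
      have hc : ¬ IsCentered I := fun hc => h ⟨I, hI, hc⟩
      have h2 := hS i I hI hc
      obtain ⟨q, hq, h3, h4, h5⟩ := coord_succ_of_transposition hI h2 hp
      have o2 := S.coord_emod_two hN i q
      refine Or.inr ⟨q, by rw [Nat.cast_zero, mul_zero, abs_pos]; omega, ?_, h3, h4, h5⟩
      unfold IsCentered at hc
      rw [Fin.ext_iff, Fin.val_rev] at hc
      obtain ⟨k, rfl⟩ := hN
      simp only [Finset.mem_Icc, Fin.le_def] at hp hq
      have := I.1.isLt
      unfold coord at *
      omega
    · push Not at hp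
      left
      unfold coord
      rw [S.perm_succ_of_notMem i p hp]

theorem NoncentralGeneralPosition.flips (hS : S.NoncentralGeneralPosition) (hN : Even N)
    {i : ℤ} {I : Fin N × Fin N} (hI : I ∈ S.switches i) (hc : IsCentered I) {d : ℕ}
    (hd : (Finset.Icc I.1 I.2).card = 2 * d) : S.Flips i d := by
  have hlt := S.switches_lt i I hI
  rw [Icc_card] at hd
  unfold IsCentered at hc
  rw [Fin.ext_iff, Fin.val_rev] at hc
  rw [Fin.lt_def] at hlt
  have h1 := I.1.isLt
  have hmem : ∀ p, S.perm i p ∈ Finset.Icc I.1 I.2 ↔ |S.coord i p| < 2 * d := by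
    intro p
    rw [Finset.mem_Icc, Fin.le_def, Fin.le_def, abs_lt]
    unfold coord
    omega
  constructor
  · intro p hp
    have := S.perm_succ_of_mem i I hI p ((hmem p).2 hp)
    unfold coord
    omega
  · intro p hp
    by_cases hp' : ∃ J ∈ S.switches i, S.perm i p ∈ Finset.Icc J.1 J.2
    · obtain ⟨J, hJ, hpJ⟩ := hp'
      have hne : J ≠ I := by
        rintro rfl
        rw [hmem] at hpJ
        omega
      -- Two centered substrings are nested, so a second crossing switch would not be disjoint from
      -- `I`.
      have hcJ : ¬ IsCentered J := by
        intro hcJ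
        have hltJ := S.switches_lt i J hJ
        unfold IsCentered at hcJ
        rw [Fin.ext_iff, Fin.val_rev] at hcJ
        rw [Fin.lt_def] at hltJ
        have := J.1.isLt
        have hd := Finset.disjoint_left.1 (S.switches_disjoint i J hJ I hI hne)
        have h1 := hd (a := I.1)
        have h3 := hd (a := J.1)
        simp only [Finset.mem_Icc, Fin.le_def] at h1 h3
        omega
      obtain ⟨q, hq, h3, h4, h5⟩ := coord_succ_of_transposition hJ (hS i J hJ hcJ) hpJ
      have hqI : ¬ |S.coord i q| < 2 * d := by
        rw [← hmem]
        exact Finset.disjoint_left.1 (S.switches_disjoint i J hJ I hI hne) hq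
      have o2 := S.coord_emod_two hN i q
      rw [abs_lt] at hqI
      rw [lt_abs] at hp
      refine Or.inr ⟨q, ?_, ?_, h3, h4, h5⟩
      · rw [lt_abs]
        omega
      · omega
    · push Not at hp'
      left
      unfold coord
      rw [S.perm_succ_of_notMem i p hp']

/-- A conjugate point has mirror positions. -/
theorem CentrallySymmetric.exists_conj (hS : S.CentrallySymmetric) (p : Fin N) :
    ∃ q, ∀ i, S.coord i q = -S.coord i p := by
  obtain ⟨q, hq⟩ := hS p
  refine ⟨q, fun i => ?_⟩
  unfold coord
  rw [hq, Fin.val_rev]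
  have := (S.perm i p).isLt
  omega

theorem Flips.swaps_conj {i : ℤ} {d : ℕ} (h : S.Flips i d) (hN : Even N) {p q : Fin N}
    (hpq : ∀ i, S.coord i q = -S.coord i p) (hp : |S.coord i p| < 2 * d) : S.Swaps i p q := by
  have o := S.coord_emod_two hN i p
  rw [swaps_iff, hpq, hpq, h.inner p hp]
  · omega
  · rintro rfl
    have := hpq i
    omega

/-- The points other than the central ones remain on their sides. -/
theorem Flips.pos_iff {i : ℤ} {d : ℕ} (h : S.Flips i d) {p : Fin N}
    (hp : 2 * d < |S.coord i p|) : 0 < S.coord (i + 1) p ↔ 0 < S.coord i p := by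
  rcases h.outer p hp with h1 | ⟨q, h1, h2, h3, h4, h5⟩
  · rw [h1]
  · rw [h4, h2]

theorem Flips.lt_abs_succ {i : ℤ} {d : ℕ} (h : S.Flips i d) {p : Fin N}
    (hp : 2 * d < |S.coord i p|) : 2 * d < |S.coord (i + 1) p| := by
  rcases h.outer p hp with h1 | ⟨q, h1, h2, h3, h4, h5⟩
  · rwa [h1]
  · rwa [h4]

theorem Flips.swaps_inner {i : ℤ} {d : ℕ} (h : S.Flips i d) {p q : Fin N} (hpq : p ≠ q)
    (hp : |S.coord i p| < 2 * d) (hq : |S.coord i q| < 2 * d) : S.Swaps i p q := by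
  rw [swaps_iff hpq, h.inner p hp, h.inner q hq]
  omega

theorem Flips.abs_succ_lt_iff {i : ℤ} {d : ℕ} (h : S.Flips i d) (hN : Even N) {p : Fin N} :
    |S.coord (i + 1) p| < 2 * d ↔ |S.coord i p| < 2 * d := by
  constructor
  · intro hp
    by_contra hn
    have o := S.coord_emod_two hN i p
    have := h.lt_abs_succ (p := p) (by rw [abs_lt] at hn; rw [lt_abs]; omega)
    omega
  · intro hp
    rw [h.inner p hp, abs_neg]
    exact hp

theorem Flips.inner_pred {i : ℤ} {d : ℕ} (h : S.Flips i d) (hN : Even N) {p : Fin N}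
    (hp : |S.coord (i + 1) p| < 2 * d) : S.coord i p = -S.coord (i + 1) p := by
  rw [h.inner p ((h.abs_succ_lt_iff hN).1 hp), neg_neg]

/-- If `u` gives up the position `k` to `w`, coming from the outside, they are switched. -/
theorem Flips.diagonal {i : ℤ} {d : ℕ} (h : S.Flips i d) (hN : Even N) {w u : Fin N} {k : ℤ}
    (hw : S.coord (i + 1) w = k) (hu : S.coord i u = k) (hne : w ≠ u) (hk : 2 * d < k)
    (hin : S.coord i w ≠ k - 2) :
    S.coord i w = k + 2 ∧ S.coord (i + 1) u = k + 2 ∧ S.Swaps i w u := by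
  have hwabs : 2 * (d : ℤ) < |S.coord i w| := by
    by_contra hn
    have o := S.coord_emod_two hN i w
    have := (h.abs_succ_lt_iff hN (p := w)).2
      (by rw [lt_abs] at hn; rw [abs_lt]; omega)
    rw [abs_lt] at this
    omega
  have e : S.coord i w = k + 2 ∧ S.coord (i + 1) u = k + 2 := by
    rcases h.outer w hwabs with h1 | ⟨q, h1, h2, h3, h4, h5⟩
    · exact absurd (coord_inj (S := S) (i := i) (by omega)) hne
    · have : q = u := coord_inj (S := S) (i := i) (by omega)
      subst this
      omega
  exact ⟨e.1, e.2, (Swaps.of_lt (p := u) (q := w) (by omega) (by omega)).symm⟩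

/-! ### Blocks near a crossing move, and Ungar's estimate. -/

/-- After a crossing move, the points it has reversed leave their positions from the outside
inwards, one at a time. -/
theorem Flips.coord_after {T : ℤ} {d : ℕ} (h : S.Flips T d) (hN : Even N)
    {K : ℕ} (hK : ∀ k : ℕ, 1 ≤ k → k ≤ K → S.Flips (T + k) 0) (hKh : K < S.h) {p : Fin N}
    (hp : 0 < S.coord (T + 1) p) (hp' : S.coord (T + 1) p < 2 * (d - K)) :
    S.coord (T + 1 + K) p = S.coord (T + 1) p := by
  induction K generalizing p with
  | zero => simp
  | succ K ih =>
    have ih' := fun p => ih (fun k h1 h2 => hK k h1 (by omega)) (by omega) (p := p)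
    push_cast at hp' ⊢
    have hfl := hK (K + 1) (by omega) le_rfl
    rw [show T + ((K + 1 : ℕ) : ℤ) = T + 1 + K by push_cast; ring] at hfl
    have e := ih' p hp (by omega)
    have o := S.coord_emod_two hN (T + 1) p
    rw [← add_assoc]
    rcases hfl.outer p (by rw [e, lt_abs]; simp; omega) with h1 | ⟨q, h1, h2, h3, h4, h5⟩
    · rw [h1, e]
    · exfalso
      rw [e] at h2 h3
      obtain ⟨q', hq'⟩ := S.exists_coord_eq hN (T + 1) (x := S.coord (T + 1 + K) q)
        (S.coord_emod_two hN _ _) (S.abs_coord_lt _ _)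
      have e' := ih' q' (by omega) (by omega)
      obtain rfl : q = q' := coord_inj (S := S) (i := T + 1 + K) (by omega)
      have hne : p ≠ q := by
        rintro rfl
        omega
      have s1 : S.Swaps T p q := h.swaps_inner hne
        ((h.abs_succ_lt_iff hN).1 (by rw [abs_lt]; omega))
        ((h.abs_succ_lt_iff hN).1 (by rw [abs_lt]; omega))
      have s2 : S.Swaps (T + 1 + K) p q := by
        rw [swaps_iff hne]
        omega
      have := Swaps.eq_of_lt hne s1 s2 (by omega) (by omega)
      omega

/-- Before a crossing move, the points it reverses reach their positions from the inside
outwards, one at a time. -/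
theorem Flips.coord_before {T : ℤ} {d : ℕ} (h : S.Flips T d) (hN : Even N)
    {K : ℕ} (hK : ∀ k : ℕ, 1 ≤ k → k ≤ K → S.Flips (T - k) 0) (hKh : K < S.h) {p : Fin N}
    (hp : 0 < S.coord T p) (hp' : S.coord T p < 2 * (d - K)) :
    S.coord (T - K) p = S.coord T p := by
  induction K generalizing p with
  | zero => simp
  | succ K ih =>
    have ih' := fun p => ih (fun k h1 h2 => hK k h1 (by omega)) (by omega) (p := p)
    push_cast at hp' ⊢
    have hfl := hK (K + 1) (by omega) le_rfl
    have e := ih' p hp (by omega)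
    have o := S.coord_emod_two hN T p
    have o' := S.coord_emod_two hN (T - (K + 1 : ℕ)) p
    push_cast at hfl o'
    have e1 : T - K = T - (K + 1) + 1 := by ring
    rw [e1] at e ih'
    have habs : 2 * ((0 : ℕ) : ℤ) < |S.coord (T - (K + 1)) p| := by
      rw [lt_abs]; simp; omega
    have hpos := hfl.pos_iff habs
    rcases hfl.outer p habs with h1 | ⟨q, h1, h2, h3, h4, h5⟩
    · rw [← h1, e]
    · exfalso
      obtain ⟨q', hq'⟩ := S.exists_coord_eq hN T (x := S.coord (T - (K + 1) + 1) q)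
        (S.coord_emod_two hN _ _) (S.abs_coord_lt _ _)
      have e' := ih' q' (by omega) (by omega)
      obtain rfl : q = q' := coord_inj (S := S) (i := T - (K + 1) + 1) (by omega)
      have hne : p ≠ q := by
        rintro rfl
        omega
      have s1 : S.Swaps T p q := h.swaps_inner hne
        (by rw [abs_lt]; omega) (by rw [abs_lt]; omega)
      have s2 : S.Swaps (T - (K + 1)) p q := by
        rw [swaps_iff hne]
        omega
      have := Swaps.eq_of_lt hne s2 s1 (by omega) (by omega)
      omega

/-- Ungar's estimate for the distance of consecutive crossing moves. -/
theorem Flips.add_le {T T' : ℤ} {d e : ℕ} (h : S.Flips T d) (h' : S.Flips T' e) (hN : Even N)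
    (hS : S.CentrallySymmetric) (hd : 0 < d) (he : 0 < e) (hdN : 2 * d ≤ N)
    (hT : T < T') (hTh : T' < T + S.h) (hno : ∀ k, T < k → k < T' → S.Flips k 0) :
    T + d + e ≤ T' := by
  by_contra hlt
  -- If the gap were too short, K < d moves after T and L < e moves before T' would lead to the same
  -- moment. The points at coordinate 1 after T and before T' both occupy it then, so they coincide.
  obtain ⟨K, L, hK, hL, hKL⟩ : ∃ K L : ℕ, K < d ∧ L < e ∧ T + 1 + K + L = T' := by
    by_cases hc : T' - T - 1 < d
    · exact ⟨(T' - T - 1).toNat, 0, by omega, he, by omega⟩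
    · exact ⟨d - 1, (T' - T - d).toNat, by omega, by omega, by omega⟩
  obtain ⟨p, hp⟩ := S.exists_coord_eq hN (T + 1) (x := 1) (by norm_num) (by rw [abs_one]; omega)
  obtain ⟨q, hq⟩ := S.exists_coord_eq hN T' (x := 1) (by norm_num) (by rw [abs_one]; omega)
  have h1 := h.coord_after hN (K := K) (fun k hk hk' => hno _ (by omega) (by omega))
    (by omega) (p := p) (by omega) (by omega)
  have h2 := h'.coord_before hN (K := L) (fun k hk hk' => hno _ (by omega) (by omega))
    (by omega) (p := q) (by omega) (by omega)
  rw [show T' - L = T + 1 + K by omega] at h2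
  obtain rfl : p = q := coord_inj (S := S) (i := T + 1 + K) (by omega)
  -- This point would be switched with its conjugate in both crossings.
  obtain ⟨p', hp'⟩ := hS.exists_conj p
  have s1 := h.swaps_conj hN hp' ((h.abs_succ_lt_iff hN).1 (by rw [hp, abs_one]; omega))
  have s2 := h'.swaps_conj hN hp' (by rw [hq, abs_one]; omega)
  have hne : p ≠ p' := by
    rintro rfl
    have := hp' T'
    omega
  have := Swaps.eq_of_lt hne s1 s2 (by omega) (by omega)
  omega

end AllowableSequence

theorem Fin.val_add_one_eq_ite {t : ℕ} [NeZero t] (i : Fin t) :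
    ((i + 1 : Fin t) : ℕ) = if (i : ℕ) + 1 = t then 0 else (i : ℕ) + 1 := by
  rw [Fin.val_add, Fin.val_one', Nat.add_mod_mod]
  split_ifs with h
  · rw [h, Nat.mod_self]
  · exact Nat.mod_eq_of_lt (by have := i.isLt; omega)

/-! ### The crossing moves of a halfperiod and their exact distances. -/

namespace AllowableSequence

variable {N : ℕ} {S : AllowableSequence N}

/-- The crossing moves of a halfperiod are `m 0 < m 1 < ⋯`, and `m j` reverses `2 * d j` points. -/
structure Crosses (S : AllowableSequence N) {t : ℕ} (d m : Fin t → ℕ) : Prop where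
  even : Even N
  symmetric : S.CentrallySymmetric
  mono : StrictMono m
  lt_h : ∀ j, m j < S.h
  le_card : ∀ j, 2 * d j ≤ N
  flips : ∀ j, S.Flips (m j) (d j)
  flips_zero : ∀ i : ℕ, i < S.h → (∀ j, m j ≠ i) → S.Flips i 0

theorem IsDC.crosses {t : ℕ} {d : Fin t → ℕ} (h : S.IsDC d) : ∃ m, S.Crosses d m := by
  obtain ⟨m, hm, hlt, hc, hall⟩ := h.centralSignature
  have hN := h.evenNearCritical.1
  refine ⟨m, hN, h.centrallySymmetric, hm, hlt, ?_, ?_, ?_⟩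
  · intro j
    obtain ⟨I, -, -, hI⟩ := hc j
    rw [← hI]
    exact (Finset.card_le_univ _).trans (by simp)
  · intro j
    obtain ⟨I, hI, hI', hd⟩ := hc j
    exact h.noncentralGeneralPosition.flips hN hI hI' hd
  · intro i hi hne
    refine h.noncentralGeneralPosition.flips_zero hN fun hex => ?_
    obtain ⟨j, hj⟩ := hall i hi hex
    exact hne j hj

/-- Being switched with the conjugate means changing sides, which only the central points do. -/
theorem Flips.abs_lt_of_swaps_conj {i : ℤ} {d : ℕ} (h : S.Flips i d) (hN : Even N) {p q : Fin N}
    (hpq : ∀ i, S.coord i q = -S.coord i p) (hs : S.Swaps i p q) : |S.coord i p| < 2 * d := by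
  have o := S.coord_emod_two hN i p
  have o' := S.coord_emod_two hN (i + 1) p
  by_contra hn
  have := h.pos_iff (p := p) (by rw [abs_lt] at hn; rw [lt_abs]; omega)
  rw [swaps_iff, hpq, hpq] at hs
  · omega
  · rintro rfl
    have := hpq i
    omega

theorem card_abs_coord_lt_le (hN : Even N) (i : ℤ) (d : ℕ) :
    (Finset.univ.filter fun p => |S.coord i p| < 2 * d).card ≤ 2 * d := by
  rw [← Finset.card_range (2 * d)]
  refine Finset.card_le_card_of_injOn (fun p => ((S.coord i p + 2 * d) / 2).toNat) ?_ ?_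
  · intro p hp
    have o := S.coord_emod_two hN i p
    simp only [Finset.coe_filter, Finset.mem_univ, true_and, Set.mem_ofPred_eq, abs_lt] at hp
    simp only [Finset.coe_range, Set.mem_Iio]
    omega
  · intro p hp q hq hpq
    have o := S.coord_emod_two hN i p
    have o' := S.coord_emod_two hN i q
    simp only [Finset.coe_filter, Finset.mem_univ, true_and, Set.mem_ofPred_eq, abs_lt] at hp hq
    exact coord_inj (S := S) (i := i) (by dsimp only at hpq; omega)

namespace Crosses

variable {t : ℕ} {d m : Fin t → ℕ}

/-- Every point meets its conjugate in some crossing of the halfperiod, so the central blocks cover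
all points. -/
theorem card_le (h : S.Crosses d m) : N ≤ ∑ j, 2 * d j := by
  have hcov : (Finset.univ : Finset (Fin N)) ⊆
      Finset.univ.biUnion fun j => Finset.univ.filter fun p => |S.coord (m j) p| < 2 * d j := by
    intro p _
    obtain ⟨q, hq⟩ := h.symmetric.exists_conj p
    have o := S.coord_emod_two h.even 0 p
    have hpq : p ≠ q := by
      rintro rfl
      have := hq 0
      omega
    obtain ⟨i, ⟨hi, hi', hs⟩, -⟩ := S.switch_once 0 p q hpq
    change S.Swaps i p q at hs
    lift i to ℕ using hi
    rw [Finset.mem_biUnion]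
    by_cases hj : ∃ j, m j = i
    · obtain ⟨j, rfl⟩ := hj
      exact ⟨j, Finset.mem_univ _, by simpa using (h.flips j).abs_lt_of_swaps_conj h.even hq hs⟩
    · push Not at hj
      have := (h.flips_zero i (by omega) hj).abs_lt_of_swaps_conj h.even hq hs
      have := abs_nonneg (S.coord i p)
      omega
  calc N = (Finset.univ : Finset (Fin N)).card := by simp
    _ ≤ _ := Finset.card_le_card hcov
    _ ≤ _ := Finset.card_biUnion_le
    _ ≤ _ := Finset.sum_le_sum fun j _ => card_abs_coord_lt_le h.even _ _

/-- The move `T` is a translate of the `i`-th crossing move. -/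
def IsAt (S : AllowableSequence N) (m : Fin t → ℕ) (T : ℤ) (i : Fin t) : Prop :=
  ∃ k : ℤ, T = m i + k * S.h

theorem IsAt.flips {T : ℤ} {i : Fin t} (hT : IsAt S m T i) (h : S.Crosses d m) :
    S.Flips T (d i) := by
  obtain ⟨k, rfl⟩ := hT
  exact (h.flips i).add_mul_h h.even k

theorem IsAt.unique {T : ℤ} {i j : Fin t} (h : S.Crosses d m) (hi : IsAt S m T i)
    (hj : IsAt S m T j) : i = j := by
  obtain ⟨k, rfl⟩ := hi
  obtain ⟨l, hl⟩ := hj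
  have h1 := h.lt_h i
  have h2 := h.lt_h j
  have e := congrArg (· % (S.h : ℤ)) hl
  simp only [Int.add_mul_emod_self_right] at e
  rw [Int.emod_eq_of_lt (by omega) (by omega), Int.emod_eq_of_lt (by omega) (by omega)] at e
  exact h.mono.injective (by omega)

/-- The crossing move that follows `m i`. -/
def next (S : AllowableSequence N) [NeZero t] (m : Fin t → ℕ) (i : Fin t) : ℤ :=
  m (i + 1) + if (i : ℕ) + 1 = t then (S.h : ℤ) else 0

variable [NeZero t]

theorem flips_between (h : S.Crosses d m) (i : Fin t) {k : ℤ} (hk : m i < k)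
    (hk' : k < next S m i) : S.Flips k 0 := by
  have hv := Fin.val_add_one_eq_ite i
  have hi := i.isLt
  unfold next at hk'
  split_ifs at hv hk' with hc
  · by_cases hkh : k < S.h
    · lift k to ℕ using by omega
      refine h.flips_zero k (by omega) fun j hj => ?_
      have : i < j := h.mono.lt_iff_lt.1 (by omega)
      rw [Fin.lt_def] at this
      omega
    · obtain ⟨k', rfl⟩ : ∃ k' : ℕ, k = k' + S.h := ⟨(k - S.h).toNat, by omega⟩
      have := h.lt_h (i + 1)
      refine (h.flips_zero k' (by omega) fun j hj => ?_).add_h h.even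
      have : j < i + 1 := h.mono.lt_iff_lt.1 (by omega)
      rw [Fin.lt_def] at this
      omega
  · lift k to ℕ using by omega
    have := h.lt_h (i + 1)
    refine h.flips_zero k (by omega) fun j hj => ?_
    have h1 : i < j := h.mono.lt_iff_lt.1 (by omega)
    have h2 : j < i + 1 := h.mono.lt_iff_lt.1 (by omega)
    rw [Fin.lt_def] at h1 h2
    omega

theorem flips_next (h : S.Crosses d m) (i : Fin t) : S.Flips (next S m i) (d (i + 1)) := by
  unfold next
  split_ifs
  · exact (h.flips _).add_h h.even
  · simpa using h.flips (i + 1)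

theorem lt_next (h : S.Crosses d m) (i : Fin t) : m i < next S m i := by
  have hv := Fin.val_add_one_eq_ite i
  unfold next
  split_ifs at hv ⊢
  · have := h.lt_h i
    omega
  · have : m i < m (i + 1) := h.mono (by rw [Fin.lt_def]; omega)
    omega

theorem next_lt (h : S.Crosses d m) (ht : 2 ≤ t) (i : Fin t) : next S m i < m i + S.h := by
  have hv := Fin.val_add_one_eq_ite i
  unfold next
  split_ifs at hv ⊢
  · have : m (i + 1) < m i := h.mono (by rw [Fin.lt_def]; omega)
    omega
  · have := h.lt_h (i + 1)
    omega

theorem sum_add_one {M : Type*} [AddCommMonoid M] (f : Fin t → M) :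
    ∑ i, f (i + 1) = ∑ i, f i :=
  Equiv.sum_comp (Equiv.addRight (1 : Fin t)) f

/-- The gaps telescope around the cycle. The last one wraps around and contributes the halfperiod.
-/
theorem sum_next_sub (S : AllowableSequence N) (m : Fin t → ℕ) :
    ∑ i, (next S m i - m i) = (S.h : ℤ) := by
  unfold next
  have ht := NeZero.pos t
  rw [Finset.sum_sub_distrib, Finset.sum_add_distrib, sum_add_one fun i => (m i : ℤ),
    add_sub_cancel_left, Finset.sum_eq_single (⟨t - 1, by omega⟩ : Fin t)]
  · rw [if_pos]
    dsimp only
    omega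
  · intro j _ hj
    rw [if_neg]
    rw [Ne, Fin.ext_iff] at hj
    dsimp only at hj
    omega
  · simp

/-- In the near-critical case, Ungar's estimate is sharp. -/
theorem next_eq (h : S.Crosses d m) (ht : 2 ≤ t) (hd : ∀ j, 0 < d j) (hh : S.h = N) (i : Fin t) :
    next S m i = m i + d i + d (i + 1) := by
  have hle : ∀ i ∈ (Finset.univ : Finset (Fin t)), ((d i : ℤ) + d (i + 1)) ≤ next S m i - m i := by
    intro i _
    have := (h.flips i).add_le (h.flips_next i) h.even h.symmetric (hd _) (hd _) (h.le_card _)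
      (h.lt_next i) (h.next_lt ht i) fun k hk hk' => h.flips_between i hk hk'
    omega
  -- The left side is 2 Σ d_j ≥ N = h, the right side is h, and Ungar's estimate compares them
  -- termwise. Equality of the sums makes every term equal.
  have hsum : ∑ i, ((d i : ℤ) + d (i + 1)) = ∑ i, (next S m i - m i) := by
    refine le_antisymm (Finset.sum_le_sum hle) ?_
    rw [sum_next_sub, Finset.sum_add_distrib, sum_add_one fun i => (d i : ℤ), hh]
    have := h.card_le
    rw [← Finset.mul_sum] at this
    zify at this
    linarith
  have := (Finset.sum_eq_sum_iff_of_le hle).1 hsum i (Finset.mem_univ i)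
  linarith

theorem IsAt.next {T : ℤ} {i : Fin t} (hT : IsAt S m T i) (h : S.Crosses d m) (ht : 2 ≤ t)
    (hd : ∀ j, 0 < d j) (hh : S.h = N) : IsAt S m (T + d i + d (i + 1)) (i + 1) := by
  obtain ⟨k, rfl⟩ := hT
  have := h.next_eq ht hd hh i
  unfold Crosses.next at this
  split_ifs at this
  · exact ⟨k + 1, by linarith⟩
  · exact ⟨k, by linarith⟩

theorem IsAt.flips_zero {T : ℤ} {i : Fin t} (hT : IsAt S m T i) (h : S.Crosses d m) (ht : 2 ≤ t)
    (hd : ∀ j, 0 < d j) (hh : S.h = N) {k : ℤ} (hk : T < k) (hk' : k < T + d i + d (i + 1)) :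
    S.Flips k 0 := by
  obtain ⟨l, rfl⟩ := hT
  have := h.flips_between i (k := k - l * S.h) (by linarith)
    (by rw [h.next_eq ht hd hh i]; linarith)
  have := this.add_mul_h h.even l
  rwa [sub_add_cancel] at this

end Crosses

/-! ### The pattern D, 1, 1, e of crossings. -/

/-- Four consecutive crossing moves, the middle ones being transpositions, at the smallest possible
distances. -/
structure Pattern (S : AllowableSequence N) (T : ℤ) (D e : ℕ) : Prop where
  even : Even N
  symmetric : S.CentrallySymmetric
  le_card : 2 * D ≤ N
  two_le : 2 ≤ D
  pos : 0 < e
  le_h : D + 4 + e ≤ S.h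
  flips_first : S.Flips T D
  flips_zero_first : ∀ k, T < k → k < T + D + 1 → S.Flips k 0
  flips_second : S.Flips (T + D + 1) 1
  flips_zero_second : S.Flips (T + D + 2) 0
  flips_third : S.Flips (T + D + 3) 1
  flips_zero_third : ∀ k, T + D + 3 < k → k < T + D + 4 + e → S.Flips k 0
  flips_fourth : S.Flips (T + D + 4 + e) e

/-- The exact gaps give the times. The block returns at `m i + h`, and the fourth crossing is that
return precisely when i + 3 = i modulo t, that is, for t = 3. -/
theorem IsDC.exists_pattern {t : ℕ} [NeZero t] (ht : 3 ≤ t) {d : Fin t → ℕ} (hd : ∀ j, 0 < d j)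
    {i : Fin t} (hi : 2 ≤ d i) (hi1 : d (i + 1) = 1) (hi2 : d (i + 2) = 1) (hS : S.IsDC d) :
    ∃ T e, S.Pattern T (d i) e ∧ ((t = 3 ∧ e = d i ∧ S.h = 2 * d i + 4 ∧ N = 2 * d i + 4) ∨
      (t ≠ 3 ∧ d i + 4 + e < S.h)) := by
  obtain ⟨m, h⟩ := hS.crosses
  have hh := hS.evenNearCritical.2
  have ht2 : 2 ≤ t := by omega
  have e2 : i + 1 + 1 = i + 2 := by
    rw [add_assoc]
    congr 1
    ext
    simp [Fin.val_add]
  have e3 : i + 2 + 1 = i + 3 := by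
    rw [add_assoc]
    congr 1
    ext
    simp [Fin.val_add]
  have a0 : Crosses.IsAt S m (m i : ℤ) i := ⟨0, by simp⟩
  have a1 := a0.next h ht2 hd hh
  have a2 := a1.next h ht2 hd hh
  have a3 := a2.next h ht2 hd hh
  have z0 := fun k => a0.flips_zero h ht2 hd hh (k := k)
  have z1 := fun k => a1.flips_zero h ht2 hd hh (k := k)
  have z2 := fun k => a2.flips_zero h ht2 hd hh (k := k)
  rw [e2] at a2 a3 z1 z2
  rw [e3] at a3 z2
  simp only [hi1, hi2] at a1 a2 a3 z0 z1 z2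
  have f0 := a0.flips h
  have f1 := a1.flips h
  have f2 := a2.flips h
  have f3 := a3.flips h
  rw [hi1] at f1
  rw [hi2] at f2
  have ah : Crosses.IsAt S m ((m i : ℤ) + S.h) i := ⟨1, by simp⟩
  have fh := ah.flips h
  have hN2 := h.le_card i
  -- The move `m i + h` is again a crossing, so it is not among the moves that keep every point on
  -- its side.
  have nz : ∀ k : ℤ, S.Flips k 0 → k ≠ m i + S.h := by
    rintro k hk rfl
    obtain ⟨p, hp⟩ := S.exists_coord_eq h.even (m i + S.h) (x := 1) (by norm_num)
      (by rw [abs_one]; omega)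
    have g1 := fh.inner p (by rw [hp, abs_one]; omega)
    have g2 := hk.pos_iff (p := p) (by rw [hp]; simp)
    omega
  have v1 := Fin.val_add_one_eq_ite i
  have v2 := Fin.val_add_one_eq_ite (i + 1)
  have v3 := Fin.val_add_one_eq_ite (i + 2)
  rw [e2] at v2
  rw [e3] at v3
  have hil := i.isLt
  have hpos := S.h_pos
  have hd3 := hd (i + 3)
  -- The return of the block can lie neither strictly between two of the crossings nor at one with
  -- index i + 1 or i + 2.
  have b1 : (m i : ℤ) + d i + 1 < m i + S.h := by
    by_contra hb
    rcases (not_lt.1 hb).lt_or_eq with hb | hb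
    · exact nz _ (z0 _ (by omega) (by push_cast; omega)) rfl
    · have := Crosses.IsAt.unique h (hb ▸ a1 : Crosses.IsAt S m (m i + S.h) (i + 1)) ah
      rw [Fin.ext_iff] at this
      split_ifs at v1 <;> omega
  have b2 : (m i : ℤ) + d i + 3 < m i + S.h := by
    by_contra hb
    rcases (not_lt.1 hb).lt_or_eq with hb | hb
    · exact nz _ (z1 _ (by push_cast; omega) (by push_cast; omega)) rfl
    · have e : (m i : ℤ) + d i + (1 : ℕ) + (1 : ℕ) + (1 : ℕ) = m i + S.h := by push_cast; omega
      have := Crosses.IsAt.unique h (e ▸ a2) ah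
      rw [Fin.ext_iff] at this
      split_ifs at v1 v2 <;> omega
  have b3 : (m i : ℤ) + d i + 4 + d (i + 3) ≤ m i + S.h := by
    by_contra hb
    exact nz _ (z2 _ (by push_cast; omega) (by push_cast; omega)) rfl
  refine ⟨m i, d (i + 3), ⟨h.even, h.symmetric, h.le_card i, hi, hd _, by omega, f0,
    fun k hk hk' => z0 k hk (by push_cast; omega), by simpa using f1,
    z1 _ (by push_cast; omega) (by push_cast; omega), ?_,
    fun k hk hk' => z2 k (by push_cast; omega) (by push_cast; omega), ?_⟩, ?_⟩
  · convert f2 using 1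
    push_cast
    ring
  · convert f3 using 1
    push_cast
    ring
  · by_cases h3 : t = 3
    · have e : i + 3 = i := by
        rw [Fin.ext_iff]
        split_ifs at v1 v2 v3 <;> omega
      rw [e] at b3 a3 ⊢
      refine Or.inl ⟨h3, rfl, ?_⟩
      -- With three crossings the gaps add up to 2(D + 1 + 1), which determines h.
      have hsum := Crosses.sum_next_sub S m
      have hne := h.next_eq ht2 hd hh
      simp only [hne] at hsum
      have hsum' : ∑ j, ((d j : ℤ) + d (j + 1)) = S.h := by
        rw [← hsum]
        exact Finset.sum_congr rfl fun j _ => by ring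
      rw [Finset.sum_add_distrib, Crosses.sum_add_one fun j => (d j : ℤ)] at hsum'
      have : ∑ j, (d j : ℤ) = d i + d (i + 1) + d (i + 2) := by
        subst h3
        rw [Fin.sum_univ_three]
        fin_cases i
        · rfl
        · have : (d 0 : ℤ) + d 1 + d 2 = d 1 + d 2 + d 0 := by ring
          exact this
        · have : (d 0 : ℤ) + d 1 + d 2 = d 2 + d 0 + d 1 := by ring
          exact this
      rw [this, hi1, hi2] at hsum'
      push_cast at hsum'
      omega
    · right
      refine ⟨h3, ?_⟩
      by_contra hb
      have e : (m i : ℤ) + d i + (1 : ℕ) + (1 : ℕ) + (1 : ℕ) + (1 : ℕ) + (d (i + 3) : ℕ) = m i + S.h := by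
        push_cast; omega
      have := Crosses.IsAt.unique h (e ▸ a3) ah
      rw [Fin.ext_iff] at this
      split_ifs at v1 v2 v3 <;> omega

end AllowableSequence

/-! ### The paths of the points between the four crossings. -/

namespace AllowableSequence

variable {N : ℕ} {S : AllowableSequence N}

/-- In each crossing that reverses it a point meets its conjugate, which happens once in a
halfperiod. -/
theorem Flips.not_both {T T' : ℤ} {d d' : ℕ} (h : S.Flips T d) (h' : S.Flips T' d')
    (hN : Even N) (hS : S.CentrallySymmetric) (hT : T < T') (hTh : T' < T + S.h) {p : Fin N}
    (hp : |S.coord T p| < 2 * d) (hp' : |S.coord T' p| < 2 * d') : False := by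
  obtain ⟨q, hq⟩ := hS.exists_conj p
  have o := S.coord_emod_two hN T p
  have hne : p ≠ q := by
    rintro rfl
    have := hq T
    omega
  have := Swaps.eq_of_lt hne (h.swaps_conj hN hq hp) (h'.swaps_conj hN hq hp') hT.le hTh
  omega

theorem Swaps.conj {i : ℤ} {p q p' q' : Fin N} (h : S.Swaps i p q) (hne : p ≠ q)
    (hp : ∀ i, S.coord i p' = -S.coord i p) (hq : ∀ i, S.coord i q' = -S.coord i q) :
    S.Swaps i p' q' := by
  rw [swaps_iff hne] at h
  rw [swaps_iff]
  · rw [hp, hp, hq, hq]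
    have h1 : S.coord i p ≠ S.coord i q := fun e => hne (coord_inj e)
    have h2 : S.coord (i + 1) p ≠ S.coord (i + 1) q := fun e => hne (coord_inj e)
    omega
  · rintro rfl
    exact hne (coord_inj (S := S) (i := i) (by have := hp i; have := hq i; omega))

namespace Pattern

variable {T : ℤ} {D e : ℕ}

section

variable (P : S.Pattern T D e)
include P

theorem exists_block {j : ℕ} (h1 : 1 ≤ j) (hj : j ≤ D) :
    ∃ a, S.coord (T + 1) a = 2 * j - 1 :=
  S.exists_coord_eq P.even _ (by omega) (by have := P.le_card; rw [abs_lt]; omega)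

theorem coord_block {j : ℕ} (h1 : 1 ≤ j) {a : Fin N}
    (ha : S.coord (T + 1) a = 2 * j - 1) {K : ℕ} (hK : j + K ≤ D) :
    S.coord (T + 1 + K) a = 2 * j - 1 := by
  have := P.le_h
  rw [P.flips_first.coord_after P.even
    (fun k hk hk' => P.flips_zero_first _ (by omega) (by omega)) (by omega) (by omega) (by omega),
    ha]

/-- Separates the block points from the points that are central in any other crossing before T + h.
-/
theorem block_ne {j : ℕ} (h1 : 1 ≤ j) (hj : j ≤ D) {a : Fin N}
    (ha : S.coord (T + 1) a = 2 * j - 1) {T' : ℤ} {d : ℕ} (hT' : S.Flips T' d) (hT : T < T')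
    (hTh : T' < T + S.h) {p : Fin N} (hp : |S.coord T' p| < 2 * d) : p ≠ a := by
  rintro rfl
  exact P.flips_first.not_both hT' P.even P.symmetric hT hTh
    ((P.flips_first.abs_succ_lt_iff P.even).1 (by rw [abs_lt]; omega)) hp

theorem first_ne_block {y : Fin N} (hy : S.coord (T + D + 1) y = 1) {j : ℕ} (h1 : 1 ≤ j)
    (hj : j ≤ D) {a : Fin N} (ha : S.coord (T + 1) a = 2 * j - 1) : y ≠ a :=
  P.block_ne h1 hj ha P.flips_second (by omega) (by have := P.le_h; omega)
    (by rw [hy, abs_one]; norm_num)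

theorem second_ne_block {z : Fin N} (hz : S.coord (T + D + 3) z = 1) {j : ℕ} (h1 : 1 ≤ j)
    (hj : j ≤ D) {a : Fin N} (ha : S.coord (T + 1) a = 2 * j - 1) : z ≠ a :=
  P.block_ne h1 hj ha P.flips_third (by omega) (by have := P.le_h; omega)
    (by rw [hz, abs_one]; norm_num)

/-- Going backwards in time: before the move, the place of `y` belonged to a_j, and the next inner
place to a_{j-1}. So `y` came from outside, exchanging with a_j. -/
theorem first_step {y : Fin N} (hy : S.coord (T + D + 1) y = 1) {j : ℕ} (h1 : 1 ≤ j)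
    (hj : j ≤ D) {a : Fin N} (ha : S.coord (T + 1) a = 2 * j - 1)
    (hyj : S.coord (T + D + 2 - j) y = 2 * j - 1) :
    S.coord (T + D + 1 - j) y = 2 * j + 1 ∧ S.coord (T + D + 2 - j) a = 2 * j + 1 ∧
      S.Swaps (T + D + 1 - j) y a := by
  have hfl := P.flips_zero_first (T + D + 1 - j) (by omega) (by omega)
  have e1 : T + D + 2 - j = T + D + 1 - j + 1 := by ring
  have ha' := P.coord_block h1 ha (K := D - j) (by omega)
  rw [show T + 1 + ((D - j : ℕ) : ℤ) = T + D + 1 - j by omega] at ha'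
  rw [e1] at hyj ⊢
  have := hfl.diagonal P.even hyj ha' (P.first_ne_block hy h1 hj ha) (by push_cast; omega) ?_
  · exact ⟨by omega, by omega, this.2.2⟩
  · intro hc
    -- For j = 1 the inner place is across the centre, which cannot be crossed in this move.
    rcases h1.eq_or_lt with rfl | h2
    · have := hfl.pos_iff (p := y) (by rw [hc]; norm_num)
      push_cast at hyj hc this
      omega
    · obtain ⟨b, hb⟩ := P.exists_block (j := j - 1) (by omega) (by omega)
      have hb' := P.coord_block (by omega) hb (K := D - j) (by omega)
      rw [show T + 1 + ((D - j : ℕ) : ℤ) = T + D + 1 - j by omega] at hb'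
      exact P.first_ne_block hy (by omega) (by omega) hb
        (coord_inj (S := S) (i := T + D + 1 - j) (by omega))

/-- Steps inwards by one place per move, past a_D, …, a_1. -/
theorem coord_first {y : Fin N} (hy : S.coord (T + D + 1) y = 1) {j : ℕ} (hj : j ≤ D) :
    S.coord (T + D + 1 - j) y = 2 * j + 1 := by
  induction j with
  | zero => simpa using hy
  | succ j ih =>
    obtain ⟨a, ha⟩ := P.exists_block (j := j + 1) (by omega) hj
    refine (P.first_step hy (by omega) hj ha ?_).1
    rw [show T + D + 2 - ((j + 1 : ℕ) : ℤ) = T + D + 1 - j by push_cast; ring, ih (by omega)]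
    push_cast
    ring

theorem first_block {y : Fin N} (hy : S.coord (T + D + 1) y = 1) {j : ℕ} (h1 : 1 ≤ j)
    (hj : j ≤ D) {a : Fin N} (ha : S.coord (T + 1) a = 2 * j - 1) :
    S.coord (T + D + 2 - j) a = 2 * j + 1 ∧ S.Swaps (T + D + 1 - j) y a := by
  refine (P.first_step hy h1 hj ha ?_).2
  have := P.coord_first hy (j := j - 1) (by omega)
  rw [show T + D + 2 - (j : ℤ) = T + D + 1 - (j - 1 : ℕ) by omega, this]
  omega

theorem first_ne_second {y z : Fin N} (hy : |S.coord (T + D + 1) y| = 1)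
    (hz : |S.coord (T + D + 3) z| = 1) : z ≠ y := by
  rintro rfl
  exact P.flips_second.not_both P.flips_third P.even P.symmetric (by omega)
    (by have := P.le_h; have := P.two_le; omega) (by rw [hy]; norm_num) (by rw [hz]; norm_num)

theorem coord_first_conj {y y' : Fin N} (hy : S.coord (T + D + 1) y = 1)
    (hyy : ∀ i, S.coord i y' = -S.coord i y) : S.coord (T + D + 2) y' = 1 := by
  have := P.flips_second.inner y (by rw [hy]; norm_num)
  rw [show T + D + 2 = T + D + 1 + 1 by ring, hyy]
  omega

theorem coord_second_conj {z z' : Fin N} (hz : S.coord (T + D + 3) z = 1)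
    (hzz : ∀ i, S.coord i z' = -S.coord i z) : S.coord (T + D + 4) z' = 1 := by
  have := P.flips_third.inner z (by rw [hz]; norm_num)
  rw [show T + D + 4 = T + D + 3 + 1 by ring, hzz]
  omega

/-- There is a single move between the two transpositions at the centre. In it `z` must take the
place that `y'` has just reached. -/
theorem second_first_conj {y y' z : Fin N} (hy : S.coord (T + D + 1) y = 1)
    (hyy : ∀ i, S.coord i y' = -S.coord i y) (hz : S.coord (T + D + 3) z = 1) :
    S.coord (T + D + 2) z = 3 ∧ S.coord (T + D + 3) y' = 3 ∧ S.Swaps (T + D + 2) z y' := by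
  have e1 : T + D + 3 = T + D + 2 + 1 := by ring
  have hne : z ≠ y' := P.first_ne_second (by rw [hyy, hy]; norm_num) (by rw [hz]; norm_num)
  rw [e1] at hz ⊢
  refine P.flips_zero_second.diagonal P.even hz (P.coord_first_conj hy hyy) hne (by norm_num) ?_
  intro hc
  have := P.flips_zero_second.pos_iff (p := z) (by rw [hc]; norm_num)
  omega

/-- Here `z` follows `y` one place behind: `y` has just pushed a_j out by one place, and `z` takes
over that place while `y` occupies the inner neighbour. -/
theorem second_step {y z : Fin N} (hy : S.coord (T + D + 1) y = 1)
    (hz : S.coord (T + D + 3) z = 1) {j : ℕ} (h1 : 1 ≤ j)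
    (hj : j ≤ D) {a : Fin N} (ha : S.coord (T + 1) a = 2 * j - 1)
    (hzj : S.coord (T + D + 3 - j) z = 2 * j + 1) :
    S.coord (T + D + 2 - j) z = 2 * j + 3 ∧ S.coord (T + D + 3 - j) a = 2 * j + 3 ∧
      S.Swaps (T + D + 2 - j) z a := by
  -- For j = 1 the move is the second crossing, otherwise it is not a crossing. In both cases the
  -- place in question is outside the reversed central points.
  obtain ⟨d, hfl, hd⟩ : ∃ d : ℕ, S.Flips (T + D + 2 - j) d ∧ d ≤ 1 := by
    rcases h1.eq_or_lt with rfl | h2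
    · refine ⟨1, ?_, le_rfl⟩
      rw [show T + D + 2 - ((1 : ℕ) : ℤ) = T + D + 1 by push_cast; ring]
      exact P.flips_second
    · exact ⟨0, P.flips_zero_first _ (by omega) (by omega), by omega⟩
  have e1 : T + D + 3 - j = T + D + 2 - j + 1 := by ring
  rw [e1] at hzj ⊢
  have := hfl.diagonal P.even hzj (P.first_block hy h1 hj ha).1 (P.second_ne_block hz h1 hj ha)
    (by omega) ?_
  · exact ⟨by omega, by omega, this.2.2⟩
  · intro hc
    have hy' := P.coord_first hy (j := j - 1) (by omega)
    rw [show T + D + 1 - ((j - 1 : ℕ) : ℤ) = T + D + 2 - j by omega] at hy'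
    exact P.first_ne_second (y := y) (z := z) (by rw [hy]; norm_num) (by rw [hz]; norm_num)
      (coord_inj (S := S) (i := T + D + 2 - j) (by omega))

theorem coord_second {y z : Fin N} (hy : S.coord (T + D + 1) y = 1)
    (hz : S.coord (T + D + 3) z = 1) {j : ℕ} (hj : j ≤ D) :
    S.coord (T + D + 2 - j) z = 2 * j + 3 := by
  induction j with
  | zero =>
    obtain ⟨y', hyy⟩ := P.symmetric.exists_conj y
    simpa using (P.second_first_conj hy hyy hz).1
  | succ j ih =>
    obtain ⟨a, ha⟩ := P.exists_block (j := j + 1) (by omega) hj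
    refine (P.second_step hy hz (by omega) hj ha ?_).1
    rw [show T + D + 3 - ((j + 1 : ℕ) : ℤ) = T + D + 2 - j by push_cast; ring, ih (by omega)]
    push_cast
    ring

theorem second_block {y z : Fin N} (hy : S.coord (T + D + 1) y = 1)
    (hz : S.coord (T + D + 3) z = 1) {j : ℕ} (h1 : 1 ≤ j)
    (hj : j ≤ D) {a : Fin N} (ha : S.coord (T + 1) a = 2 * j - 1) :
    S.coord (T + D + 3 - j) a = 2 * j + 3 ∧ S.Swaps (T + D + 2 - j) z a := by
  refine (P.second_step hy hz h1 hj ha ?_).2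
  have := P.coord_second hy hz (j := j - 1) (by omega)
  rw [show T + D + 3 - (j : ℤ) = T + D + 2 - (j - 1 : ℕ) by omega, this]
  omega

/-- Traced backwards, `w` takes its place at the centre from `z'` and, one move earlier, the place
at coordinate 3 from `y'`. -/
theorem third_first_conj {y y' z w : Fin N} (hy : S.coord (T + D + 1) y = 1)
    (hyy : ∀ i, S.coord i y' = -S.coord i y) (hz : S.coord (T + D + 3) z = 1)
    (hw : S.coord (T + D + 4 + e) w = 1) :
    S.coord (T + D + 3) w = 5 ∧ S.Swaps (T + D + 3) w y' := by
  have hle := P.le_h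
  have hpos := P.pos
  have h2 := P.two_le
  obtain ⟨z', hzz⟩ := P.symmetric.exists_conj z
  have ne1 : ∀ {q}, |S.coord (T + D + 3) q| = 1 → w ≠ q := by
    rintro q hq rfl
    exact P.flips_third.not_both P.flips_fourth P.even P.symmetric (by omega) (by omega)
      (by rw [hq]; norm_num) (by rw [hw, abs_one]; omega)
  have ne2 : w ≠ y' := by
    rintro rfl
    exact P.flips_second.not_both P.flips_fourth P.even P.symmetric (by omega) (by omega)
      (by rw [hyy, hy]; norm_num) (by rw [hw, abs_one]; omega)
  -- The innermost point of the fourth crossing is in place e - 1 moves ahead.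
  have hw5 : S.coord (T + D + 5) w = 1 := by
    have := P.flips_fourth.coord_before P.even (K := e - 1)
      (fun k hk hk' => P.flips_zero_third _ (by omega) (by omega)) (by omega) (p := w)
      (by omega) (by omega)
    rwa [hw, show T + D + 4 + e - ((e - 1 : ℕ) : ℤ) = T + D + 5 by omega] at this
  have hf4 := P.flips_zero_third (T + D + 4) (by omega) (by omega)
  have h4 : S.coord (T + D + 4) w = 3 := by
    rw [show T + D + 5 = T + D + 4 + 1 by ring] at hw5
    refine (hf4.diagonal P.even hw5 (P.coord_second_conj hz hzz)
      (ne1 (by rw [hzz, hz]; norm_num)) (by norm_num) ?_).1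
    intro hc
    have := hf4.pos_iff (p := w) (by rw [hc]; norm_num)
    omega
  rw [show T + D + 4 = T + D + 3 + 1 by ring] at h4
  have := P.flips_third.diagonal P.even h4 (P.second_first_conj hy hyy hz).2.1 ne2
    (by norm_num) fun hc => ne1 (q := z) (by rw [hz]; norm_num)
      (coord_inj (S := S) (i := T + D + 3) (by omega))
  exact ⟨this.1, this.2.2⟩

/-- Here `w` follows `z` one place behind. The hypothesis `hlt` puts the fourth crossing before the
return of the block, so `w` is not a block point. -/
theorem third_block {y z w a b : Fin N} (hy : S.coord (T + D + 1) y = 1)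
    (hz : S.coord (T + D + 3) z = 1) (hw : S.coord (T + D + 4 + e) w = 1)
    (hlt : D + 4 + e < S.h) (ha : S.coord (T + 1) a = 1) (hb : S.coord (T + 1) b = 3) :
    S.Swaps (T + D + 2) w a ∧ S.Swaps (T + D + 1) w b := by
  have hpos := P.pos
  have h2 := P.two_le
  obtain ⟨y', hyy⟩ := P.symmetric.exists_conj y
  have hw3 := (P.third_first_conj hy hyy hz hw).1
  have hzw : w ≠ z := by
    rintro rfl
    omega
  have ne : ∀ {j : ℕ} {a}, 1 ≤ j → j ≤ D → S.coord (T + 1) a = 2 * j - 1 → w ≠ a := by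
    intro j a h1 hj ha
    exact P.block_ne h1 hj ha P.flips_fourth (by omega) (by omega) (by rw [hw, abs_one]; omega)
  have ha' : S.coord (T + 1) a = 2 * (1 : ℕ) - 1 := by rw [ha]; norm_num
  have hb' : S.coord (T + 1) b = 2 * (2 : ℕ) - 1 := by rw [hb]; norm_num
  have a2 := (P.second_block hy hz le_rfl (by omega) ha').1
  have b2 := (P.second_block hy hz (by norm_num) h2 hb').1
  rw [show T + D + 3 - ((1 : ℕ) : ℤ) = T + D + 2 by push_cast; ring] at a2
  rw [show T + D + 3 - ((2 : ℕ) : ℤ) = T + D + 1 by push_cast; ring] at b2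
  have z0 := P.coord_second hy hz (j := 0) (by omega)
  have z1 := P.coord_second hy hz (j := 1) (by omega)
  rw [show T + D + 2 - ((0 : ℕ) : ℤ) = T + D + 2 by push_cast; ring] at z0
  rw [show T + D + 2 - ((1 : ℕ) : ℤ) = T + D + 1 by push_cast; ring] at z1
  push_cast at a2 b2 z0 z1
  rw [show T + D + 3 = T + D + 2 + 1 by ring] at hw3
  have s2 := P.flips_zero_second.diagonal P.even hw3 a2 (ne le_rfl (by omega) ha') (by norm_num)
    fun hc => hzw (coord_inj (S := S) (i := T + D + 2) (by omega))
  have hw2 := s2.1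
  rw [show T + D + 2 = T + D + 1 + 1 by ring] at hw2
  have s1 := P.flips_second.diagonal P.even hw2 b2 (ne (by norm_num) h2 hb') (by norm_num)
    fun hc => hzw (coord_inj (S := S) (i := T + D + 1) (by omega))
  exact ⟨s2.2.2, s1.2.2⟩

end

/-! ### The paths when the fourth crossing is the return of the block. -/

section

variable (P : S.Pattern T D D) (hh : S.h = 2 * D + 4)
include P hh

/-- After a halfperiod the two reflections of the block cancel, so before its return the block
points come to the same places that they had after the move T. -/
theorem coord_block_before {j : ℕ} (h1 : 1 ≤ j) {a : Fin N}
    (ha : S.coord (T + 1) a = 2 * j - 1) {K : ℕ} (hK : j + K ≤ D) :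
    S.coord (T + D + 4 + D - K) a = 2 * j - 1 := by
  have hT := P.flips_first.inner_pred P.even (p := a) (by rw [ha, abs_lt]; omega)
  have e1 : T + D + 4 + D = T + S.h := by rw [hh]; push_cast; ring
  have hTh : S.coord (T + D + 4 + D) a = 2 * j - 1 := by
    rw [e1, coord_add_h, hT, neg_neg, ha]
  rw [P.flips_fourth.coord_before P.even
    (fun k hk hk' => P.flips_zero_third _ (by omega) (by omega)) (by omega) (by omega) (by omega),
    hTh]

/-- Mirror image in time of `first_step`: `z'` walks outwards while a_j returns to its final place.
-/
theorem second_conj_step {z z' : Fin N}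
    (hz : S.coord (T + D + 3) z = 1) (hzz : ∀ i, S.coord i z' = -S.coord i z) {j : ℕ}
    (h1 : 1 ≤ j) (hj : j ≤ D) {a : Fin N} (ha : S.coord (T + 1) a = 2 * j - 1)
    (hzj : S.coord (T + D + 3 + j) z' = 2 * j - 1) :
    S.coord (T + D + 3 + j) a = 2 * j + 1 ∧ S.coord (T + D + 4 + j) z' = 2 * j + 1 ∧
      S.Swaps (T + D + 3 + j) a z' := by
  have hfl := P.flips_zero_third (T + D + 3 + j) (by omega) (by omega)
  have ha' := P.coord_block_before hh h1 ha (K := D - j) (by omega)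
  rw [show T + D + 4 + D - ((D - j : ℕ) : ℤ) = T + D + 3 + j + 1 by omega] at ha'
  have hne : a ≠ z' := (P.block_ne h1 hj ha P.flips_third (by omega) (by omega)
    (by rw [hzz, hz]; norm_num)).symm
  have := hfl.diagonal P.even ha' hzj hne (by push_cast; omega) ?_
  · rw [show T + D + 4 + j = T + D + 3 + j + 1 by ring]
    exact ⟨by omega, by omega, this.2.2⟩
  · intro hc
    rcases h1.eq_or_lt with rfl | h2
    · have := hfl.pos_iff (p := a) (by rw [hc]; norm_num)
      push_cast at ha' hc this
      omega
    · obtain ⟨b, hb⟩ := P.exists_block (j := j - 1) (by omega) (by omega)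
      have hb' := P.coord_block_before hh (by omega) hb (K := D - j + 1) (by omega)
      rw [show T + D + 4 + D - ((D - j + 1 : ℕ) : ℤ) = T + D + 3 + j by omega] at hb'
      have : a = b := coord_inj (S := S) (i := T + D + 3 + j) (by omega)
      subst this
      omega

theorem coord_second_conj' {z z' : Fin N}
    (hz : S.coord (T + D + 3) z = 1) (hzz : ∀ i, S.coord i z' = -S.coord i z) {j : ℕ}
    (hj : j ≤ D) : S.coord (T + D + 4 + j) z' = 2 * j + 1 := by
  induction j with
  | zero => simpa using P.coord_second_conj hz hzz
  | succ j ih =>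
    obtain ⟨a, ha⟩ := P.exists_block (j := j + 1) (by omega) hj
    refine (P.second_conj_step hh hz hzz (by omega) hj ha ?_).2.1
    rw [show T + D + 3 + ((j + 1 : ℕ) : ℤ) = T + D + 4 + j by push_cast; ring, ih (by omega)]
    push_cast
    ring

theorem second_conj_block {z z' : Fin N}
    (hz : S.coord (T + D + 3) z = 1) (hzz : ∀ i, S.coord i z' = -S.coord i z) {j : ℕ}
    (h1 : 1 ≤ j) (hj : j ≤ D) {a : Fin N} (ha : S.coord (T + 1) a = 2 * j - 1) :
    S.coord (T + D + 3 + j) a = 2 * j + 1 ∧ S.Swaps (T + D + 3 + j) a z' := by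
  have := P.second_conj_step hh hz hzz h1 hj ha ?_
  · exact ⟨this.1, this.2.2⟩
  · have := P.coord_second_conj' hh hz hzz (j := j - 1) (by omega)
    rw [show T + D + 3 + (j : ℤ) = T + D + 4 + (j - 1 : ℕ) by omega, this]
    omega

/-- Mirror image in time of `second_step`: `y'` walks outwards one place ahead of `z'`. -/
theorem first_conj_step {y y' z : Fin N} (hy : S.coord (T + D + 1) y = 1)
    (hyy : ∀ i, S.coord i y' = -S.coord i y)
    (hz : S.coord (T + D + 3) z = 1) {j : ℕ}
    (h1 : 1 ≤ j) (hj : j ≤ D) {a : Fin N} (ha : S.coord (T + 1) a = 2 * j - 1)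
    (hyj : S.coord (T + D + 2 + j) y' = 2 * j + 1) :
    S.coord (T + D + 3 + j) y' = 2 * j + 3 ∧ S.Swaps (T + D + 2 + j) a y' := by
  obtain ⟨z', hzz⟩ := P.symmetric.exists_conj z
  obtain ⟨d, hfl, hd⟩ : ∃ d : ℕ, S.Flips (T + D + 2 + j) d ∧ d ≤ 1 := by
    rcases h1.eq_or_lt with rfl | h2
    · refine ⟨1, ?_, le_rfl⟩
      rw [show T + D + 2 + ((1 : ℕ) : ℤ) = T + D + 3 by push_cast; ring]
      exact P.flips_third
    · exact ⟨0, P.flips_zero_third _ (by omega) (by omega), by omega⟩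
  have ha' := (P.second_conj_block hh hz hzz h1 hj ha).1
  have e1 : T + D + 3 + j = T + D + 2 + j + 1 := by ring
  rw [e1] at ha' ⊢
  have hne : a ≠ y' := (P.block_ne h1 hj ha P.flips_second (by omega) (by omega)
    (by rw [hyy, hy]; norm_num)).symm
  have := hfl.diagonal P.even ha' hyj hne (by omega) ?_
  · exact ⟨by omega, this.2.2⟩
  · intro hc
    rcases h1.eq_or_lt with rfl | h2
    · rw [show T + D + 2 + ((1 : ℕ) : ℤ) = T + D + 3 by push_cast; ring] at hc
      push_cast at hc
      exact P.second_ne_block hz le_rfl hj ha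
        (coord_inj (S := S) (i := T + D + 3) (by omega))
    · obtain ⟨b, hb⟩ := P.exists_block (j := j - 1) (by omega) (by omega)
      have hb' := (P.second_conj_block hh hz hzz (by omega) (by omega) hb).1
      rw [show T + D + 3 + ((j - 1 : ℕ) : ℤ) = T + D + 2 + j by omega] at hb'
      have : a = b := coord_inj (S := S) (i := T + D + 2 + j) (by omega)
      subst this
      omega

theorem coord_first_conj' {y y' z : Fin N} (hy : S.coord (T + D + 1) y = 1)
    (hyy : ∀ i, S.coord i y' = -S.coord i y)
    (hz : S.coord (T + D + 3) z = 1) {j : ℕ}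
    (hj : j ≤ D) : S.coord (T + D + 3 + j) y' = 2 * j + 3 := by
  induction j with
  | zero => simpa using (P.second_first_conj hy hyy hz).2.1
  | succ j ih =>
    obtain ⟨a, ha⟩ := P.exists_block (j := j + 1) (by omega) hj
    refine (P.first_conj_step hh hy hyy hz (by omega) hj ha ?_).1
    rw [show T + D + 2 + ((j + 1 : ℕ) : ℤ) = T + D + 3 + j by push_cast; ring, ih (by omega)]
    push_cast
    ring

theorem first_conj_block {y y' z : Fin N} (hy : S.coord (T + D + 1) y = 1)
    (hyy : ∀ i, S.coord i y' = -S.coord i y)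
    (hz : S.coord (T + D + 3) z = 1) {j : ℕ}
    (h1 : 1 ≤ j) (hj : j ≤ D) {a : Fin N} (ha : S.coord (T + 1) a = 2 * j - 1) :
    S.Swaps (T + D + 2 + j) a y' := by
  refine (P.first_conj_step hh hy hyy hz h1 hj ha ?_).2
  have := P.coord_first_conj' hh hy hyy hz (j := j - 1) (by omega)
  rw [show T + D + 2 + (j : ℤ) = T + D + 3 + (j - 1 : ℕ) by omega, this]
  omega

/-- The two points outside the block after the first crossing move. -/
theorem coord_start {y z : Fin N} (hy : S.coord (T + D + 1) y = 1)
    (hz : S.coord (T + D + 3) z = 1) :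
    S.coord (T + 1) y = 2 * D + 1 ∧ S.coord (T + 1) z = 2 * D + 3 ∧ S.Swaps T y z := by
  obtain ⟨z', hzz⟩ := P.symmetric.exists_conj z
  have h1 := P.coord_first hy (j := D) le_rfl
  rw [show T + D + 1 - (D : ℤ) = T + 1 by ring] at h1
  -- The outward path of `z'` ends at T + h, which by antiperiodicity shows that `z` is at 2D + 1
  -- before the move T. After it `y` is there, so the two were transposed.
  have h2 := P.coord_second_conj' hh hz hzz (j := D) le_rfl
  rw [show T + D + 4 + (D : ℤ) = T + S.h by rw [hh]; push_cast; ring, coord_add_h, hzz] at h2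
  have hne : z ≠ y := P.first_ne_second (by rw [hy, abs_one]) (by rw [hz, abs_one])
  have hd := (P.flips_first.abs_succ_lt_iff P.even (p := y)).not.1 (by rw [h1, abs_lt]; omega)
  have o := S.coord_emod_two P.even T y
  have habs : 2 * (D : ℤ) < |S.coord T y| := by
    rw [abs_lt] at hd
    rw [lt_abs]
    omega
  rcases P.flips_first.outer y habs with h3 | ⟨q, h3, h4, h5, h6, h7⟩
  · exact absurd (coord_inj (S := S) (i := T) (by omega)) hne
  · obtain rfl : q = z := coord_inj (S := S) (i := T) (by omega)
    have hd' := (P.flips_first.abs_succ_lt_iff P.even (p := q)).not.2 (by omega)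
    rw [abs_lt] at hd'
    have o' := S.coord_emod_two P.even (T + 1) q
    have e : S.coord (T + 1) q = 2 * D + 3 := by omega
    exact ⟨h1, e, (Swaps.of_lt (p := q) (q := y) (by omega) (by omega)).symm⟩

end

end Pattern

end AllowableSequence

/-! ### Uniqueness of the sequence for three crossings. -/

namespace AllowableSequence

variable {N : ℕ} {S : AllowableSequence N}

/-- In every sequence with signature `(D, 1, 1)`, the points at the positions `u` and `w` after the
first crossing move are switched `τ` moves after the first one. -/
def SwapTime (D : ℕ) (u w τ : ℤ) : Prop :=
  0 ≤ τ ∧ τ < 2 * D + 4 ∧ ∀ {N : ℕ} (S : AllowableSequence N) (T : ℤ), S.Pattern T D D →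
    S.h = 2 * D + 4 → ∀ p q, S.coord (T + 1) p = u → S.coord (T + 1) q = w → S.Swaps (T + τ) p q

namespace SwapTime

variable {D : ℕ} {u w τ : ℤ}

theorem symm (h : SwapTime D u w τ) : SwapTime D w u τ :=
  ⟨h.1, h.2.1, fun S T P hh p q hp hq => (h.2.2 S T P hh q p hq hp).symm⟩

theorem neg (h : SwapTime D u w τ) (hne : u ≠ w) : SwapTime D (-u) (-w) τ := by
  refine ⟨h.1, h.2.1, fun S T P hh p q hp hq => ?_⟩
  obtain ⟨p', hp'⟩ := P.symmetric.exists_conj p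
  obtain ⟨q', hq'⟩ := P.symmetric.exists_conj q
  have e1 := hp' (T + 1)
  have e2 := hq' (T + 1)
  refine (h.2.2 S T P hh p' q' (by omega) (by omega)).conj ?_ (fun i => by rw [hp', neg_neg])
    (fun i => by rw [hq', neg_neg])
  rintro rfl
  omega

theorem block (hu : |u| < 2 * D) (hw : |w| < 2 * D) (hne : u ≠ w) : SwapTime D u w 0 := by
  refine ⟨le_rfl, by omega, fun S T P hh p q hp hq => ?_⟩
  rw [add_zero]
  refine P.flips_first.swaps_inner ?_ ((P.flips_first.abs_succ_lt_iff P.even).1 (by rwa [hp]))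
    ((P.flips_first.abs_succ_lt_iff P.even).1 (by rwa [hq]))
  rintro rfl
  exact hne (hp.symm.trans hq)

theorem exists_points {T : ℤ} (P : S.Pattern T D D) (hh : S.h = 2 * D + 4) :
    ∃ y z y' z', S.coord (T + D + 1) y = 1 ∧ S.coord (T + D + 3) z = 1 ∧
      (∀ i, S.coord i y' = -S.coord i y) ∧ (∀ i, S.coord i z' = -S.coord i z) ∧
      (∀ p, S.coord (T + 1) p = 2 * D + 1 → p = y) ∧
      (∀ p, S.coord (T + 1) p = 2 * D + 3 → p = z) ∧
      (∀ p, S.coord (T + 1) p = -(2 * D + 1) → p = y') ∧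
      (∀ p, S.coord (T + 1) p = -(2 * D + 3) → p = z') := by
  have hN : |(1 : ℤ)| < N := by
    have := P.le_card
    have := P.two_le
    rw [abs_one]
    omega
  obtain ⟨y, hy⟩ := S.exists_coord_eq P.even (T + D + 1) (x := 1) (by norm_num) hN
  obtain ⟨z, hz⟩ := S.exists_coord_eq P.even (T + D + 3) (x := 1) (by norm_num) hN
  obtain ⟨y', hyy⟩ := P.symmetric.exists_conj y
  obtain ⟨z', hzz⟩ := P.symmetric.exists_conj z
  obtain ⟨e1, e2, -⟩ := P.coord_start hh hy hz
  have e3 := hyy (T + 1)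
  have e4 := hzz (T + 1)
  exact ⟨y, z, y', z', hy, hz, hyy, hzz, fun p hp => coord_inj (hp.trans e1.symm),
    fun p hp => coord_inj (hp.trans e2.symm),
    fun p hp => coord_inj (S := S) (i := T + 1) (by omega),
    fun p hp => coord_inj (S := S) (i := T + 1) (by omega)⟩

theorem outer_block {j : ℕ} (h1 : 1 ≤ j) (hj : j ≤ D) :
    SwapTime D (2 * D + 1) (2 * j - 1) (D + 1 - j) ∧
    SwapTime D (2 * D + 3) (2 * j - 1) (D + 2 - j) ∧
    SwapTime D (-(2 * D + 1)) (2 * j - 1) (D + 2 + j) ∧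
    SwapTime D (-(2 * D + 3)) (2 * j - 1) (D + 3 + j) := by
  refine ⟨⟨by omega, by omega, fun S T P hh p q hp hq => ?_⟩,
    ⟨by omega, by omega, fun S T P hh p q hp hq => ?_⟩,
    ⟨by omega, by omega, fun S T P hh p q hp hq => ?_⟩,
    ⟨by omega, by omega, fun S T P hh p q hp hq => ?_⟩⟩ <;>
  obtain ⟨y, z, y', z', hy, hz, hyy, hzz, fy, fz, fy', fz'⟩ := exists_points P hh
  · rw [fy p hp, show T + ((D : ℤ) + 1 - j) = T + D + 1 - j by ring]
    exact (P.first_block hy h1 hj hq).2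
  · rw [fz p hp, show T + ((D : ℤ) + 2 - j) = T + D + 2 - j by ring]
    exact (P.second_block hy hz h1 hj hq).2
  · rw [fy' p hp, show T + ((D : ℤ) + 2 + j) = T + D + 2 + j by ring]
    exact (P.first_conj_block hh hy hyy hz h1 hj hq).symm
  · rw [fz' p hp, show T + ((D : ℤ) + 3 + j) = T + D + 3 + j by ring]
    exact (P.second_conj_block hh hz hzz h1 hj hq).2.symm

theorem outer_outer :
    SwapTime D (2 * D + 1) (-(2 * D + 1)) (D + 1) ∧
    SwapTime D (2 * D + 3) (-(2 * D + 3)) (D + 3) ∧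
    SwapTime D (2 * D + 1) (2 * D + 3) 0 ∧
    SwapTime D (2 * D + 3) (-(2 * D + 1)) (D + 2) := by
  refine ⟨⟨by omega, by omega, fun S T P hh p q hp hq => ?_⟩,
    ⟨by omega, by omega, fun S T P hh p q hp hq => ?_⟩,
    ⟨by omega, by omega, fun S T P hh p q hp hq => ?_⟩,
    ⟨by omega, by omega, fun S T P hh p q hp hq => ?_⟩⟩ <;>
  obtain ⟨y, z, y', z', hy, hz, hyy, hzz, fy, fz, fy', fz'⟩ := exists_points P hh
  · rw [fy p hp, fy' q hq, ← add_assoc]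
    exact P.flips_second.swaps_conj P.even hyy (by rw [hy]; norm_num)
  · rw [fz p hp, fz' q hq, ← add_assoc]
    exact P.flips_third.swaps_conj P.even hzz (by rw [hz]; norm_num)
  · rw [fy p hp, fz q hq, add_zero]
    exact (P.coord_start hh hy hz).2.2
  · rw [fz p hp, fy' q hq, ← add_assoc]
    exact (P.second_first_conj hy hyy hz).2.2

/-- With 2D + 4 positions, each pair lies in the block, or joins one of the four outer positions to
the block, or is a pair of outer ones. Conjugation reduces block positions to the positive side. -/
theorem exists_of_ne (hu : u % 2 = 1) (hw : w % 2 = 1) (hu' : |u| < 2 * D + 4)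
    (hw' : |w| < 2 * D + 4) (hne : u ≠ w) : ∃ τ, SwapTime D u w τ := by
  have split : ∀ x : ℤ, x % 2 = 1 → |x| < 2 * D + 4 → |x| < 2 * D ∨
      (x = 2 * D + 1 ∨ x = 2 * D + 3 ∨ x = -(2 * D + 1) ∨ x = -(2 * D + 3)) := by
    intro x hx hx'
    rw [abs_lt] at *
    omega
  have outer_block' : ∀ x y : ℤ, y % 2 = 1 → |y| < 2 * D →
      (x = 2 * D + 1 ∨ x = 2 * D + 3 ∨ x = -(2 * D + 1) ∨ x = -(2 * D + 3)) →
      ∃ τ, SwapTime D x y τ := by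
    intro x y hy hy' hx
    rw [abs_lt] at hy'
    rcases lt_or_ge 0 y with hpos | hneg
    · obtain ⟨j, rfl⟩ : ∃ j : ℕ, y = 2 * j - 1 := ⟨((y + 1) / 2).toNat, by omega⟩
      obtain ⟨s1, s2, s3, s4⟩ := outer_block (D := D) (j := j) (by omega) (by omega)
      rcases hx with rfl | rfl | rfl | rfl
      exacts [⟨_, s1⟩, ⟨_, s2⟩, ⟨_, s3⟩, ⟨_, s4⟩]
    · obtain ⟨j, rfl⟩ : ∃ j : ℕ, y = -(2 * j - 1) := ⟨((-y + 1) / 2).toNat, by omega⟩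
      obtain ⟨s1, s2, s3, s4⟩ := outer_block (D := D) (j := j) (by omega) (by omega)
      rcases hx with rfl | rfl | rfl | rfl
      · exact ⟨_, by simpa only [neg_neg] using s3.neg (by omega)⟩
      · exact ⟨_, by simpa only [neg_neg] using s4.neg (by omega)⟩
      · exact ⟨_, s1.neg (by omega)⟩
      · exact ⟨_, s2.neg (by omega)⟩
  obtain ⟨s1, s2, s3, s4⟩ := outer_outer (D := D)
  rcases split u hu hu' with h1 | h1 <;> rcases split w hw hw' with h2 | h2
  · exact ⟨0, block h1 h2 hne⟩
  · obtain ⟨τ, h⟩ := outer_block' w u hu h1 h2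
    exact ⟨τ, h.symm⟩
  · exact outer_block' u w hw h2 h1
  · have s3' := s3.neg (by omega)
    have s4' := s4.neg (by omega)
    rw [neg_neg] at s4'
    rcases h1 with rfl | rfl | rfl | rfl <;> rcases h2 with rfl | rfl | rfl | rfl <;>
    first
    | exact absurd rfl hne
    | exact ⟨_, s1⟩
    | exact ⟨_, s1.symm⟩
    | exact ⟨_, s2⟩
    | exact ⟨_, s2.symm⟩
    | exact ⟨_, s3⟩
    | exact ⟨_, s3.symm⟩
    | exact ⟨_, s3'⟩
    | exact ⟨_, s3'.symm⟩
    | exact ⟨_, s4⟩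
    | exact ⟨_, s4.symm⟩
    | exact ⟨_, s4'⟩
    | exact ⟨_, s4'.symm⟩

end SwapTime

/-- The order of two points after `k` moves is determined by the time of their switch. -/
theorem Swaps.lt_iff {T τ : ℤ} {p q : Fin N} (hne : p ≠ q) (h : S.Swaps (T + τ) p q)
    (h0 : 0 ≤ τ) (hτ : τ < S.h) {k : ℕ} (h1 : 1 ≤ k) (hk : k ≤ S.h) :
    S.coord (T + k) p < S.coord (T + k) q ↔
      ((1 ≤ τ ∧ τ < k) ↔ ¬ S.coord (T + 1) p < S.coord (T + 1) q) := by
  induction k, h1 using Nat.le_induction with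
  | base =>
    -- The comparison starts after the move T, so a switch with τ = 0 does not count.
    have : ¬ (1 ≤ τ ∧ τ < ((1 : ℕ) : ℤ)) := by
      push_cast
      omega
    rw [iff_false_left this, not_not, Nat.cast_one]
  | succ k h1 ih =>
    have ih := ih (by omega)
    have hd : S.coord (T + k) p ≠ S.coord (T + k) q := fun e => hne (coord_inj e)
    have hd' : S.coord (T + k + 1) p ≠ S.coord (T + k + 1) q := fun e => hne (coord_inj e)
    have e := swaps_iff (S := S) (i := T + k) hne
    push_cast
    rw [← add_assoc]
    by_cases hc : τ = k
    · subst hc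
      have := e.1 h
      have h3 : ¬ (1 ≤ (k : ℤ) ∧ (k : ℤ) < k) := by omega
      have h4 : (1 ≤ (k : ℤ) ∧ (k : ℤ) < k + 1) := by omega
      rw [iff_false_left h3, not_not] at ih
      rw [iff_true_left h4]
      omega
    · have hns : ¬ S.Swaps (T + k) p q := by
        intro hs
        rcases lt_or_gt_of_ne hc with hlt | hlt
        · have := Swaps.eq_of_lt hne h hs (by omega) (by omega)
          omega
        · have := Swaps.eq_of_lt hne hs h (by omega) (by omega)
          omega
      have h3 : (1 ≤ τ ∧ τ < (k : ℤ) + 1) ↔ (1 ≤ τ ∧ τ < (k : ℤ)) := by omega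
      rw [h3, ← ih]
      rw [e] at hns
      omega

/-- All sequences with signature `(D, 1, 1)` are equal up to the labels and the indices. -/
theorem Pattern.coord_eq {S' : AllowableSequence N} {D : ℕ} {T T' : ℤ} (P : S.Pattern T D D)
    (P' : S'.Pattern T' D D) (hh : S.h = 2 * D + 4) (hh' : S'.h = 2 * D + 4)
    (hN : N = 2 * D + 4) {k : ℕ} (h1 : 1 ≤ k) (hk : k ≤ S.h) {p p' : Fin N}
    (hp : S.coord (T + 1) p = S'.coord (T' + 1) p') :
    S.coord (T + k) p = S'.coord (T' + k) p' := by
  have perm_eq : ∀ {i i' : ℤ} {p p' : Fin N}, S.coord i p = S'.coord i' p' ↔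
      S.perm i p = S'.perm i' p' := by
    intro i i' p p'
    unfold coord
    rw [Fin.ext_iff]
    omega
  let f : Fin N → Fin N := fun p => (S'.perm (T' + 1)).symm (S.perm (T + 1) p)
  have hf : ∀ p, S.coord (T + 1) p = S'.coord (T' + 1) (f p) := by
    intro p
    rw [perm_eq, Equiv.apply_symm_apply]
  obtain rfl : p' = f p := coord_inj (S := S') (i := T' + 1) (by rw [← hp, hf])
  -- Corresponding points have the same switch times, so both sequences order them alike. A strictly
  -- increasing map of `Fin N` to itself is the identity.
  have hmono : StrictMono fun x => S'.perm (T' + k) (f ((S.perm (T + k)).symm x)) := by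
    intro x y hxy
    dsimp only
    obtain ⟨p, rfl⟩ := (S.perm (T + k)).surjective x
    obtain ⟨q, rfl⟩ := (S.perm (T + k)).surjective y
    rw [Equiv.symm_apply_apply, Equiv.symm_apply_apply, ← coord_lt_iff]
    rw [← coord_lt_iff] at hxy
    have hne : p ≠ q := by
      rintro rfl
      exact lt_irrefl _ hxy
    have hb := S.abs_coord_lt (T + 1) p
    have hb' := S.abs_coord_lt (T + 1) q
    obtain ⟨τ, h2, h3, hτ⟩ := SwapTime.exists_of_ne (D := D) (S.coord_emod_two P.even (T + 1) p)
      (S.coord_emod_two P.even (T + 1) q) (by omega) (by omega) (fun e => hne (coord_inj e))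
    have s1 := hτ S T P hh p q rfl rfl
    have s2 := hτ S' T' P' hh' (f p) (f q) (hf p).symm (hf q).symm
    have hne' : f p ≠ f q := fun e => hne (by simpa [f] using e)
    have i1 := s1.lt_iff hne h2 (by omega) h1 hk
    have i2 := s2.lt_iff hne' h2 (by omega) h1 (by omega)
    rw [← hf, ← hf] at i2
    rw [i2, ← i1]
    exact hxy
  have hid : (fun x => S'.perm (T' + k) (f ((S.perm (T + k)).symm x))) = id := by
    refine (hmono.range_inj strictMono_id).1 ?_
    rw [Set.range_id, Set.range_eq_univ]
    exact Finite.surjective_of_injective hmono.injective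
  rw [perm_eq]
  have := congrFun hid (S.perm (T + k) p)
  simpa using this.symm

theorem Pattern.coord_eq_int {S' : AllowableSequence N} {D : ℕ} {T T' : ℤ} (P : S.Pattern T D D)
    (P' : S'.Pattern T' D D) (hh : S.h = 2 * D + 4) (hh' : S'.h = 2 * D + 4)
    (hN : N = 2 * D + 4) (k : ℤ) {p p' : Fin N}
    (hp : S.coord (T + 1) p = S'.coord (T' + 1) p') :
    S.coord (T + k) p = S'.coord (T' + k) p' := by
  have step : ∀ k : ℤ, S.coord (T + k) p = S'.coord (T' + k) p' ↔
      S.coord (T + (k + S.h)) p = S'.coord (T' + (k + S.h)) p' := by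
    intro k
    rw [← add_assoc, coord_add_h, ← add_assoc, hh, ← hh', coord_add_h, neg_inj]
  have hk : ∀ l : ℤ, ∀ k : ℤ, S.coord (T + k) p = S'.coord (T' + k) p' ↔
      S.coord (T + (k + l * S.h)) p = S'.coord (T' + (k + l * S.h)) p' := by
    intro l k
    induction l with
    | zero => simp
    | succ l ih =>
      rw [ih, step, add_mul, one_mul, add_assoc k]
    | pred l ih =>
      rw [ih, step (k + (-(l : ℤ) - 1) * S.h), sub_mul, one_mul, add_sub_assoc', sub_add_cancel]
  have hpos := S.h_pos
  -- The shift by one gives representatives 1, …, h instead of 0, …, h - 1, as `coord_eq` starts at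
  -- 1.
  have hb := Int.emod_nonneg (k - 1) (b := S.h) (by omega)
  have hb' := Int.emod_lt_of_pos (k - 1) (b := S.h) (by omega)
  have he := Int.emod_add_mul_ediv (k - 1) S.h
  have := P.coord_eq P' hh hh' hN (k := ((k - 1) % S.h + 1).toNat) (by omega) (by omega) hp
  rw [show (((k - 1) % S.h + 1).toNat : ℤ) = (k - 1) % S.h + 1 by omega,
    hk ((k - 1) / S.h)] at this
  rwa [show (k - 1) % S.h + 1 + (k - 1) / S.h * S.h = k by linarith] at this

end AllowableSequence

/-! ### Determinants, affine frames and projections in the plane. -/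

/-- The determinant of two vectors in the plane. -/
def planeDet (a b : ℝ × ℝ) : ℝ := a.1 * b.2 - a.2 * b.1

theorem planeDet_smul_right (a : ℝ × ℝ) (k : ℝ) : planeDet a (k • a) = 0 := by
  simp only [planeDet, Prod.smul_fst, Prod.smul_snd, smul_eq_mul]
  ring

theorem exists_smul_eq_of_planeDet_eq_zero {a b : ℝ × ℝ} (ha : a ≠ 0) (h : planeDet a b = 0) :
    ∃ k : ℝ, b = k • a := by
  unfold planeDet at h
  have hpos : a.1 ^ 2 + a.2 ^ 2 ≠ 0 := by
    intro h0
    refine ha (Prod.ext ?_ ?_)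
    · exact pow_eq_zero_iff two_ne_zero |>.1 (by nlinarith [sq_nonneg a.1, sq_nonneg a.2])
    · exact pow_eq_zero_iff two_ne_zero |>.1 (by nlinarith [sq_nonneg a.1, sq_nonneg a.2])
  refine ⟨(a.1 * b.1 + a.2 * b.2) / (a.1 ^ 2 + a.2 ^ 2), Prod.ext ?_ ?_⟩
  · simp only [Prod.smul_fst, smul_eq_mul]
    field_simp
    linear_combination a.2 * -h
  · simp only [Prod.smul_snd, smul_eq_mul]
    field_simp
    linear_combination a.1 * h

/-- The affine coordinates with respect to the frame with origin `o` and basis `A`, `B`. -/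
noncomputable def frameEquiv (o A B : ℝ × ℝ) (h : planeDet A B ≠ 0) :
    (ℝ × ℝ) ≃ᵃ[ℝ] (ℝ × ℝ) where
  -- Cramer's rule.
  toFun x := (planeDet (x - o) B / planeDet A B, planeDet A (x - o) / planeDet A B)
  invFun x := o + (x.1 • A + x.2 • B)
  left_inv x := by
    have hd : planeDet A B = A.1 * B.2 - A.2 * B.1 := rfl
    generalize planeDet A B = Δ at *
    ext <;> simp [planeDet] <;> field_simp <;> rw [hd] <;> ring
  right_inv x := by
    have hd : planeDet A B = A.1 * B.2 - A.2 * B.1 := rfl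
    generalize planeDet A B = Δ at *
    ext <;> simp [planeDet] <;> field_simp <;> rw [hd] <;> ring
  linear :=
    { toFun x := (planeDet x B / planeDet A B, planeDet A x / planeDet A B)
      invFun x := x.1 • A + x.2 • B
      left_inv x := by
        have hd : planeDet A B = A.1 * B.2 - A.2 * B.1 := rfl
        generalize planeDet A B = Δ at *
        ext <;> simp [planeDet] <;> field_simp <;> rw [hd] <;> ring
      right_inv x := by
        have hd : planeDet A B = A.1 * B.2 - A.2 * B.1 := rfl
        generalize planeDet A B = Δ at *
        ext <;> simp [planeDet] <;> field_simp <;> rw [hd] <;> ring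
      map_add' x y := by
        unfold planeDet
        ext <;> simp <;> ring
      map_smul' x y := by
        unfold planeDet
        ext <;> simp <;> ring }
  map_vadd' x y := by
    simp only [planeDet, vadd_eq_add, Equiv.coe_fn_mk, LinearEquiv.coe_mk, LinearMap.coe_mk,
      AddHom.coe_mk]
    ext <;> simp <;> ring

theorem frameEquiv_apply (o A B : ℝ × ℝ) (h : planeDet A B ≠ 0) (x : ℝ × ℝ) :
    frameEquiv o A B h x =
      (planeDet (x - o) B / planeDet A B, planeDet A (x - o) / planeDet A B) := rfl

theorem frameEquiv_add (o A B : ℝ × ℝ) (h : planeDet A B ≠ 0) (s t : ℝ) :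
    frameEquiv o A B h (o + (s • A + t • B)) = (s, t) :=
  (frameEquiv o A B h).toEquiv.apply_symm_apply (s, t)

theorem proj_sub (φ : ℝ) (x y : ℝ × ℝ) : proj φ (x - y) = proj φ x - proj φ y := by
  simp only [proj, Prod.fst_sub, Prod.snd_sub]
  ring

theorem continuous_proj (x : ℝ × ℝ) : Continuous fun φ => proj φ x := by
  unfold proj
  fun_prop

theorem proj_smul (φ k : ℝ) (x : ℝ × ℝ) : proj φ (k • x) = k * proj φ x := by
  simp only [proj, Prod.smul_fst, Prod.smul_snd, smul_eq_mul]
  ring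

theorem planeDet_eq_zero_of_proj {φ : ℝ} {x y : ℝ × ℝ} (hx : proj φ x = 0) (hy : proj φ y = 0) :
    planeDet x y = 0 := by
  unfold proj at hx hy
  unfold planeDet
  have h := Real.sin_sq_add_cos_sq φ
  linear_combination (-(x.1 * y.2 - x.2 * y.1)) * h +
    (y.2 * Real.cos φ - y.1 * Real.sin φ) * hx + (x.1 * Real.sin φ - x.2 * Real.cos φ) * hy

/-! ### Switches in the same move and parallel lines. -/

namespace AllowableSequence

variable {N : ℕ} {S : AllowableSequence N}

/-- The lines joining two pairs of points are parallel if and only if the pairs are switched in the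
same moves. -/
structure HasDirections (S : AllowableSequence N) (v : Fin N → ℝ × ℝ) : Prop where
  injective : Function.Injective v
  det_iff : ∀ i p q r s, p ≠ q → r ≠ s → S.Swaps i p q →
    (planeDet (v p - v q) (v r - v s) = 0 ↔ S.Swaps i r s)

/-- Two points are switched in the move i when their projections change order at the angle θ (i +
1), that is, when their difference is orthogonal to that direction. Proportional differences change
sign together. -/
theorem hasDirections_of_isCircularSequence {v : Fin N → ℝ × ℝ} (hv : Function.Injective v)
    (h : IsCircularSequence v S.perm) : S.HasDirections v := by
  obtain ⟨θ, hθ, hrange, hord⟩ := h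
  have hmid : ∀ i, θ i < (θ i + θ (i + 1)) / 2 ∧ (θ i + θ (i + 1)) / 2 < θ (i + 1) := by
    intro i
    have := hθ (lt_add_one i)
    constructor <;> linarith
  have hord' : ∀ i p q, proj ((θ i + θ (i + 1)) / 2) (v p - v q) < 0 ↔
      S.coord i p < S.coord i q := by
    intro i p q
    rw [proj_sub, sub_neg, hord i _ (hmid i).1 (hmid i).2, coord_lt_iff]
  have hflip : ∀ i p q, p ≠ q → (S.Swaps i p q ↔
      proj ((θ i + θ (i + 1)) / 2) (v p - v q) *
        proj ((θ (i + 1) + θ (i + 1 + 1)) / 2) (v p - v q) < 0) := by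
    intro i p q hpq
    have h1 := hord' i p q
    have h2 := hord' i q p
    have h3 := hord' (i + 1) p q
    have h4 := hord' (i + 1) q p
    have e : ∀ φ, proj φ (v q - v p) = -proj φ (v p - v q) := by
      intro φ
      rw [proj_sub, proj_sub, neg_sub]
    rw [e, neg_lt_zero] at h2 h4
    rw [swaps_iff hpq, mul_neg_iff, h1, h2, h3, h4]
    have n1 : S.coord i p ≠ S.coord i q := fun e => hpq (coord_inj e)
    have n2 : S.coord (i + 1) p ≠ S.coord (i + 1) q := fun e => hpq (coord_inj e)
    omega
  refine ⟨hv, fun i p q r s hpq hrs hs => ⟨fun hdet => ?_, fun hs' => ?_⟩⟩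
  · obtain ⟨k, hk⟩ := exists_smul_eq_of_planeDet_eq_zero
      (sub_ne_zero.2 fun e => hpq (hv e)) hdet
    have hk0 : k ≠ 0 := by
      rintro rfl
      rw [zero_smul, sub_eq_zero] at hk
      exact hrs (hv hk)
    rw [hflip i p q hpq] at hs
    rw [hflip i r s hrs, hk, proj_smul, proj_smul]
    have : 0 < k * k := mul_self_pos.2 hk0
    nlinarith
  · have hzero : ∀ p q, p ≠ q → S.Swaps i p q → proj (θ (i + 1)) (v p - v q) = 0 := by
      intro p q hpq hs
      rw [hflip i p q hpq] at hs
      have hle : (θ i + θ (i + 1)) / 2 ≤ (θ (i + 1) + θ (i + 1 + 1)) / 2 :=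
        ((hmid i).2.trans (hmid (i + 1)).1).le
      have hc := intermediate_value_uIcc ((continuous_proj (v p - v q)).continuousOn
        (s := Set.uIcc ((θ i + θ (i + 1)) / 2) ((θ (i + 1) + θ (i + 1 + 1)) / 2)))
      obtain ⟨φ, hφ, hφ0⟩ := hc (show (0 : ℝ) ∈ Set.uIcc _ _ by
        rw [Set.mem_uIcc]
        rcases mul_neg_iff.1 hs with h | h
        · exact Or.inr ⟨h.2.le, h.1.le⟩
        · exact Or.inl ⟨h.1.le, h.2.le⟩)
      dsimp only at hφ0
      rw [Set.uIcc_of_le hle, Set.mem_Icc] at hφ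
      have hmem : φ ∈ Set.range θ := by
        rw [hrange]
        exact ⟨p, q, hpq, by rwa [proj_sub, sub_eq_zero] at hφ0⟩
      obtain ⟨j, rfl⟩ := hmem
      have h1 : i < j := hθ.lt_iff_lt.1 ((hmid i).1.trans_le hφ.1)
      have h2 : j < i + 1 + 1 := hθ.lt_iff_lt.1 (hφ.2.trans_lt (hmid (i + 1)).2)
      obtain rfl : j = i + 1 := by omega
      exact hφ0
    exact planeDet_eq_zero_of_proj (hzero p q hpq hs) (hzero r s hrs hs')

theorem HasDirections.comp {v : Fin N → ℝ × ℝ} (h : S.HasDirections v)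
    (e : (ℝ × ℝ) ≃ᵃ[ℝ] (ℝ × ℝ)) : S.HasDirections (e ∘ v) := by
  have hlin : ∀ p q, (e ∘ v) p - (e ∘ v) q = e.linear (v p - v q) := by
    intro p q
    rw [Function.comp_apply, Function.comp_apply, ← vsub_eq_sub, ← vsub_eq_sub]
    exact (e.toAffineMap.linearMap_vsub _ _).symm
  refine ⟨e.injective.comp h.injective, fun i p q r s hpq hrs hs => ?_⟩
  rw [← h.det_iff i p q r s hpq hrs hs, hlin, hlin]
  have h0 : v p - v q ≠ 0 := sub_ne_zero.2 fun e => hpq (h.injective e)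
  constructor
  · intro hd
    obtain ⟨k, hk⟩ := exists_smul_eq_of_planeDet_eq_zero
      ((map_ne_zero_iff _ e.linear.injective).2 h0) hd
    rw [← map_smul] at hk
    rw [e.linear.injective hk]
    exact planeDet_smul_right _ _
  · intro hd
    obtain ⟨k, hk⟩ := exists_smul_eq_of_planeDet_eq_zero h0 hd
    rw [hk, map_smul]
    exact planeDet_smul_right _ _

/-- Two pairs of parallel chords of two homothetic columns, seen from two points, determine the
ratio `-1` of the homothety. -/
theorem central_of_parallel {y₁ y₂ u₁ u₂ z₁ z₂ s₁ s₂ α₁ α₂ β₁ β₂ : ℝ} (hy : y₁ ≠ 0) (hz : z₁ ≠ 0)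
    (hβ : β₁ ≠ β₂)
    (hy1 : y₁ * (u₂ - β₁) - (y₂ - α₁) * u₁ = 0) (hy2 : y₁ * (u₂ - β₂) - (y₂ - α₂) * u₁ = 0)
    (hz1 : z₁ * (s₂ - β₁) - (z₂ - α₁) * s₁ = 0) (hz2 : z₁ * (s₂ - β₂) - (z₂ - α₂) * s₁ = 0)
    (hpar : (z₁ - u₁) * (y₂ - s₂) - (z₂ - u₂) * (y₁ - s₁) = 0)
    (hne : (y₁ - u₁) * (z₂ - s₂) - (y₂ - u₂) * (z₁ - s₁) ≠ 0) :
    u₁ = -y₁ ∧ s₁ = -z₁ ∧ z₂ + s₂ = y₂ + u₂ := by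
  have hβ' : β₂ - β₁ ≠ 0 := sub_ne_zero.2 hβ.symm
  -- l is the ratio of the homothety from the second column to the first. By the parallel chords it
  -- also takes (u₁, u₂) to (y₁, y₂) and (s₁, s₂) to (z₁, z₂).
  obtain ⟨l, hl⟩ : ∃ l, α₂ - α₁ = l * (β₂ - β₁) := ⟨_, (div_mul_cancel₀ _ hβ').symm⟩
  have e1 : y₁ = l * u₁ := mul_right_cancel₀ hβ' (by linear_combination hy1 - hy2 + u₁ * hl)
  have e2 : z₁ = l * s₁ := mul_right_cancel₀ hβ' (by linear_combination hz1 - hz2 + s₁ * hl)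
  have hu : u₁ ≠ 0 := by
    rintro rfl
    simp [e1] at hy
  have hs : s₁ ≠ 0 := by
    rintro rfl
    simp [e2] at hz
  have e3 : y₂ = l * u₂ + (α₁ - l * β₁) :=
    mul_right_cancel₀ hu (by rw [e1] at hy1; linear_combination -hy1)
  have e4 : z₂ = l * s₂ + (α₁ - l * β₁) :=
    mul_right_cancel₀ hs (by rw [e2] at hz1; linear_combination -hz1)
  -- With both points eliminated by the homothety, the two determinants differ by the factor (1 -
  -- l)/(1 + l), cleared of denominators. One vanishes and the other does not.
  have e5 : (l + 1) * ((y₁ - u₁) * (z₂ - s₂) - (y₂ - u₂) * (z₁ - s₁)) = 0 := by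
    have : (l + 1) * ((y₁ - u₁) * (z₂ - s₂) - (y₂ - u₂) * (z₁ - s₁)) =
        (1 - l) * ((z₁ - u₁) * (y₂ - s₂) - (z₂ - u₂) * (y₁ - s₁)) := by
      rw [e1, e2, e3, e4]
      ring
    rw [this, hpar, mul_zero]
  have e6 : l = -1 := by
    have := (mul_eq_zero.1 e5).resolve_right hne
    linarith
  subst e6
  exact ⟨by linarith, by linarith, by linarith⟩

end AllowableSequence

/-! ### Central symmetry of a realization, and normalized coordinates. -/

namespace AllowableSequence

variable {N : ℕ} {S : AllowableSequence N}

theorem Swaps.not_swaps {i j : ℤ} {p q : Fin N} (h : S.Swaps i p q) (hpq : p ≠ q) (hij : i ≠ j)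
    (h1 : j < i + S.h) (h2 : i < j + S.h) : ¬ S.Swaps j p q := by
  intro h'
  rcases lt_or_gt_of_ne hij with hlt | hlt
  · exact hij (h.eq_of_lt hpq h' hlt.le h1)
  · exact hij (h'.eq_of_lt hpq h hlt.le h2).symm

theorem ne_of_conj {p p' q q' : Fin N} (hp : ∀ i, S.coord i p' = -S.coord i p)
    (hq : ∀ i, S.coord i q' = -S.coord i q) (hne : p ≠ q) : p' ≠ q' := by
  rintro rfl
  exact hne (coord_inj (S := S) (i := 0) (by have := hp 0; have := hq 0; omega))

theorem self_ne_conj (hN : Even N) {p p' : Fin N} (hp : ∀ i, S.coord i p' = -S.coord i p) :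
    p ≠ p' := by
  rintro rfl
  have := hp 0
  have := S.coord_emod_two hN 0 p
  omega

namespace Pattern

variable {T : ℤ} {D e : ℕ}

section

variable (P : S.Pattern T D e)
include P

theorem swaps_block {p q : Fin N} (hpq : p ≠ q) (hp : |S.coord (T + 1) p| < 2 * D)
    (hq : |S.coord (T + 1) q| < 2 * D) : S.Swaps T p q :=
  P.flips_first.swaps_inner hpq ((P.flips_first.abs_succ_lt_iff P.even).1 hp)
    ((P.flips_first.abs_succ_lt_iff P.even).1 hq)

variable {v : Fin N → ℝ × ℝ} (hd : S.HasDirections v)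
  (h0 : ∀ a, |S.coord (T + 1) a| < 2 * D → (v a).1 = 0)
include hd h0

/-- A further point on the axis would be joined to `a` in the direction of the block, hence switched
with `a` in the move T. -/
theorem fst_ne_zero {p a : Fin N} (hpa : p ≠ a) (ha : |S.coord (T + 1) a| < 2 * D)
    (hs : ¬ S.Swaps T p a) : (v p).1 ≠ 0 := by
  intro hp
  obtain ⟨a', ha'⟩ := P.symmetric.exists_conj a
  have hb : |S.coord (T + 1) a'| < 2 * D := by rwa [ha', abs_neg]
  have hne : a ≠ a' := self_ne_conj P.even ha'
  refine hs ((hd.det_iff T a a' p a hne hpa (P.swaps_block hne ha hb)).1 ?_)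
  simp [planeDet, h0 a ha, h0 a' hb, hp]

/-- Conjugate pairs are switched in the same move, so y a_j ∥ y' a_j' and z a_j ∥ z' a_j'. Using j =
1 and 2, which exist as D ≥ 2, `central_of_parallel` gives the centre, and the remaining a_j follow
from their chords to `y`. -/
theorem central {y y' z z' : Fin N} (hy : S.coord (T + D + 1) y = 1)
    (hyy : ∀ i, S.coord i y' = -S.coord i y) (hz : S.coord (T + D + 3) z = 1)
    (hzz : ∀ i, S.coord i z' = -S.coord i z) :
    ∃ m : ℝ, v y' = (0, m) - v y ∧ v z' = (0, m) - v z ∧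
      ∀ j : ℕ, 1 ≤ j → j ≤ D → ∀ a a', S.coord (T + 1) a = 2 * j - 1 →
        (∀ i, S.coord i a' = -S.coord i a) → v a' = (0, m) - v a := by
  have h2 := P.two_le
  have hle := P.le_h
  have hyz : z ≠ y := P.first_ne_second (by rw [hy]; norm_num) (by rw [hz]; norm_num)
  have hyz' : z ≠ y' := P.first_ne_second (by rw [hyy, hy]; norm_num) (by rw [hz]; norm_num)
  have hyc := self_ne_conj P.even hyy
  have hzc := self_ne_conj P.even hzz
  have hy' : ∀ i, S.coord i y = -S.coord i y' := fun i => by rw [hyy, neg_neg]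
  have blk : ∀ j : ℕ, 1 ≤ j → j ≤ D → ∀ a, S.coord (T + 1) a = 2 * j - 1 →
      |S.coord (T + 1) a| < 2 * D := by
    intro j h1 hj a ha
    rw [ha, abs_lt]
    omega
  have blk' : ∀ j : ℕ, 1 ≤ j → j ≤ D → ∀ a a', S.coord (T + 1) a = 2 * j - 1 →
      (∀ i, S.coord i a' = -S.coord i a) → |S.coord (T + 1) a'| < 2 * D := by
    intro j h1 hj a a' ha haa
    rw [haa, abs_neg]
    exact blk j h1 hj a ha
  have py : ∀ j : ℕ, 1 ≤ j → j ≤ D → ∀ a a', S.coord (T + 1) a = 2 * j - 1 →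
      (∀ i, S.coord i a' = -S.coord i a) →
      (v y).1 * ((v y').2 - (v a').2) - ((v y).2 - (v a).2) * (v y').1 = 0 := by
    intro j h1 hj a a' ha haa
    have hne := P.first_ne_block hy h1 hj ha
    have hs := (P.first_block hy h1 hj ha).2
    have := (hd.det_iff _ y a y' a' hne (ne_of_conj hyy haa hne) hs).2 (hs.conj hne hyy haa)
    simpa [planeDet, h0 a (blk j h1 hj a ha), h0 a' (blk' j h1 hj a a' ha haa)] using this
  have pz : ∀ j : ℕ, 1 ≤ j → j ≤ D → ∀ a a', S.coord (T + 1) a = 2 * j - 1 →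
      (∀ i, S.coord i a' = -S.coord i a) →
      (v z).1 * ((v z').2 - (v a').2) - ((v z).2 - (v a).2) * (v z').1 = 0 := by
    intro j h1 hj a a' ha haa
    have hne := P.second_ne_block hz h1 hj ha
    have hs := (P.second_block hy hz h1 hj ha).2
    have := (hd.det_iff _ z a z' a' hne (ne_of_conj hzz haa hne) hs).2 (hs.conj hne hzz haa)
    simpa [planeDet, h0 a (blk j h1 hj a ha), h0 a' (blk' j h1 hj a a' ha haa)] using this
  obtain ⟨a, ha⟩ := P.exists_block (j := 1) le_rfl (by omega)
  obtain ⟨b, hb⟩ := P.exists_block (j := 2) (by omega) h2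
  obtain ⟨a', haa⟩ := P.symmetric.exists_conj a
  obtain ⟨b', hbb⟩ := P.symmetric.exists_conj b
  have hna := P.first_ne_block hy le_rfl (by omega) ha
  have hnz := P.second_ne_block hz le_rfl (by omega) ha
  have hy1 : (v y).1 ≠ 0 := P.fst_ne_zero hd h0 hna (blk 1 le_rfl (by omega) a ha)
    ((P.first_block hy le_rfl (by omega) ha).2.not_swaps hna (by omega) (by omega) (by omega))
  have hz1 : (v z).1 ≠ 0 := P.fst_ne_zero hd h0 hnz (blk 1 le_rfl (by omega) a ha)
    ((P.second_block hy hz le_rfl (by omega) ha).2.not_swaps hnz (by omega) (by omega) (by omega))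
  have hab : (v a').2 ≠ (v b').2 := by
    intro heq
    have : a' = b' := hd.injective (Prod.ext
      ((h0 a' (blk' 1 le_rfl (by omega) a a' ha haa)).trans
        (h0 b' (blk' 2 (by omega) h2 b b' hb hbb)).symm) heq)
    subst this
    have h3 := haa (T + 1)
    have h4 := hbb (T + 1)
    rw [h3, ha, hb] at h4
    norm_num at h4
  have sy := P.flips_second.swaps_conj P.even hyy (by rw [hy]; norm_num)
  have sz := P.flips_third.swaps_conj P.even hzz (by rw [hz]; norm_num)
  have szy := (P.second_first_conj hy hyy hz).2.2
  have szy' := szy.conj hyz' hzz hy'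
  -- The second and third crossings are different moves of one halfperiod, so y y' and z z' are not
  -- parallel.
  have hne := (hd.det_iff _ y y' z z' hyc hzc sy).not.2
    (sz.not_swaps hzc (by omega) (by omega) (by omega))
  have hpar := (hd.det_iff _ z y' y z' hyz' (ne_of_conj hzz hy' hyz').symm szy).2 szy'.symm
  obtain ⟨e1, e2, e3⟩ := central_of_parallel hy1 hz1 hab (py 1 le_rfl (by omega) a a' ha haa)
    (py 2 (by omega) h2 b b' hb hbb) (pz 1 le_rfl (by omega) a a' ha haa)
    (pz 2 (by omega) h2 b b' hb hbb) (by simpa [planeDet] using hpar)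
    (by simpa [planeDet] using hne)
  refine ⟨(v y).2 + (v y').2, Prod.ext ?_ ?_, Prod.ext ?_ ?_, ?_⟩
  · simpa using e1
  · simp
  · simpa using e2
  · rw [← e3]
    simp
  · intro j h1 hj c c' hc hcc
    refine Prod.ext ?_ ?_
    · simp [h0 c (blk j h1 hj c hc), h0 c' (blk' j h1 hj c c' hc hcc)]
    · have := py j h1 hj c c' hc hcc
      rw [e1] at this
      have h3 : (v y).1 * ((v y').2 - (v c').2 + ((v y).2 - (v c).2)) = 0 := by
        linear_combination this
      have := (mul_eq_zero.1 h3).resolve_left hy1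
      simp only [Prod.snd_sub]
      linarith

end

/-- Coordinates in which the block lies on the second axis and conjugate points are opposite. -/
structure Frame (S : AllowableSequence N) (T : ℤ) (D : ℕ) (v : Fin N → ℝ × ℝ) (y y' z z' : Fin N) :
    Prop where
  directions : S.HasDirections v
  fst_block : ∀ j : ℕ, 1 ≤ j → j ≤ D → ∀ a, S.coord (T + 1) a = 2 * j - 1 → (v a).1 = 0
  first_conj : v y' = -v y
  second_conj : v z' = -v z
  fst_first : (v y).1 ≠ 0
  block_conj : ∀ j : ℕ, 1 ≤ j → j ≤ D → ∀ a a', S.coord (T + 1) a = 2 * j - 1 →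
    (∀ i, S.coord i a' = -S.coord i a) → v a' = -v a

/-- The line of the block becomes the second axis, and a translation along it brings the centre of
symmetry to the origin. -/
theorem exists_frame (P : S.Pattern T D e) {v : Fin N → ℝ × ℝ} (hd : S.HasDirections v)
    {y y' z z' : Fin N} (hy : S.coord (T + D + 1) y = 1)
    (hyy : ∀ i, S.coord i y' = -S.coord i y) (hz : S.coord (T + D + 3) z = 1)
    (hzz : ∀ i, S.coord i z' = -S.coord i z) :
    ∃ f : (ℝ × ℝ) ≃ᵃ[ℝ] (ℝ × ℝ), Frame S T D (f ∘ v) y y' z z' := by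
  have h2 := P.two_le
  have hle := P.le_h
  obtain ⟨a, ha⟩ := P.exists_block (j := 1) le_rfl (by omega)
  obtain ⟨a', haa⟩ := P.symmetric.exists_conj a
  have hba : |S.coord (T + 1) a| < 2 * D := by rw [ha, abs_lt]; omega
  have hba' : |S.coord (T + 1) a'| < 2 * D := by rwa [haa, abs_neg]
  have hna := P.first_ne_block hy le_rfl (by omega) ha
  have hac := self_ne_conj P.even haa
  have hsy : ¬ S.Swaps T y a := (P.first_block hy le_rfl (by omega) ha).2.not_swaps hna
    (by omega) (by omega) (by omega)
  have hsa := P.swaps_block hac.symm hba' hba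
  -- The pair y, a is not switched in the move T, in which the block is reversed.
  have hdet : planeDet (v y - v a) (v a' - v a) ≠ 0 := by
    intro h
    refine hsy ((hd.det_iff T a' a y a hac.symm hna hsa).1 ?_)
    unfold planeDet at *
    linear_combination -h
  let f := frameEquiv (v a) (v y - v a) (v a' - v a) hdet
  have hf0 : ∀ b, |S.coord (T + 1) b| < 2 * D → ((f ∘ v) b).1 = 0 := by
    intro b hb
    rw [Function.comp_apply, frameEquiv_apply, div_eq_zero_iff]
    left
    rcases eq_or_ne b a with rfl | hne
    · simp [planeDet]
    · have := (hd.det_iff T a' a b a hac.symm hne hsa).2 (P.swaps_block hne hb hba)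
      unfold planeDet at *
      linear_combination -this
  have hdf := hd.comp f
  obtain ⟨m, h3, h4, h5⟩ := P.central hdf hf0 hy hyy hz hzz
  let g := AffineEquiv.constVAdd ℝ (ℝ × ℝ) (-(0, m / 2) : ℝ × ℝ)
  have hg : ∀ x, g x = x - (0, m / 2) := by
    intro x
    simp only [g, AffineEquiv.constVAdd_apply, vadd_eq_add]
    abel
  have hg1 : ∀ x, (g x).1 = x.1 := by
    intro x
    simp [hg]
  have hneg : ∀ x y : ℝ × ℝ, x = (0, m) - y → g x = -g y := by
    rintro x y rfl
    rw [hg, hg]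
    ext
    · simp
    · simp only [Prod.snd_sub, Prod.snd_neg]
      ring
  refine ⟨f.trans g, hdf.comp g, ?_, hneg _ _ h3, hneg _ _ h4, ?_, ?_⟩
  · intro j h1 hj b hb
    have := hf0 b (by rw [hb, abs_lt]; omega)
    simpa [hg1] using this
  · have := P.fst_ne_zero hdf hf0 hna hba hsy
    simpa [hg1] using this
  · exact fun j h1 hj b b' hb hbb => hneg _ _ (h5 j h1 hj b b' hb hbb)

theorem Frame.comm {v : Fin N → ℝ × ℝ} {y y' z z' : Fin N} (F : Frame S T D v y y' z z')
    {i : ℤ} {p q r s : Fin N} (hpq : p ≠ q) (hrs : r ≠ s) (h : S.Swaps i p q)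
    (h' : S.Swaps i r s) : planeDet (v p - v q) (v r - v s) = 0 :=
  (F.directions.det_iff i p q r s hpq hrs h).2 h'

/-- The positions of the points of the block nearest to the center. -/
theorem Frame.snd_block (P : S.Pattern T D e) {v : Fin N → ℝ × ℝ} {y y' z z' : Fin N}
    (F : Frame S T D v y y' z z') (hy : S.coord (T + D + 1) y = 1)
    (hyy : ∀ i, S.coord i y' = -S.coord i y) (hz : S.coord (T + D + 3) z = 1) :
    (∀ a, S.coord (T + 1) a = 1 → (v y).1 * ((v z).2 - (v a).2) = (v y).2 * (v z).1) ∧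
    ∀ j : ℕ, 1 ≤ j → j + 1 ≤ D → ∀ a b, S.coord (T + 1) a = 2 * j - 1 →
      S.coord (T + 1) b = 2 * j + 1 →
      (v y).1 * ((v z).2 - (v b).2) = ((v y).2 - (v a).2) * (v z).1 := by
  have h2 := P.two_le
  constructor
  · intro a ha
    have ha' : S.coord (T + 1) a = 2 * (1 : ℕ) - 1 := by rw [ha]; norm_num
    -- In the move T+D+1: y y' ∥ z a_1.
    have s1 := P.flips_second.swaps_conj P.even hyy (by rw [hy]; norm_num)
    have s2 := (P.second_block hy hz le_rfl (by omega) ha').2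
    rw [show T + D + 2 - ((1 : ℕ) : ℤ) = T + D + 1 by push_cast; ring] at s2
    have := F.comm (self_ne_conj P.even hyy) (P.second_ne_block hz le_rfl (by omega) ha') s1 s2
    have h0 := F.fst_block 1 le_rfl (by omega) a ha'
    simp only [planeDet, F.first_conj, Prod.fst_sub, Prod.snd_sub, Prod.fst_neg, Prod.snd_neg,
      h0] at this
    linarith
  · intro j h1 hj a b ha hb
    have hb' : S.coord (T + 1) b = 2 * (j + 1 : ℕ) - 1 := by rw [hb]; push_cast; ring
    -- In the move T+D+1-j: y a_j ∥ z a_{j+1}.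
    have s1 := (P.first_block hy h1 (by omega) ha).2
    have s2 := (P.second_block hy hz (by omega) hj hb').2
    rw [show T + D + 2 - ((j + 1 : ℕ) : ℤ) = T + D + 1 - j by push_cast; ring] at s2
    have := F.comm (P.first_ne_block hy h1 (by omega) ha) (P.second_ne_block hz (by omega) hj hb')
      s1 s2
    have h0 := F.fst_block j h1 (by omega) a ha
    have h0' := F.fst_block (j + 1) (by omega) hj b hb'
    simp only [planeDet, Prod.fst_sub, Prod.snd_sub, h0, h0'] at this
    linarith

/-- Five parallelisms determine z, a_2 and w from y, a_1 and the ratio of the first coordinates of z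
and y. The sixth, z z' ∥ w y', then contradicts them. -/
theorem no_fourth (P : S.Pattern T D e) (hlt : D + 4 + e < S.h) {v : Fin N → ℝ × ℝ}
    (hd : S.HasDirections v) : False := by
  have h2 := P.two_le
  have hN : |(1 : ℤ)| < N := by
    have := P.le_card
    rw [abs_one]
    omega
  obtain ⟨y, hy⟩ := S.exists_coord_eq P.even (T + D + 1) (x := 1) (by norm_num) hN
  obtain ⟨z, hz⟩ := S.exists_coord_eq P.even (T + D + 3) (x := 1) (by norm_num) hN
  obtain ⟨w, hw⟩ := S.exists_coord_eq P.even (T + D + 4 + e) (x := 1) (by norm_num) hN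
  obtain ⟨y', hyy⟩ := P.symmetric.exists_conj y
  obtain ⟨z', hzz⟩ := P.symmetric.exists_conj z
  obtain ⟨a, ha⟩ := P.exists_block (j := 1) le_rfl (by omega)
  obtain ⟨b, hb⟩ := P.exists_block (j := 2) (by omega) h2
  obtain ⟨f, F⟩ := P.exists_frame hd hy hyy hz hzz
  generalize f ∘ v = v at F
  have ha0 := F.fst_block 1 le_rfl (by omega) a ha
  have hb0 := F.fst_block 2 (by omega) h2 b hb
  have ha1 : S.coord (T + 1) a = 1 := by rw [ha]; norm_num
  have hb1 : S.coord (T + 1) b = 3 := by rw [hb]; norm_num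
  obtain ⟨e1, e2⟩ := F.snd_block P hy hyy hz
  have e1 := e1 a ha1
  have e2 := e2 1 le_rfl (by omega) a b ha (by rw [hb1]; norm_num)
  have hwa : w ≠ a := P.block_ne le_rfl (by omega) ha P.flips_fourth (by omega) (by omega)
    (by rw [hw, abs_one]; have := P.pos; omega)
  have hwb : w ≠ b := P.block_ne (by omega) h2 hb P.flips_fourth (by omega) (by omega)
    (by rw [hw, abs_one]; have := P.pos; omega)
  have hwy : w ≠ y' := by
    rintro rfl
    have := P.pos
    exact P.flips_second.not_both P.flips_fourth P.even P.symmetric (by omega) (by omega)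
      (by rw [hyy, hy]; norm_num) (by rw [hw, abs_one]; omega)
  have hzy' : z ≠ y' := P.first_ne_second (by rw [hyy, hy]; norm_num) (by rw [hz]; norm_num)
  have hyc := self_ne_conj P.even hyy
  have hzc := self_ne_conj P.even hzz
  have sy := P.flips_second.swaps_conj P.even hyy (by rw [hy]; norm_num)
  have sz := P.flips_third.swaps_conj P.even hzz (by rw [hz]; norm_num)
  have szy := (P.second_first_conj hy hyy hz).2.2
  have swy := (P.third_first_conj hy hyy hz hw).2
  obtain ⟨swa, swb⟩ := P.third_block hy hz hw hlt ha1 hb1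
  have q1 := F.comm hyc hwb sy swb
  have q2 := F.comm hzy' hwa szy swa
  have q3 := F.comm hzc hwy sz swy
  obtain ⟨a', haa⟩ := P.symmetric.exists_conj a
  -- The conjugate of `a` is a different point, and it is placed at `-v a`.
  have hA : (v a).2 ≠ 0 := by
    intro hA
    have := F.block_conj 1 le_rfl (by omega) a a' ha haa
    have e0 : v a = 0 := Prod.ext ha0 hA
    rw [e0, neg_zero] at this
    exact self_ne_conj P.even haa (F.directions.injective (e0.trans this.symm))
  have hY := F.fst_first
  simp only [planeDet, F.first_conj, F.second_conj, Prod.fst_sub, Prod.snd_sub, Prod.fst_neg,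
    Prod.snd_neg, ha0, hb0] at q1 q2 q3
  generalize (v y).1 = Y₁ at *
  generalize (v y).2 = Y₂ at *
  generalize (v z).1 = Z₁ at *
  generalize (v z).2 = Z₂ at *
  generalize (v w).1 = W₁ at *
  generalize (v w).2 = W₂ at *
  generalize (v a).2 = A at *
  generalize (v b).2 = B at *
  -- The unknowns are the ratio r and the slope k of y y'. The slope only shears the picture and
  -- drops out of the last two equations.
  obtain ⟨r, rfl⟩ : ∃ r, Z₁ = r * Y₁ := ⟨_, (div_mul_cancel₀ _ hY).symm⟩
  obtain ⟨k, rfl⟩ : ∃ k, Y₂ = k * Y₁ := ⟨_, (div_mul_cancel₀ _ hY).symm⟩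
  obtain rfl : Z₂ = A + k * r * Y₁ := mul_left_cancel₀ hY (by linear_combination e1)
  obtain rfl : B = A + r * A := mul_left_cancel₀ hY (by linear_combination -e2)
  obtain rfl : W₂ = A + r * A + k * W₁ := mul_left_cancel₀ hY (by linear_combination q1 / 2)
  have hW : W₁ = r * (r + 1) * Y₁ := mul_left_cancel₀ hA (by linear_combination -q2)
  -- Together with `hW` this gives Y₁ = 0, although y is off the axis.
  have hW' : W₁ + Y₁ = r * (r + 1) * Y₁ := mul_left_cancel₀ hA (by linear_combination -q3 / 2)
  exact hY (by linarith)

end Pattern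

end AllowableSequence

/-! ### The shape of a realization for three crossings. -/

theorem mem_tricolumnarArrayStar_one_zero {D : ℕ} {x : ℝ × ℝ} :
    x ∈ tricolumnarArrayStar 1 D 0 ↔ x = (1, 0) ∨ x = (1, 1) ∨ x = (-1, 0) ∨ x = (-1, 1) ∨
      ∃ j : ℕ, 1 ≤ j ∧ j ≤ D ∧ (x = (0, 1 / 2 + (j : ℝ)) ∨ x = (0, 1 / 2 - (j : ℝ))) := by
  unfold tricolumnarArrayStar tricolumnarArray
  rw [Set.mem_sdiff, Set.mem_singleton_iff, Set.mem_ofPred_eq, Nat.cast_one]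
  constructor
  · rintro ⟨⟨k, hk, h⟩ | ⟨j, hj, h⟩ | ⟨j, h1, h2, -⟩, hne⟩
    · interval_cases k
      · rw [Nat.cast_zero] at h
        tauto
      · rw [Nat.cast_one] at h
        tauto
    · rcases Nat.eq_zero_or_pos j with rfl | hpos
      · simp at h
        exact absurd h (by simpa using hne)
      · exact Or.inr (Or.inr (Or.inr (Or.inr ⟨j, hpos, hj, h⟩)))
    · omega
  · rintro (rfl | rfl | rfl | rfl | ⟨j, h1, hj, rfl | rfl⟩)
    · exact ⟨Or.inl ⟨0, by simp⟩, by simp⟩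
    · exact ⟨Or.inl ⟨1, by simp⟩, by simp⟩
    · exact ⟨Or.inl ⟨0, by simp⟩, by simp⟩
    · exact ⟨Or.inl ⟨1, by simp⟩, by simp⟩
    · exact ⟨Or.inr (Or.inl ⟨j, hj, Or.inl rfl⟩), by simp; omega⟩
    · exact ⟨Or.inr (Or.inl ⟨j, hj, Or.inr rfl⟩), by simp; omega⟩

namespace AllowableSequence

variable {N : ℕ} {S : AllowableSequence N} {T : ℤ} {D : ℕ}

namespace Pattern

/-- The block is an arithmetic progression, and the two outer points on one side differ by its
difference. -/
theorem Frame.eq_of_t_eq_three (P : S.Pattern T D D) (hh : S.h = 2 * D + 4) {v : Fin N → ℝ × ℝ}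
    {y y' z z' : Fin N} (F : Frame S T D v y y' z z') (hy : S.coord (T + D + 1) y = 1)
    (hyy : ∀ i, S.coord i y' = -S.coord i y) (hz : S.coord (T + D + 3) z = 1)
    (hzz : ∀ i, S.coord i z' = -S.coord i z) :
    ∃ A : ℝ, A ≠ 0 ∧ v z = v y + (0, A) ∧
      ∀ j : ℕ, 1 ≤ j → j ≤ D → ∀ a, S.coord (T + 1) a = 2 * j - 1 → v a = (0, j * A) := by
  have h2 := P.two_le
  obtain ⟨a, ha⟩ := P.exists_block (j := 1) le_rfl (by omega)
  obtain ⟨a', haa⟩ := P.symmetric.exists_conj a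
  have ha1 : S.coord (T + 1) a = 1 := by rw [ha]; norm_num
  have ha0 := F.fst_block 1 le_rfl (by omega) a ha
  have hA : (v a).2 ≠ 0 := by
    intro hA
    have := F.block_conj 1 le_rfl (by omega) a a' ha haa
    have e0 : v a = 0 := Prod.ext ha0 hA
    rw [e0, neg_zero] at this
    exact self_ne_conj P.even haa (F.directions.injective (e0.trans this.symm))
  have hY := F.fst_first
  obtain ⟨e1, e2⟩ := F.snd_block P hy hyy hz
  have e1 := e1 a ha1
  have sz := P.flips_third.swaps_conj P.even hzz (by rw [hz]; norm_num)
  have say := P.first_conj_block hh hy hyy hz le_rfl (by omega) ha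
  rw [show T + D + 2 + ((1 : ℕ) : ℤ) = T + D + 3 by push_cast; ring] at say
  have hne : a ≠ y' := (P.block_ne le_rfl (by omega) ha P.flips_second (by omega) (by omega)
    (by rw [hyy, hy]; norm_num)).symm
  have q := F.comm (self_ne_conj P.even hzz) hne sz say
  simp only [planeDet, F.first_conj, F.second_conj, Prod.fst_sub, Prod.snd_sub, Prod.fst_neg,
    Prod.snd_neg, ha0] at q
  -- The additional parallelism z z' ∥ a_1 y' of the third crossing puts y and z at the same
  -- distance from the axis.
  have hZ1 : (v z).1 = (v y).1 := by
    refine mul_left_cancel₀ hA (sub_eq_zero.1 ?_)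
    linear_combination q / 2 + e1
  have hZ2 : (v z).2 = (v y).2 + (v a).2 := by
    rw [hZ1] at e1
    exact mul_left_cancel₀ hY (by linear_combination e1)
  refine ⟨(v a).2, hA, Prod.ext (by simpa using hZ1) (by simpa using hZ2), ?_⟩
  intro j h1
  induction j, h1 using Nat.le_induction with
  | base =>
    intro _ b hb
    obtain rfl : a = b := coord_inj (S := S) (i := T + 1) (ha.trans hb.symm)
    exact Prod.ext ha0 (by simp)
  | succ j h1 ih =>
    intro hj c hc
    obtain ⟨b, hb⟩ := P.exists_block h1 (by omega)
    have hb' := ih (by omega) b hb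
    refine Prod.ext (F.fst_block _ (by omega) hj c hc) ?_
    have := e2 j h1 hj b c hb (by rw [hc]; push_cast; ring)
    rw [hZ1, hZ2, hb'] at this
    push_cast
    exact mul_left_cancel₀ hY (by linear_combination -this)

theorem exists_of_coord (P : S.Pattern T D D) (hh : S.h = 2 * D + 4) (hN : N = 2 * D + 4)
    {y y' z z' : Fin N} (hy : S.coord (T + D + 1) y = 1)
    (hyy : ∀ i, S.coord i y' = -S.coord i y) (hz : S.coord (T + D + 3) z = 1)
    (hzz : ∀ i, S.coord i z' = -S.coord i z) (p : Fin N) :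
    p = y ∨ p = y' ∨ p = z ∨ p = z' ∨ ∃ j : ℕ, 1 ≤ j ∧ j ≤ D ∧
      ∃ a, S.coord (T + 1) a = 2 * j - 1 ∧ (p = a ∨ ∀ i, S.coord i p = -S.coord i a) := by
  obtain ⟨h1, h2, -⟩ := P.coord_start hh hy hz
  have h3 := hyy (T + 1)
  have h4 := hzz (T + 1)
  have hb := S.abs_coord_lt (T + 1) p
  have ho := S.coord_emod_two P.even (T + 1) p
  rw [abs_lt] at hb
  have key : ∀ q, S.coord (T + 1) p = S.coord (T + 1) q → p = q := fun q => coord_inj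
  by_cases e1 : S.coord (T + 1) p = 2 * D + 1
  · exact Or.inl (key _ (e1.trans h1.symm))
  by_cases e2 : S.coord (T + 1) p = -(2 * D + 1)
  · exact Or.inr (Or.inl (key _ (by omega)))
  by_cases e3 : S.coord (T + 1) p = 2 * D + 3
  · exact Or.inr (Or.inr (Or.inl (key _ (by omega))))
  by_cases e4 : S.coord (T + 1) p = -(2 * D + 3)
  · exact Or.inr (Or.inr (Or.inr (Or.inl (key _ (by omega)))))
  refine Or.inr (Or.inr (Or.inr (Or.inr ?_)))
  rcases lt_or_ge 0 (S.coord (T + 1) p) with hpos | hneg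
  · exact ⟨((S.coord (T + 1) p + 1) / 2).toNat, by omega, by omega, p, by omega, Or.inl rfl⟩
  · obtain ⟨p', hp'⟩ := P.symmetric.exists_conj p
    have := hp' (T + 1)
    exact ⟨((-S.coord (T + 1) p + 1) / 2).toNat, by omega, by omega, p', by omega,
      Or.inr fun i => by rw [hp', neg_neg]⟩

theorem affinelyEquivalent (P : S.Pattern T D D) (hh : S.h = 2 * D + 4) (hN : N = 2 * D + 4)
    {v : Fin N → ℝ × ℝ} (hd : S.HasDirections v) :
    AffinelyEquivalent (Set.range v) (tricolumnarArrayStar 1 D 0) := by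
  have hN1 : |(1 : ℤ)| < N := by
    rw [abs_one]
    omega
  obtain ⟨y, hy⟩ := S.exists_coord_eq P.even (T + D + 1) (x := 1) (by norm_num) hN1
  obtain ⟨z, hz⟩ := S.exists_coord_eq P.even (T + D + 3) (x := 1) (by norm_num) hN1
  obtain ⟨y', hyy⟩ := P.symmetric.exists_conj y
  obtain ⟨z', hzz⟩ := P.symmetric.exists_conj z
  obtain ⟨f, F⟩ := P.exists_frame hd hy hyy hz hzz
  obtain ⟨A, hA, hzA, hblock⟩ := F.eq_of_t_eq_three P hh hy hyy hz hzz
  have hcover := P.exists_of_coord hh hN hy hyy hz hzz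
  have hY := F.fst_first
  have hdet : planeDet ((f ∘ v) y + (0, A / 2)) (0, A) ≠ 0 := by
    simp only [planeDet, Prod.fst_add, Prod.snd_add]
    simpa using ⟨hY, hA⟩
  -- The origin half a step below the centre puts the centre at (0, 1/2). The first basis vector
  -- sends y to (1, 0), and the step A becomes 1.
  let g := frameEquiv (0, -(A / 2)) ((f ∘ v) y + (0, A / 2)) (0, A) hdet
  have hg : ∀ s t x, x = (0, -(A / 2)) + (s • ((f ∘ v) y + (0, A / 2)) + t • (0, A)) →
      g x = (s, t) := by
    rintro s t x rfl
    exact frameEquiv_add _ _ _ hdet s t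
  have gy : g (f (v y)) = (1, 0) := by
    apply hg
    ext <;> simp
  have gy' : g (f (v y')) = (-1, 1) := by
    apply hg
    rw [← Function.comp_apply (f := f), F.first_conj]
    ext <;> simp; ring
  have gz : g (f (v z)) = (1, 1) := by
    apply hg
    rw [← Function.comp_apply (f := f), hzA]
    ext <;> simp; ring
  have gz' : g (f (v z')) = (-1, 0) := by
    apply hg
    rw [← Function.comp_apply (f := f), F.second_conj, hzA]
    ext <;> simp; ring
  have ga : ∀ j : ℕ, 1 ≤ j → j ≤ D → ∀ a, S.coord (T + 1) a = 2 * j - 1 →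
      g (f (v a)) = (0, 1 / 2 + (j : ℝ)) := by
    intro j h1 hj a ha
    apply hg
    rw [← Function.comp_apply (f := f), hblock j h1 hj a ha]
    ext <;> simp; ring
  have ga' : ∀ j : ℕ, 1 ≤ j → j ≤ D → ∀ a a', S.coord (T + 1) a = 2 * j - 1 →
      (∀ i, S.coord i a' = -S.coord i a) → g (f (v a')) = (0, 1 / 2 - (j : ℝ)) := by
    intro j h1 hj a a' ha haa
    apply hg
    rw [← Function.comp_apply (f := f), F.block_conj j h1 hj a a' ha haa, hblock j h1 hj a ha]
    ext <;> simp; ring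
  refine ⟨f.trans g, ?_⟩
  rw [← Set.range_comp]
  ext x
  rw [mem_tricolumnarArrayStar_one_zero, Set.mem_range]
  constructor
  · rintro ⟨p, rfl⟩
    change g (f (v p)) = _ ∨ g (f (v p)) = _ ∨ g (f (v p)) = _ ∨ g (f (v p)) = _ ∨
      ∃ j : ℕ, 1 ≤ j ∧ j ≤ D ∧ (g (f (v p)) = _ ∨ g (f (v p)) = _)
    rcases hcover p with rfl | rfl | rfl | rfl | ⟨j, h1, hj, a, ha, rfl | haa⟩
    · exact Or.inl gy
    · exact Or.inr (Or.inr (Or.inr (Or.inl gy')))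
    · exact Or.inr (Or.inl gz)
    · exact Or.inr (Or.inr (Or.inl gz'))
    · exact Or.inr (Or.inr (Or.inr (Or.inr ⟨j, h1, hj, Or.inl (ga j h1 hj _ ha)⟩)))
    · exact Or.inr (Or.inr (Or.inr (Or.inr ⟨j, h1, hj, Or.inr (ga' j h1 hj a p ha haa)⟩)))
  · rintro (rfl | rfl | rfl | rfl | ⟨j, h1, hj, rfl | rfl⟩)
    · exact ⟨y, gy⟩
    · exact ⟨z, gz⟩
    · exact ⟨z', gz'⟩
    · exact ⟨y', gy'⟩
    · obtain ⟨a, ha⟩ := P.exists_block h1 hj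
      exact ⟨a, ga j h1 hj a ha⟩
    · obtain ⟨a, ha⟩ := P.exists_block h1 hj
      obtain ⟨a', haa⟩ := P.symmetric.exists_conj a
      exact ⟨a', ga' j h1 hj a a' ha haa⟩

end Pattern

end AllowableSequence

/-! ### Ranks of the values of a function. -/

open Finset in
/-- The number of indices with a smaller value. -/
noncomputable def lowerCount {N : ℕ} (f : Fin N → ℝ) (p : Fin N) : ℕ :=
  (univ.filter fun q => f q < f p).card

open Finset in
/-- The number of indices with the same value. -/
noncomputable def equalCount {N : ℕ} (f : Fin N → ℝ) (p : Fin N) : ℕ :=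
  (univ.filter fun q => f q = f p).card

section Counts

variable {N : ℕ} {f g k : Fin N → ℝ}

theorem lowerCount_congr {p q : Fin N} (h : f p = f q) : lowerCount f p = lowerCount f q := by
  unfold lowerCount
  rw [h]

theorem equalCount_congr {p q : Fin N} (h : f p = f q) : equalCount f p = equalCount f q := by
  unfold equalCount
  rw [h]

theorem equalCount_pos (f : Fin N → ℝ) (p : Fin N) : 0 < equalCount f p :=
  Finset.card_pos.2 ⟨p, by simp⟩

theorem lowerCount_add_equalCount (f : Fin N → ℝ) (p : Fin N) :
    lowerCount f p + equalCount f p = (Finset.univ.filter fun q => f q ≤ f p).card := by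
  unfold lowerCount equalCount
  rw [← Finset.card_union_of_disjoint, ← Finset.filter_or]
  · simp only [le_iff_lt_or_eq]
  · rw [Finset.disjoint_filter]
    intro q _ h
    exact h.ne

theorem lowerCount_add_equalCount_le (f : Fin N → ℝ) (p : Fin N) :
    lowerCount f p + equalCount f p ≤ N := by
  rw [lowerCount_add_equalCount]
  exact (Finset.card_le_univ _).trans (by simp)

theorem lowerCount_lt (f : Fin N → ℝ) (p : Fin N) : lowerCount f p < N := by
  have := lowerCount_add_equalCount_le f p
  have := equalCount_pos f p
  omega

theorem lowerCount_lt_of_lt {p q : Fin N} (h : f p < f q) : lowerCount f p < lowerCount f q := by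
  refine Finset.card_lt_card ?_
  rw [Finset.ssubset_iff_of_subset]
  · exact ⟨p, by simpa using h, by simp⟩
  · intro r
    simp only [Finset.mem_filter, Finset.mem_univ, true_and]
    exact fun hr => hr.trans h

theorem lowerCount_lt_iff {p q : Fin N} : lowerCount f p < lowerCount f q ↔ f p < f q := by
  refine ⟨fun h => ?_, lowerCount_lt_of_lt⟩
  by_contra hn
  rcases (not_lt.1 hn).lt_or_eq with h1 | h1
  · exact lt_asymm h (lowerCount_lt_of_lt h1)
  · rw [lowerCount_congr h1] at h
    exact lt_irrefl _ h

/-- If `g` refines `f`, the values of `f` occupy intervals in the order of `g`. -/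
theorem lowerCount_mem_iff (h : ∀ p q, f p < f q → g p < g q) {p q : Fin N} :
    lowerCount f p ≤ lowerCount g q ∧ lowerCount g q < lowerCount f p + equalCount f p ↔
      f q = f p := by
  have h' : ∀ p q, g p < g q → f p ≤ f q := fun p q hg => by
    by_contra hn
    exact lt_asymm hg (h q p (not_le.1 hn))
  constructor
  · rintro ⟨h1, h2⟩
    by_contra hne
    rcases lt_or_gt_of_ne hne with hlt | hlt
    · refine absurd h1 (not_le.2 (Finset.card_lt_card ?_))
      rw [Finset.ssubset_iff_of_subset]
      · exact ⟨q, by simpa using hlt, by simp⟩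
      · intro r
        simp only [Finset.mem_filter, Finset.mem_univ, true_and]
        exact fun hr => (h' r q hr).trans_lt hlt
    · refine absurd h2 (not_lt.2 ?_)
      rw [lowerCount_add_equalCount]
      refine Finset.card_le_card ?_
      intro r
      simp only [Finset.mem_filter, Finset.mem_univ, true_and]
      exact fun hr => h r q (hr.trans_lt hlt)
  · intro he
    constructor
    · refine Finset.card_le_card ?_
      intro r
      simp only [Finset.mem_filter, Finset.mem_univ, true_and]
      exact fun hr => h r q (hr.trans_eq he.symm)
    · rw [lowerCount_add_equalCount]
      refine Finset.card_lt_card ?_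
      rw [Finset.ssubset_iff_of_subset]
      · exact ⟨q, by simp [he], by simp⟩
      · intro r
        simp only [Finset.mem_filter, Finset.mem_univ, true_and]
        exact fun hr => (h' r q hr).trans_eq he

/-- If `g` and `k` refine `f` in opposite ways, each value of `f` is reversed. -/
theorem lowerCount_add_lowerCount (hg : ∀ p q, f p < f q → g p < g q)
    (hk : ∀ p q, f p < f q → k p < k q)
    (hgk : ∀ p q, p ≠ q → f p = f q → (g p < g q ↔ ¬ k p < k q)) (p : Fin N) :
    lowerCount g p + lowerCount k p + 1 = 2 * lowerCount f p + equalCount f p := by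
  -- All counts become sums of indicators over q and are compared termwise. The 1 accounts for q =
  -- p.
  have h1 : (1 : ℕ) = ∑ q : Fin N, if q = p then 1 else 0 := by simp
  unfold lowerCount equalCount
  rw [Finset.card_filter, Finset.card_filter, Finset.card_filter, Finset.card_filter]
  conv_lhs => rw [h1]
  rw [Finset.mul_sum, ← Finset.sum_add_distrib, ← Finset.sum_add_distrib,
    ← Finset.sum_add_distrib]
  refine Finset.sum_congr rfl fun q _ => ?_
  rcases eq_or_ne q p with rfl | hne
  · simp
  · rcases lt_trichotomy (f q) (f p) with h | h | h
    · simp [hg q p h, hk q p h, h, h.ne, hne]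
    · have := hgk q p hne h
      by_cases h2 : k q < k p
      · simp [h, hne, h2, this]
      · simp [h, hne, h2, this]
    · simp [(hg p q h).not_gt, (hk p q h).not_gt, h.not_gt, h.ne', hne]

theorem lowerCount_neg (hf : Function.Injective f) (p : Fin N) :
    lowerCount f p + lowerCount (fun q => -f q) p + 1 = N := by
  have h1 : (1 : ℕ) = ∑ q : Fin N, if q = p then 1 else 0 := by simp
  have h2 : N = ∑ q : Fin N, 1 := by simp
  unfold lowerCount
  rw [Finset.card_filter, Finset.card_filter]
  conv_lhs => rw [h1]
  conv_rhs => rw [h2]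
  rw [← Finset.sum_add_distrib, ← Finset.sum_add_distrib]
  refine Finset.sum_congr rfl fun q _ => ?_
  rcases eq_or_ne q p with rfl | hne
  · simp
  · rcases lt_or_gt_of_ne (hf.ne hne) with h | h
    · simp [h, h.not_gt, hne]
    · simp [h, h.not_gt, hne]

/-- The permutation that sorts the values of an injective function. -/
noncomputable def rankPerm (f : Fin N → ℝ) (hf : Function.Injective f) : Equiv.Perm (Fin N) :=
  Equiv.ofBijective (fun p => ⟨lowerCount f p, lowerCount_lt f p⟩) <| by
    refine Finite.injective_iff_bijective.1 fun p q h => ?_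
    rw [Fin.mk.injEq] at h
    by_contra hne
    rcases lt_or_gt_of_ne (hf.ne hne) with h1 | h1
    · exact (lowerCount_lt_of_lt h1).ne h
    · exact (lowerCount_lt_of_lt h1).ne' h

theorem val_rankPerm (hf : Function.Injective f) (p : Fin N) :
    (rankPerm f hf p : ℕ) = lowerCount f p := rfl

end Counts

/-! ### The allowable sequence of a point set with a list of critical angles. -/

/-- The list of all angles at which two of the points have the same projection; `h` of them are in
a half turn. -/
structure IsAngleList {N : ℕ} (v : Fin N → ℝ × ℝ) (ψ : ℤ → ℝ) (h : ℕ) : Prop where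
  injective : Function.Injective v
  mono : StrictMono ψ
  h_pos : 0 < h
  add_h : ∀ i, ψ (i + h) = ψ i + Real.pi
  critical : ∀ φ, (∃ p q, p ≠ q ∧ proj φ (v p) = proj φ (v q)) ↔ ∃ i, ψ i = φ

theorem proj_lt_of_forall_ne {x y : ℝ × ℝ} {α β : ℝ} (h : proj α x < proj α y)
    (hne : ∀ φ ∈ Set.uIcc α β, proj φ x ≠ proj φ y) : proj β x < proj β y := by
  by_contra hn
  have hc := intermediate_value_uIcc ((continuous_proj (x - y)).continuousOn (s := Set.uIcc α β))
  obtain ⟨φ, hφ, h0⟩ := hc (show (0 : ℝ) ∈ Set.uIcc _ _ by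
    rw [Set.mem_uIcc, proj_sub, proj_sub]
    left
    constructor <;> linarith)
  dsimp only at h0
  rw [proj_sub, sub_eq_zero] at h0
  exact hne φ hφ h0

/-- A vector orthogonal to the direction ψ is a multiple of (-sin ψ, cos ψ). -/
theorem proj_eq_sin_mul {φ ψ : ℝ} {x : ℝ × ℝ} (h : proj ψ x = 0) :
    proj φ x = Real.sin (φ - ψ) * (x.2 * Real.cos ψ - x.1 * Real.sin ψ) := by
  have h1 := Real.sin_sq_add_cos_sq ψ
  unfold proj at *
  rw [Real.sin_sub]
  linear_combination (-(x.1 * Real.cos φ + x.2 * Real.sin φ)) * h1 +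
    (Real.cos φ * Real.cos ψ + Real.sin φ * Real.sin ψ) * h

theorem proj_add_pi (φ : ℝ) (x : ℝ × ℝ) : proj (φ + Real.pi) x = -proj φ x := by
  unfold proj
  rw [Real.cos_add_pi, Real.sin_add_pi]
  ring

theorem exists_proj_eq_zero (x : ℝ × ℝ) : ∃ φ, proj φ x = 0 := by
  have hc := intermediate_value_uIcc ((continuous_proj x).continuousOn
    (s := Set.uIcc 0 (0 + Real.pi)))
  obtain ⟨φ, -, h0⟩ := hc (show (0 : ℝ) ∈ Set.uIcc _ _ by
    rw [Set.mem_uIcc, proj_add_pi]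
    rcases le_total 0 (proj 0 x) with h | h
    · exact Or.inr ⟨by linarith, h⟩
    · exact Or.inl ⟨h, by linarith⟩)
  exact ⟨φ, h0⟩

theorem proj_add_int_mul_pi {φ : ℝ} {x : ℝ × ℝ} (h : proj φ x = 0) (k : ℤ) :
    proj (φ + k * Real.pi) x = 0 := by
  rw [proj_eq_sin_mul h, add_sub_cancel_left, Real.sin_int_mul_pi, zero_mul]

namespace IsAngleList

variable {N : ℕ} {v : Fin N → ℝ × ℝ} {ψ : ℤ → ℝ} {h : ℕ} (A : IsAngleList v ψ h)
include A

theorem eq_of_proj_eq {i : ℤ} {φ : ℝ} (h1 : ψ (i - 1) < φ) (h2 : φ < ψ (i + 1)) {p q : Fin N}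
    (hpq : p ≠ q) (he : proj φ (v p) = proj φ (v q)) : φ = ψ i := by
  obtain ⟨j, rfl⟩ := (A.critical φ).1 ⟨p, q, hpq, he⟩
  have := A.mono.lt_iff_lt.1 h1
  have := A.mono.lt_iff_lt.1 h2
  rw [show j = i by omega]

theorem ne_of_between {i : ℤ} {φ : ℝ} (h1 : ψ i < φ) (h2 : φ < ψ (i + 1)) {p q : Fin N}
    (hpq : p ≠ q) : proj φ (v p) ≠ proj φ (v q) := by
  intro he
  have := A.eq_of_proj_eq (i := i) ((A.mono (by omega)).trans h1) h2 hpq he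
  linarith

theorem proj_lt_of_between {i : ℤ} {α β : ℝ} (h1 : ψ i < α) (h2 : α < ψ (i + 1)) (h3 : ψ i < β)
    (h4 : β < ψ (i + 1)) {p q : Fin N} (hlt : proj α (v p) < proj α (v q)) :
    proj β (v p) < proj β (v q) := by
  refine proj_lt_of_forall_ne hlt fun φ hφ => ?_
  rw [Set.mem_uIcc] at hφ
  refine A.ne_of_between (i := i) ?_ ?_ (by rintro rfl; exact lt_irrefl _ hlt)
  · rcases hφ with hφ | hφ <;> linarith
  · rcases hφ with hφ | hφ <;> linarith

theorem proj_lt_of_lt {i : ℤ} {α : ℝ} (h1 : ψ (i - 1) < α) (h2 : α < ψ (i + 1)) {p q : Fin N}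
    (hlt : proj (ψ i) (v p) < proj (ψ i) (v q)) : proj α (v p) < proj α (v q) := by
  have h3 : ψ (i - 1) < ψ i := A.mono (by omega)
  have h4 : ψ i < ψ (i + 1) := A.mono (by omega)
  refine proj_lt_of_forall_ne hlt fun φ hφ he => ?_
  rw [Set.mem_uIcc] at hφ
  have : φ = ψ i := by
    refine A.eq_of_proj_eq ?_ ?_ (p := p) (q := q) (by rintro rfl; exact lt_irrefl _ hlt) he
    · rcases hφ with hφ | hφ <;> linarith
    · rcases hφ with hφ | hφ <;> linarith
  rw [this] at he
  exact hlt.ne he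

theorem sub_le_pi (i : ℤ) : ψ (i + 1) ≤ ψ i + Real.pi := by
  rw [← A.add_h]
  have := A.h_pos
  exact A.mono.monotone (by omega)

/-- The difference projects to a nonzero multiple of sin (φ - ψ i), which changes sign at ψ i. The
neighbouring critical angles are at most π away. -/
theorem proj_lt_iff_of_eq {i : ℤ} {α β : ℝ} (h1 : ψ (i - 1) < α) (h2 : α < ψ i) (h3 : ψ i < β)
    (h4 : β < ψ (i + 1)) {p q : Fin N} (hpq : p ≠ q)
    (he : proj (ψ i) (v p) = proj (ψ i) (v q)) :
    proj α (v p) < proj α (v q) ↔ ¬ proj β (v p) < proj β (v q) := by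
  have h0 : proj (ψ i) (v p - v q) = 0 := by rw [proj_sub, he, sub_self]
  have hα := proj_eq_sin_mul (φ := α) h0
  have hβ := proj_eq_sin_mul (φ := β) h0
  generalize (v p - v q).2 * Real.cos (ψ i) - (v p - v q).1 * Real.sin (ψ i) = c at hα hβ
  have p1 := A.sub_le_pi (i - 1)
  have p2 := A.sub_le_pi i
  rw [sub_add_cancel] at p1
  have s1 : Real.sin (α - ψ i) < 0 :=
    Real.sin_neg_of_neg_of_neg_pi_lt (by linarith) (by linarith)
  have s2 : 0 < Real.sin (β - ψ i) := Real.sin_pos_of_pos_of_lt_pi (by linarith) (by linarith)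
  have hc : c ≠ 0 := by
    rintro rfl
    rw [mul_zero, proj_sub, sub_eq_zero] at hα
    exact A.ne_of_between (i := i - 1) h1 (by rwa [sub_add_cancel]) hpq hα
  rw [← sub_neg, ← proj_sub, hα, ← sub_neg (b := proj β (v q)), ← proj_sub, hβ]
  rcases lt_or_gt_of_ne hc with hc | hc
  · have := mul_pos_of_neg_of_neg s1 hc
    have := mul_neg_of_pos_of_neg s2 hc
    constructor <;> intro <;> linarith
  · have := mul_neg_of_neg_of_pos s1 hc
    have := mul_pos s2 hc
    constructor
    · intro
      linarith
    · intro
      linarith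

end IsAngleList

/-- An angle before the `i`-th one. -/
noncomputable def midAngle (ψ : ℤ → ℝ) (i : ℤ) : ℝ := (ψ (i - 1) + ψ i) / 2

namespace IsAngleList

variable {N : ℕ} {v : Fin N → ℝ × ℝ} {ψ : ℤ → ℝ} {h : ℕ} (A : IsAngleList v ψ h)

section
include A

theorem lt_midAngle (i : ℤ) : ψ (i - 1) < midAngle ψ i := by
  have : ψ (i - 1) < ψ i := A.mono (by omega)
  unfold midAngle
  linarith

theorem midAngle_lt (i : ℤ) : midAngle ψ i < ψ i := by
  have : ψ (i - 1) < ψ i := A.mono (by omega)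
  unfold midAngle
  linarith

theorem lt_midAngle_succ (i : ℤ) : ψ i < midAngle ψ (i + 1) := by
  have := A.lt_midAngle (i + 1)
  rwa [add_sub_cancel_right] at this

theorem injective_mid (i : ℤ) : Function.Injective fun p => proj (midAngle ψ i) (v p) := by
  intro p q hpq
  by_contra hne
  exact A.ne_of_between (i := i - 1) (A.lt_midAngle i)
    (by rw [sub_add_cancel]; exact A.midAngle_lt i) hne hpq

theorem refine_before (i : ℤ) (p q : Fin N) (hlt : proj (ψ i) (v p) < proj (ψ i) (v q)) :
    proj (midAngle ψ i) (v p) < proj (midAngle ψ i) (v q) :=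
  A.proj_lt_of_lt (A.lt_midAngle i) ((A.midAngle_lt i).trans (A.mono (by omega))) hlt

theorem refine_after (i : ℤ) (p q : Fin N) (hlt : proj (ψ i) (v p) < proj (ψ i) (v q)) :
    proj (midAngle ψ (i + 1)) (v p) < proj (midAngle ψ (i + 1)) (v q) :=
  A.proj_lt_of_lt ((A.mono (by omega)).trans (A.lt_midAngle_succ i)) (A.midAngle_lt (i + 1)) hlt

/-- This is the reversal rule for a move: positions before and after add up to the sum of the ends
of the substring. -/
theorem rank_add_rank (i : ℤ) (p : Fin N) :
    lowerCount (fun q => proj (midAngle ψ i) (v q)) p +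
      lowerCount (fun q => proj (midAngle ψ (i + 1)) (v q)) p + 1 =
    2 * lowerCount (fun q => proj (ψ i) (v q)) p + equalCount (fun q => proj (ψ i) (v q)) p :=
  lowerCount_add_lowerCount (A.refine_before i) (A.refine_after i)
    (fun _ _ hne he => A.proj_lt_iff_of_eq (A.lt_midAngle i) (A.midAngle_lt i)
      (A.lt_midAngle_succ i) (A.midAngle_lt (i + 1)) hne he) p

theorem add_mul_h (i k : ℤ) : ψ (i + k * h) = ψ i + k * Real.pi := by
  induction k with
  | zero => simp
  | succ k ih =>
    rw [add_mul, one_mul, ← add_assoc, A.add_h, ih]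
    push_cast
    ring
  | pred k ih =>
    have := A.add_h (i + (-(k : ℤ) - 1) * h)
    rw [show i + (-(k : ℤ) - 1) * h + h = i + -(k : ℤ) * h by ring, ih] at this
    push_cast at this ⊢
    linarith

theorem existsUnique_proj_eq (a : ℤ) {p q : Fin N} (hpq : p ≠ q) :
    ∃! i : ℤ, a ≤ i ∧ i < a + h ∧ proj (ψ i) (v p) = proj (ψ i) (v q) := by
  have hh := A.h_pos
  obtain ⟨φ, hφ⟩ := exists_proj_eq_zero (v p - v q)
  rw [proj_sub, sub_eq_zero] at hφ
  obtain ⟨i, rfl⟩ := (A.critical φ).1 ⟨p, q, hpq, hφ⟩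
  have hb := Int.emod_nonneg (i - a) (b := h) (by omega)
  have hb' := Int.emod_lt_of_pos (i - a) (b := h) (by omega)
  have he := Int.emod_add_mul_ediv (i - a) h
  refine ⟨a + (i - a) % h, ⟨by omega, by omega, ?_⟩, ?_⟩
  · rw [show a + (i - a) % h = i + (-((i - a) / h)) * h by linarith, A.add_mul_h, ← sub_eq_zero,
      ← proj_sub]
    exact proj_add_int_mul_pi (by rw [proj_sub, hφ, sub_self]) _
  -- Two zeros less than π apart would make the sine multiple vanish identically, yet the points are
  -- separated at the angle `midAngle ψ 0`.
  · have key : ∀ i j : ℤ, i < j → j < i + h → proj (ψ i) (v p) = proj (ψ i) (v q) →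
        proj (ψ j) (v p) ≠ proj (ψ j) (v q) := by
      intro i j hij hj hi hj'
      have h0 : proj (ψ i) (v p - v q) = 0 := by rw [proj_sub, hi, sub_self]
      have h1 := proj_eq_sin_mul (φ := ψ j) h0
      have h2 := proj_eq_sin_mul (φ := midAngle ψ 0) h0
      have h3 : ψ i < ψ j := A.mono hij
      have h4 : ψ j < ψ i + Real.pi := by
        rw [← A.add_h]
        exact A.mono hj
      rw [proj_sub, hj', sub_self] at h1
      have hs : 0 < Real.sin (ψ j - ψ i) := Real.sin_pos_of_pos_of_lt_pi (by linarith) (by linarith)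
      rw [(mul_eq_zero.1 h1.symm).resolve_left hs.ne', mul_zero, proj_sub, sub_eq_zero] at h2
      exact hpq (A.injective_mid 0 h2)
    have hj0 : proj (ψ (a + (i - a) % h)) (v p) = proj (ψ (a + (i - a) % h)) (v q) := by
      rw [show a + (i - a) % h = i + (-((i - a) / h)) * h by linarith, A.add_mul_h, ← sub_eq_zero,
        ← proj_sub]
      exact proj_add_int_mul_pi (by rw [proj_sub, hφ, sub_self]) _
    rintro j ⟨h1, h2, h3⟩
    rcases lt_trichotomy j (a + (i - a) % h) with hlt | heq | hlt
    · exact absurd hj0 (key _ _ hlt (by omega) h3)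
    · exact heq
    · exact absurd h3 (key _ _ hlt (by omega) hj0)

end

/-- The substring of the points whose projection is that of `p`. -/
noncomputable def block (v : Fin N → ℝ × ℝ) (φ : ℝ) (p : Fin N) : Fin N × Fin N :=
  (⟨lowerCount (fun q => proj φ (v q)) p, lowerCount_lt _ p⟩,
    ⟨lowerCount (fun q => proj φ (v q)) p + equalCount (fun q => proj φ (v q)) p - 1, by
      have := lowerCount_add_equalCount_le (fun q => proj φ (v q)) p
      have := equalCount_pos (fun q => proj φ (v q)) p
      omega⟩)

theorem block_congr {φ : ℝ} {p q : Fin N} (he : proj φ (v p) = proj φ (v q)) :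
    block v φ p = block v φ q := by
  unfold block
  simp only [lowerCount_congr (f := fun q => proj φ (v q)) he,
    equalCount_congr (f := fun q => proj φ (v q)) he]

include A in
theorem rankPerm_mem_block {i : ℤ} {p q : Fin N} :
    rankPerm _ (A.injective_mid i) q ∈ Finset.Icc (block v (ψ i) p).1 (block v (ψ i) p).2 ↔
      proj (ψ i) (v q) = proj (ψ i) (v p) := by
  have := equalCount_pos (fun q => proj (ψ i) (v q)) p
  rw [← lowerCount_mem_iff (f := fun q => proj (ψ i) (v q)) (A.refine_before i), Finset.mem_Icc,
    Fin.le_def, Fin.le_def, val_rankPerm]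
  unfold block
  dsimp only
  omega

theorem one_lt_equalCount {φ : ℝ} {p q : Fin N} (hpq : p ≠ q)
    (he : proj φ (v p) = proj φ (v q)) : 1 < equalCount (fun q => proj φ (v q)) p :=
  Finset.one_lt_card.2 ⟨p, by simp, q, by simp [he], hpq⟩

/-- The allowable sequence of the orders of the projections. -/
noncomputable def toAllowableSequence : AllowableSequence N where
  perm i := rankPerm _ (A.injective_mid i)
  switches i := (Finset.univ.filter fun p => 1 < equalCount (fun q => proj (ψ i) (v q)) p).image
    (block v (ψ i))
  h := h
  h_pos := A.h_pos
  perm_add_h i p := by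
    have e : midAngle ψ (i + h) = midAngle ψ i + Real.pi := by
      unfold midAngle
      rw [show i + h - 1 = i - 1 + h by ring, A.add_h, A.add_h]
      ring
    ext
    have := lowerCount_neg (A.injective_mid i) p
    rw [Fin.val_rev, val_rankPerm, val_rankPerm]
    simp only [e, proj_add_pi]
    omega
  switches_nonempty i := by
    obtain ⟨p, q, hpq, he⟩ := (A.critical (ψ i)).2 ⟨i, rfl⟩
    exact ⟨_, Finset.mem_image_of_mem _
      (Finset.mem_filter.2 ⟨Finset.mem_univ p, one_lt_equalCount hpq he⟩)⟩
  switches_lt i I hI := by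
    obtain ⟨p, hp, rfl⟩ := Finset.mem_image.1 hI
    have := (Finset.mem_filter.1 hp).2
    rw [Fin.lt_def]
    unfold block
    dsimp only
    omega
  switches_disjoint i I hI J hJ hne := by
    obtain ⟨p, hp, rfl⟩ := Finset.mem_image.1 hI
    obtain ⟨q, hq, rfl⟩ := Finset.mem_image.1 hJ
    rw [Finset.disjoint_left]
    intro x hx hx'
    obtain ⟨r, rfl⟩ := (rankPerm _ (A.injective_mid i)).surjective x
    rw [A.rankPerm_mem_block] at hx hx'
    exact hne (block_congr (hx.symm.trans hx'))
  perm_succ_of_mem i I hI p hp := by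
    obtain ⟨q, hq, rfl⟩ := Finset.mem_image.1 hI
    rw [A.rankPerm_mem_block] at hp
    have := A.rank_add_rank i p
    rw [← block_congr hp, val_rankPerm, val_rankPerm]
    have := equalCount_pos (fun q => proj (ψ i) (v q)) p
    unfold block
    dsimp only
    omega
  perm_succ_of_notMem i p hp := by
    -- A point in no switch is alone at its value, so its rank is the same before and after.
    have h1 : ¬ 1 < equalCount (fun q => proj (ψ i) (v q)) p := by
      intro hc
      exact hp _ (Finset.mem_image_of_mem _ (Finset.mem_filter.2 ⟨Finset.mem_univ p, hc⟩))
        (A.rankPerm_mem_block.2 rfl)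
    have h2 := A.rank_add_rank i p
    have h3 := (lowerCount_mem_iff (p := p) (A.refine_before i)).2 rfl
    have h4 := (lowerCount_mem_iff (p := p) (A.refine_after i)).2 rfl
    ext
    rw [val_rankPerm, val_rankPerm]
    omega
  switch_once a p q hpq := by
    refine (existsUnique_congr fun i => ?_).1 (A.existsUnique_proj_eq a hpq)
    refine and_congr_right fun _ => and_congr_right fun _ => ⟨fun he => ?_, ?_⟩
    · exact ⟨_, Finset.mem_image_of_mem _
        (Finset.mem_filter.2 ⟨Finset.mem_univ p, one_lt_equalCount hpq he⟩),
        A.rankPerm_mem_block.2 rfl, A.rankPerm_mem_block.2 he.symm⟩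
    · rintro ⟨I, hI, h1, h2⟩
      obtain ⟨r, -, rfl⟩ := Finset.mem_image.1 hI
      rw [A.rankPerm_mem_block] at h1 h2
      exact h1.trans h2.symm

theorem isCircularSequence (A : IsAngleList v ψ h) :
    IsCircularSequence v A.toAllowableSequence.perm := by
  -- The i-th permutation is taken between ψ (i - 1) and ψ i, whence the shift of the index.
  refine ⟨fun i => ψ (i - 1), A.mono.comp fun i j hij => by omega, ?_, ?_⟩
  · ext φ
    rw [Set.mem_ofPred_eq, A.critical]
    constructor
    · rintro ⟨i, rfl⟩
      exact ⟨i - 1, rfl⟩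
    · rintro ⟨i, rfl⟩
      exact ⟨i + 1, by simp⟩
  · intro i φ h1 h2 p q
    dsimp only at h1 h2
    have h3 := A.lt_midAngle i
    have h4 := A.midAngle_lt i
    rw [show i = i - 1 + 1 by ring] at h4
    rw [show i + 1 - 1 = i - 1 + 1 by ring] at h2
    change _ ↔ rankPerm _ (A.injective_mid i) p < rankPerm _ (A.injective_mid i) q
    rw [Fin.lt_def, val_rankPerm, val_rankPerm, lowerCount_lt_iff]
    rw [sub_add_cancel] at h2 h4
    rw [← sub_add_cancel i 1] at h2
    constructor
    · exact A.proj_lt_of_between h1 h2 h3 (by rw [sub_add_cancel]; exact A.midAngle_lt i)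
    · exact A.proj_lt_of_between h3 (by rw [sub_add_cancel]; exact A.midAngle_lt i) h1 h2

end IsAngleList

/-! ### Shifted sequences, and sequences of centrally symmetric sets. -/

theorem lowerCount_comp_rev {N : ℕ} (f : Fin N → ℝ) (p : Fin N) :
    lowerCount (fun q => f q.rev) p = lowerCount f p.rev :=
  Finset.card_equiv Fin.revPerm fun q => by simp

theorem lowerCount_add_equalCount_add {N : ℕ} (f : Fin N → ℝ) (p : Fin N) :
    lowerCount f p + equalCount f p + lowerCount (fun q => -f q) p = N := by
  have h2 : N = ∑ q : Fin N, 1 := by simp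
  unfold lowerCount equalCount
  rw [Finset.card_filter, Finset.card_filter, Finset.card_filter]
  conv_rhs => rw [h2]
  rw [← Finset.sum_add_distrib, ← Finset.sum_add_distrib]
  refine Finset.sum_congr rfl fun q _ => ?_
  rcases lt_trichotomy (f q) (f p) with h | h | h
  · simp [h, h.not_gt, h.ne]
  · simp [h]
  · simp [h, h.not_gt, h.ne']

namespace AllowableSequence

variable {N : ℕ}

/-- The sequence that starts at the permutation of index `a`, with the points relabelled by their
positions in it. -/
def shift (S : AllowableSequence N) (a : ℤ) : AllowableSequence N where
  perm i := (S.perm a).symm.trans (S.perm (i + a))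
  switches i := S.switches (i + a)
  h := S.h
  h_pos := S.h_pos
  perm_add_h i p := by
    rw [Equiv.trans_apply, show i + S.h + a = i + a + S.h by ring, S.perm_add_h]
    rfl
  switches_nonempty i := S.switches_nonempty _
  switches_lt i := S.switches_lt _
  switches_disjoint i := S.switches_disjoint _
  perm_succ_of_mem i I hI p hp := by
    rw [show i + 1 + a = i + a + 1 by ring]
    exact S.perm_succ_of_mem _ I hI _ hp
  perm_succ_of_notMem i p hp := by
    rw [show i + 1 + a = i + a + 1 by ring]
    exact S.perm_succ_of_notMem _ _ hp
  switch_once b p q hpq := by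
    obtain ⟨i, ⟨h1, h2, h3⟩, hu⟩ := S.switch_once (b + a) _ _
      ((S.perm a).symm.injective.ne hpq)
    refine ⟨i - a, ⟨by omega, by omega, ?_⟩, ?_⟩
    · rw [sub_add_cancel]
      exact h3
    · rintro j ⟨h4, h5, h6⟩
      have := hu (j + a) ⟨by omega, by omega, h6⟩
      omega

end AllowableSequence

namespace IsAngleList

variable {N : ℕ} {v : Fin N → ℝ × ℝ} {ψ : ℤ → ℝ} {h : ℕ} (A : IsAngleList v ψ h)

theorem mem_switches {i : ℤ} {I : Fin N × Fin N} : I ∈ A.toAllowableSequence.switches i ↔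
    ∃ p, 1 < equalCount (fun q => proj (ψ i) (v q)) p ∧ block v (ψ i) p = I := by
  change I ∈ Finset.image _ _ ↔ _
  simp

theorem card_block (φ : ℝ) (p : Fin N) : (Finset.Icc (block v φ p).1 (block v φ p).2).card =
    equalCount (fun q => proj φ (v q)) p := by
  have := equalCount_pos (fun q => proj φ (v q)) p
  rw [Fin.card_Icc]
  unfold block
  dsimp only
  omega

theorem proj_neg (φ : ℝ) (x : ℝ × ℝ) : proj φ (-x) = -proj φ x := by
  simp only [proj, Prod.fst_neg, Prod.snd_neg]
  ring

/-- The mirror image of the substring of `p` is that of `p.rev`, whose projection is the negative.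
They agree exactly when the projection is 0. -/
theorem isCentered_block (hv : ∀ p, v p.rev = -v p) (φ : ℝ) (p : Fin N) :
    IsCentered (block v φ p) ↔ proj φ (v p) = 0 := by
  have h1 := lowerCount_add_equalCount_add (fun q => proj φ (v q)) p
  have h2 := equalCount_pos (fun q => proj φ (v q)) p
  have h3 := lowerCount_comp_rev (fun q => proj φ (v q)) p
  simp only [hv, proj_neg] at h3
  rw [h3] at h1
  have h4 := lowerCount_lt_iff (f := fun q => proj φ (v q)) (p := p) (q := p.rev)
  have h5 := lowerCount_lt_iff (f := fun q => proj φ (v q)) (p := p.rev) (q := p)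
  simp only [hv, proj_neg] at h4 h5
  have h6 : IsCentered (block v φ p) ↔
      lowerCount (fun q => proj φ (v q)) p = lowerCount (fun q => proj φ (v q)) p.rev := by
    unfold IsCentered block
    rw [Fin.ext_iff, Fin.val_rev]
    dsimp only
    omega
  rw [h6]
  constructor
  · intro he
    rw [he, lt_self_iff_false, false_iff] at h4
    rw [he, lt_self_iff_false, false_iff] at h5
    linarith
  · intro he
    refine le_antisymm (not_lt.1 fun hlt => ?_) (not_lt.1 fun hlt => ?_)
    · have := h5.1 hlt
      linarith
    · have := h4.1 hlt
      linarith

theorem centrallySymmetric (hv : ∀ p, v p.rev = -v p) :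
    A.toAllowableSequence.CentrallySymmetric := by
  intro p
  refine ⟨p.rev, fun i => ?_⟩
  change rankPerm _ (A.injective_mid i) _ = (rankPerm _ (A.injective_mid i) _).rev
  have h1 := lowerCount_neg (A.injective_mid i) p
  have h3 := lowerCount_comp_rev (fun q => proj (midAngle ψ i) (v q)) p
  simp only [hv, proj_neg] at h3
  ext
  rw [Fin.val_rev, val_rankPerm, val_rankPerm]
  omega

theorem exists_centered_iff (hv : ∀ p, v p.rev = -v p) (hN : ∀ p : Fin N, p.rev ≠ p) {i : ℤ} :
    (∃ I ∈ A.toAllowableSequence.switches i, IsCentered I) ↔ ∃ p, proj (ψ i) (v p) = 0 := by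
  constructor
  · rintro ⟨I, hI, hc⟩
    obtain ⟨p, -, rfl⟩ := A.mem_switches.1 hI
    exact ⟨p, (isCentered_block hv _ p).1 hc⟩
  · rintro ⟨p, hp⟩
    refine ⟨_, A.mem_switches.2 ⟨p, one_lt_equalCount (hN p).symm ?_, rfl⟩,
      (isCentered_block hv _ p).2 hp⟩
    rw [hv, proj_neg, hp, neg_zero]

theorem exists_centered_card (hv : ∀ p, v p.rev = -v p) (hN : ∀ p : Fin N, p.rev ≠ p) {i : ℤ}
    {n : ℕ} (hn : 0 < n) (hc : (Finset.univ.filter fun p => proj (ψ i) (v p) = 0).card = n) :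
    ∃ I ∈ A.toAllowableSequence.switches i, IsCentered I ∧
      (Finset.Icc I.1 I.2).card = n := by
  rw [← hc] at hn
  obtain ⟨p, hp⟩ := Finset.card_pos.1 hn
  have hp := (Finset.mem_filter.1 hp).2
  refine ⟨_, A.mem_switches.2 ⟨p, one_lt_equalCount (hN p).symm ?_, rfl⟩,
      (isCentered_block hv _ p).2 hp, ?_⟩
  · rw [hv, proj_neg, hp, neg_zero]
  · rw [card_block, ← hc]
    unfold equalCount
    simp only [hp]

end IsAngleList

/-! ### The tricolumnar array and its directions. -/

section Array

variable {D : ℕ}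

/-- The first coordinate of a point of the tricolumnar array, centered at the origin. -/
def arrayX (D : ℕ) (p : Fin (2 * D + 4)) : ℤ :=
  if (p : ℕ) < 2 then -1 else if (p : ℕ) < 2 * D + 2 then 0 else 1

/-- Twice the second coordinate of a point of the tricolumnar array, centered at the origin. -/
def arrayY (D : ℕ) (p : Fin (2 * D + 4)) : ℤ :=
  if (p : ℕ) = 0 then -1 else if (p : ℕ) = 1 then 1 else
  -- The middle column has the heights ±2, …, ±2D, and 0 is left out. The side columns have ±1.
  if (p : ℕ) < D + 2 then 2 * p - 2 * (D + 2) else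
  if (p : ℕ) < 2 * D + 2 then 2 * p - 2 * (D + 1) else
  if (p : ℕ) = 2 * D + 2 then -1 else 1

theorem array_cases (p : Fin (2 * D + 4)) :
    (arrayX D p = -1 ∧ (arrayY D p = -1 ∧ (p : ℕ) = 0 ∨ arrayY D p = 1 ∧ (p : ℕ) = 1)) ∨
    (arrayX D p = 0 ∧ 2 ≤ (p : ℕ) ∧ (p : ℕ) < 2 * D + 2 ∧
      (arrayY D p = 2 * p - 2 * (D + 2) ∧ (p : ℕ) < D + 2 ∨
        arrayY D p = 2 * p - 2 * (D + 1) ∧ D + 2 ≤ (p : ℕ))) ∨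
    (arrayX D p = 1 ∧ (arrayY D p = -1 ∧ (p : ℕ) = 2 * D + 2 ∨
      arrayY D p = 1 ∧ (p : ℕ) = 2 * D + 3)) := by
  have := p.isLt
  unfold arrayX arrayY
  split_ifs <;> omega

theorem array_ext {p q : Fin (2 * D + 4)} (hX : arrayX D p = arrayX D q)
    (hY : arrayY D p = arrayY D q) : p = q := by
  have := array_cases p
  have := array_cases q
  ext
  omega

theorem array_rev (p : Fin (2 * D + 4)) :
    arrayX D p.rev = -arrayX D p ∧ arrayY D p.rev = -arrayY D p := by
  have := array_cases p
  have := array_cases p.rev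
  have h := Fin.val_rev p
  have := p.isLt
  omega

/-- The slopes of the lines joining the points of the array, in increasing order. -/
def arraySlope (D : ℕ) (r : ℤ) : ℤ :=
  -- For 0 < r < 2D + 4 these are the odd numbers from -(2D+1) to 2D+1 with 0 inserted. With the
  -- vertical direction this makes 2D + 4 directions.
  if r ≤ D + 1 then 2 * r - 2 * D - 3 else if r = D + 2 then 0 else 2 * r - 2 * D - 5

theorem arraySlope_lt (r : ℤ) : arraySlope D r < arraySlope D (r + 1) := by
  unfold arraySlope
  split_ifs <;> omega

/-- The slope, or the vertical direction, in the move `i`. -/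
def IsArrayDirection (D : ℕ) (i : ℤ) (x y : ℤ) : Prop :=
  (i % (2 * D + 4) = 0 → x = 0) ∧
    (i % (2 * D + 4) ≠ 0 → y = arraySlope D (i % (2 * D + 4)) * x)

/-- The labelled points of the array. -/
noncomputable def arrayPoint (D : ℕ) (p : Fin (2 * D + 4)) : ℝ × ℝ :=
  ((arrayX D p : ℝ), (arrayY D p : ℝ))

/-- The critical angles of the array. -/
noncomputable def arrayAngle (D : ℕ) (i : ℤ) : ℝ :=
  ((i / (2 * D + 4) : ℤ) : ℝ) * Real.pi + if i % (2 * D + 4) = 0 then 0 else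
    -- Projecting along this angle identifies the points of a line with that slope. The angle 0
    -- belongs to vertical lines.
    Real.pi / 2 + Real.arctan (arraySlope D (i % (2 * D + 4)))

theorem arrayPoint_rev (p : Fin (2 * D + 4)) : arrayPoint D p.rev = -arrayPoint D p := by
  unfold arrayPoint
  rw [(array_rev p).1, (array_rev p).2]
  ext <;> simp

theorem proj_pi_div_two_add_arctan (s x y : ℝ) : proj (Real.pi / 2 + Real.arctan s) (x, y) =
    Real.cos (Real.arctan s) * (y - s * x) := by
  have h := Real.tan_mul_cos (Real.cos_arctan_pos s).ne'
  rw [Real.tan_arctan] at h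
  unfold proj
  rw [add_comm (Real.pi / 2), Real.cos_add_pi_div_two, Real.sin_add_pi_div_two]
  dsimp only
  linear_combination x * h

theorem proj_arrayAngle (i x y : ℤ) :
    proj (arrayAngle D i) ((x : ℝ), (y : ℝ)) = 0 ↔ IsArrayDirection D i x y := by
  have hshift : ∀ (k : ℤ) (φ : ℝ) (w : ℝ × ℝ), proj (k * Real.pi + φ) w = 0 ↔ proj φ w = 0 := by
    intro k φ w
    rw [add_comm]
    constructor
    · intro h
      have := proj_add_int_mul_pi h (-k)
      rwa [Int.cast_neg, neg_mul, add_neg_cancel_right] at this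
    · exact fun h => proj_add_int_mul_pi h k
  unfold arrayAngle IsArrayDirection
  rw [hshift]
  split_ifs with h
  · simp [proj, h]
  · rw [proj_pi_div_two_add_arctan, mul_eq_zero, or_iff_right (Real.cos_arctan_pos _).ne',
      sub_eq_zero]
    simp only [h, false_imp_iff, true_and, ne_eq, not_false_eq_true, true_imp_iff]
    norm_cast

theorem proj_arrayPoint_eq_iff (i : ℤ) (p q : Fin (2 * D + 4)) :
    proj (arrayAngle D i) (arrayPoint D p) = proj (arrayAngle D i) (arrayPoint D q) ↔
      IsArrayDirection D i (arrayX D p - arrayX D q) (arrayY D p - arrayY D q) := by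
  rw [← proj_arrayAngle, ← sub_eq_zero, ← proj_sub]
  unfold arrayPoint
  rw [Prod.mk_sub_mk]
  push_cast
  rfl

theorem arrayAngle_lt (i : ℤ) : arrayAngle D i < arrayAngle D (i + 1) := by
  have hb := Int.emod_nonneg i (b := 2 * D + 4) (by omega)
  have hb' := Int.emod_lt_of_pos i (b := 2 * D + 4) (by omega)
  have he := Int.emod_add_mul_ediv i (2 * D + 4)
  have hpi := Real.pi_pos
  have hl := fun x => Real.neg_pi_div_two_lt_arctan x
  have hr := fun x => Real.arctan_lt_pi_div_two x
  unfold arrayAngle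
  by_cases hlast : i % (2 * D + 4) = 2 * D + 3
  · have e1 : (i + 1) / (2 * D + 4) = i / (2 * D + 4) + 1 := by
      rw [← Int.add_mul_ediv_right i 1 (show (2 * (D : ℤ) + 4) ≠ 0 by omega)]
      apply le_antisymm
      · exact Int.ediv_le_ediv (by omega) (by omega)
      · rw [Int.le_ediv_iff_mul_le (by omega)]
        have e2 : (i + 1 * (2 * (D : ℤ) + 4)) / (2 * D + 4) = i / (2 * D + 4) + 1 :=
          Int.add_mul_ediv_right i 1 (by omega)
        rw [e2]
        linarith
    have e2 : (i + 1) % (2 * D + 4) = 0 := by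
      have := Int.emod_add_mul_ediv (i + 1) (2 * D + 4)
      rw [e1] at this
      linarith
    rw [e1, e2, if_pos rfl, hlast, if_neg (by omega)]
    have := hr (arraySlope D (2 * D + 3))
    push_cast
    linarith
  · have e1 : (i + 1) / (2 * D + 4) = i / (2 * D + 4) := by
      apply le_antisymm
      · rw [← Int.lt_add_one_iff, Int.ediv_lt_iff_lt_mul (by omega)]
        have : i % (2 * D + 4) < 2 * D + 3 := by omega
        linarith
      · exact Int.ediv_le_ediv (by omega) (by omega)
    have e2 : (i + 1) % (2 * D + 4) = i % (2 * D + 4) + 1 := by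
      have := Int.emod_add_mul_ediv (i + 1) (2 * D + 4)
      rw [e1] at this
      linarith
    rw [e1, e2, if_neg (show i % (2 * (D : ℤ) + 4) + 1 ≠ 0 by omega)]
    split_ifs with h0
    · have := hl (arraySlope D (i % (2 * D + 4) + 1))
      linarith
    · have : Real.arctan (arraySlope D (i % (2 * D + 4))) <
          Real.arctan (arraySlope D (i % (2 * D + 4) + 1)) :=
        Real.arctan_strictMono (by exact_mod_cast arraySlope_lt _)
      linarith

/-- Heights in the middle column are even and those in the side columns odd, so adjacent columns
give odd slopes. The two side columns give -1, 0 and 1. -/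
theorem exists_arraySlope_eq {p q : Fin (2 * D + 4)} (hX : arrayX D p ≠ arrayX D q) :
    ∃ r : ℤ, 0 < r ∧ r < 2 * D + 4 ∧
      arrayY D p - arrayY D q = arraySlope D r * (arrayX D p - arrayX D q) := by
  have key : ∀ s : ℤ, s = 0 ∨ s % 2 = 1 → -(2 * D + 1) ≤ s → s ≤ 2 * D + 1 →
      arrayY D p - arrayY D q = s * (arrayX D p - arrayX D q) →
      ∃ r : ℤ, 0 < r ∧ r < 2 * D + 4 ∧
        arrayY D p - arrayY D q = arraySlope D r * (arrayX D p - arrayX D q) := by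
    intro s hs h1 h2 he
    obtain ⟨r, h3, h4, h5⟩ : ∃ r : ℤ, 0 < r ∧ r < 2 * D + 4 ∧ arraySlope D r = s := by
      unfold arraySlope
      rcases lt_trichotomy s 0 with h | h | h
      · exact ⟨(s + 2 * D + 3) / 2, by omega, by omega, by split_ifs <;> omega⟩
      · exact ⟨D + 2, by omega, by omega, by split_ifs <;> omega⟩
      · exact ⟨(s + 2 * D + 5) / 2, by omega, by omega, by split_ifs <;> omega⟩
    exact ⟨r, h3, h4, h5.symm ▸ he⟩
  have hp := array_cases p
  have hq := array_cases q
  rcases hp with ⟨h1, h2⟩ | ⟨h1, h2⟩ | ⟨h1, h2⟩ <;>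
    rcases hq with ⟨h3, h4⟩ | ⟨h3, h4⟩ | ⟨h3, h4⟩
  · omega
  · exact key (arrayY D q - arrayY D p) (by omega) (by omega) (by omega) (by rw [h1, h3]; ring)
  · exact key ((arrayY D q - arrayY D p) / 2) (by omega) (by omega) (by omega)
      (by rw [h1, h3]; omega)
  · exact key (arrayY D p - arrayY D q) (by omega) (by omega) (by omega) (by rw [h1, h3]; ring)
  · omega
  · exact key (arrayY D q - arrayY D p) (by omega) (by omega) (by omega) (by rw [h1, h3]; ring)
  · exact key ((arrayY D p - arrayY D q) / 2) (by omega) (by omega) (by omega)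
      (by rw [h1, h3]; omega)
  · exact key (arrayY D p - arrayY D q) (by omega) (by omega) (by omega) (by rw [h1, h3]; ring)
  · omega

/-- The lower right point sees the upper half of the middle column in the slopes below -1, and the
lower left point sees it in those above 1. The remaining directions come from the four side points.
-/
theorem exists_isArrayDirection (i : ℤ) : ∃ p q : Fin (2 * D + 4), p ≠ q ∧
    IsArrayDirection D i (arrayX D p - arrayX D q) (arrayY D p - arrayY D q) := by
  have hb := Int.emod_nonneg i (b := 2 * D + 4) (by omega)
  have hb' := Int.emod_lt_of_pos i (b := 2 * D + 4) (by omega)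
  unfold IsArrayDirection
  generalize i % (2 * D + 4) = r at *
  have key : ∀ a b : ℕ, ∀ (ha : a < 2 * D + 4) (hb : b < 2 * D + 4), a ≠ b →
      ((r = 0 → arrayX D ⟨a, ha⟩ - arrayX D ⟨b, hb⟩ = 0) ∧
        (r ≠ 0 → arrayY D ⟨a, ha⟩ - arrayY D ⟨b, hb⟩ =
          arraySlope D r * (arrayX D ⟨a, ha⟩ - arrayX D ⟨b, hb⟩))) →
      ∃ p q : Fin (2 * D + 4), p ≠ q ∧ ((r = 0 → arrayX D p - arrayX D q = 0) ∧
        (r ≠ 0 → arrayY D p - arrayY D q = arraySlope D r * (arrayX D p - arrayX D q))) :=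
    fun a b ha hb hne h => ⟨⟨a, ha⟩, ⟨b, hb⟩, by rwa [Ne, Fin.mk.injEq], h⟩
  have hy := array_cases (⟨2 * D + 2, by omega⟩ : Fin (2 * D + 4))
  have hz := array_cases (⟨2 * D + 3, by omega⟩ : Fin (2 * D + 4))
  have hz' := array_cases (⟨0, by omega⟩ : Fin (2 * D + 4))
  have hy' := array_cases (⟨1, by omega⟩ : Fin (2 * D + 4))
  dsimp only at hy hz hz' hy'
  rcases lt_trichotomy r 0 with h | h | h
  · omega
  · exact key 0 1 (by omega) (by omega) (by omega) ⟨fun _ => by omega, fun h0 => absurd h h0⟩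
  rcases lt_trichotomy r (D + 1) with h1 | h1 | h1
  · have ha := array_cases (⟨2 * D + 2 - r.toNat, by omega⟩ : Fin (2 * D + 4))
    dsimp only at ha
    refine key (2 * D + 2) (2 * D + 2 - r.toNat) (by omega) (by omega) (by omega)
      ⟨fun h0 => by omega, fun _ => ?_⟩
    have e1 : arrayX D ⟨2 * D + 2, by omega⟩ - arrayX D ⟨2 * D + 2 - r.toNat, by omega⟩ = 1 := by
      omega
    rw [e1, mul_one]
    unfold arraySlope
    split_ifs <;> omega
  · refine key (2 * D + 2) 1 (by omega) (by omega) (by omega) ⟨fun h0 => by omega, fun _ => ?_⟩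
    have e1 : arraySlope D r = -1 := by
      unfold arraySlope
      split_ifs <;> omega
    rw [e1]
    omega
  rcases lt_trichotomy r (D + 3) with h2 | h2 | h2
  · refine key (2 * D + 3) 1 (by omega) (by omega) (by omega) ⟨fun h0 => by omega, fun _ => ?_⟩
    have e1 : arraySlope D r = 0 := by
      unfold arraySlope
      split_ifs <;> omega
    rw [e1]
    omega
  · refine key (2 * D + 3) 0 (by omega) (by omega) (by omega) ⟨fun h0 => by omega, fun _ => ?_⟩
    have e1 : arraySlope D r = 1 := by
      unfold arraySlope
      split_ifs <;> omega
    rw [e1]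
    omega
  · have ha := array_cases (⟨r.toNat - 2, by omega⟩ : Fin (2 * D + 4))
    dsimp only at ha
    refine key (r.toNat - 2) 0 (by omega) (by omega) (by omega)
      ⟨fun h0 => by omega, fun _ => ?_⟩
    have e1 : arrayX D ⟨r.toNat - 2, by omega⟩ - arrayX D ⟨0, by omega⟩ = 1 := by
      omega
    rw [e1, mul_one]
    unfold arraySlope
    split_ifs <;> omega

theorem isAngleList_array (D : ℕ) : IsAngleList (arrayPoint D) (arrayAngle D) (2 * D + 4) where
  injective p q h := by
    unfold arrayPoint at h
    rw [Prod.mk.injEq, Int.cast_inj, Int.cast_inj] at h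
    exact array_ext h.1 h.2
  mono := strictMono_int_of_lt_succ arrayAngle_lt
  h_pos := by omega
  add_h i := by
    have e : ((2 * D + 4 : ℕ) : ℤ) = 1 * (2 * D + 4) := by
      push_cast
      ring
    unfold arrayAngle
    rw [e, Int.add_mul_emod_self_right, Int.add_mul_ediv_right _ _ (by omega)]
    push_cast
    ring
  critical φ := by
    constructor
    · rintro ⟨p, q, hpq, he⟩
      -- Reduction to a half turn. Its left end is the vertical direction, and the other angles have
      -- the form π/2 + arctan s.
      set k := ⌊φ / Real.pi⌋ with hk
      have hpi := Real.pi_pos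
      have hk1 : k * Real.pi ≤ φ := by
        rw [← le_div_iff₀ hpi]
        exact Int.floor_le _
      have hk2 : φ < (k + 1) * Real.pi := by
        rw [← div_lt_iff₀ hpi]
        exact Int.lt_floor_add_one _
      rw [← sub_eq_zero, ← proj_sub] at he
      have h0 := proj_add_int_mul_pi he (-k)
      have hdiv : ∀ r : ℤ, 0 ≤ r → r < 2 * D + 4 → (r + k * (2 * D + 4)) / (2 * D + 4) = k ∧
          (r + k * (2 * D + 4)) % (2 * D + 4) = r := by
        intro r h1 h2
        rw [Int.add_mul_ediv_right _ _ (by omega), Int.add_mul_emod_self_right,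
          Int.ediv_eq_zero_of_lt h1 h2, Int.emod_eq_of_lt h1 h2, zero_add]
        exact ⟨rfl, rfl⟩
      have e1 : arrayPoint D p - arrayPoint D q =
          (((arrayX D p - arrayX D q : ℤ) : ℝ), ((arrayY D p - arrayY D q : ℤ) : ℝ)) := by
        unfold arrayPoint
        rw [Prod.mk_sub_mk]
        push_cast
        rfl
      rw [e1] at h0
      push_cast at h0
      rcases hk1.eq_or_lt with h1 | h1
      · refine ⟨0 + k * (2 * D + 4), ?_⟩
        unfold arrayAngle
        rw [(hdiv 0 le_rfl (by omega)).1, (hdiv 0 le_rfl (by omega)).2, if_pos rfl, add_zero, h1]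
      · have e2 : φ + -(k : ℝ) * Real.pi = Real.pi / 2 +
            Real.arctan (Real.tan (φ + -k * Real.pi - Real.pi / 2)) := by
          rw [Real.arctan_tan (by linarith) (by linarith)]
          ring
        rw [e2, proj_pi_div_two_add_arctan, mul_eq_zero,
          or_iff_right (Real.cos_arctan_pos _).ne', sub_eq_zero] at h0
        have hX : arrayX D p ≠ arrayX D q := by
          intro hX
          rw [hX, sub_self, mul_zero, sub_eq_zero, Int.cast_inj] at h0
          exact hpq (array_ext hX h0)
        obtain ⟨r, h2, h3, h4⟩ := exists_arraySlope_eq hX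
        have hX' : (arrayX D p : ℝ) - arrayX D q ≠ 0 := by
          rw [sub_ne_zero]
          exact_mod_cast hX
        have h4' : (arrayY D p : ℝ) - arrayY D q =
            arraySlope D r * (arrayX D p - arrayX D q) := by
          exact_mod_cast h4
        rw [h4'] at h0
        have h5 := mul_right_cancel₀ hX' h0
        refine ⟨r + k * (2 * D + 4), ?_⟩
        unfold arrayAngle
        rw [(hdiv r h2.le h3).1, (hdiv r h2.le h3).2, if_neg h2.ne', h5, ← e2]
        ring
    · rintro ⟨i, rfl⟩
      obtain ⟨p, q, hpq, h⟩ := exists_isArrayDirection (D := D) i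
      exact ⟨p, q, hpq, (proj_arrayPoint_eq_iff i p q).2 h⟩

end Array

/-! ### The sequence of the array and its crossings. -/

section Array

variable {D : ℕ}

/-- The allowable sequence of the tricolumnar array. -/
noncomputable def arraySequence (D : ℕ) : AllowableSequence (2 * D + 4) :=
  (isAngleList_array D).toAllowableSequence

theorem rev_ne_self (p : Fin (2 * D + 4)) : p.rev ≠ p := by
  rw [Ne, Fin.ext_iff, Fin.val_rev]
  omega

theorem proj_arrayPoint_eq_zero (i : ℤ) (p : Fin (2 * D + 4)) :
    proj (arrayAngle D i) (arrayPoint D p) = 0 ↔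
      IsArrayDirection D i (arrayX D p) (arrayY D p) :=
  proj_arrayAngle i _ _

theorem arrayPoint_central_cases {i : ℤ} {p : Fin (2 * D + 4)}
    (h : proj (arrayAngle D i) (arrayPoint D p) = 0) :
    i % (2 * D + 4) = 0 ∨ i % (2 * D + 4) = D + 1 ∨ i % (2 * D + 4) = D + 3 := by
  rw [proj_arrayPoint_eq_zero] at h
  have hp := array_cases p
  have hs : arraySlope D (i % (2 * D + 4)) = arraySlope D (i % (2 * D + 4)) := rfl
  unfold IsArrayDirection at h
  conv_rhs at hs => unfold arraySlope
  by_cases h0 : i % (2 * D + 4) = 0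
  · exact Or.inl h0
  have h2 := h.2 h0
  generalize arraySlope D (i % (2 * D + 4)) = s at *
  rcases hp with ⟨h3, h4⟩ | ⟨h3, h4⟩ | ⟨h3, h4⟩ <;> rw [h3] at h2 <;> split_ifs at hs <;> omega

theorem card_central {i : ℤ} :
    (i % (2 * D + 4) = 0 → (Finset.univ.filter fun p =>
      proj (arrayAngle D i) (arrayPoint D p) = 0).card = 2 * D) ∧
    (i % (2 * D + 4) = D + 1 ∨ i % (2 * D + 4) = D + 3 → (Finset.univ.filter fun p =>
      proj (arrayAngle D i) (arrayPoint D p) = 0).card = 2) := by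
  constructor
  · intro h0
    have e : (Finset.univ.filter fun p : Fin (2 * D + 4) =>
        proj (arrayAngle D i) (arrayPoint D p) = 0) =
        Finset.Icc ⟨2, by omega⟩ ⟨2 * D + 1, by omega⟩ := by
      ext p
      have hp := array_cases p
      rw [Finset.mem_filter, proj_arrayPoint_eq_zero]
      simp only [IsArrayDirection, h0, Finset.mem_univ, true_and, Finset.mem_Icc, Fin.le_def,
        ne_eq, not_true_eq_false, false_imp_iff, and_true, true_imp_iff]
      omega
    rw [e, Fin.card_Icc]
    dsimp only
    omega
  · have key : ∀ a b : Fin (2 * D + 4), a ≠ b →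
        (∀ p, IsArrayDirection D i (arrayX D p) (arrayY D p) ↔ p = a ∨ p = b) →
        (Finset.univ.filter fun p : Fin (2 * D + 4) =>
          proj (arrayAngle D i) (arrayPoint D p) = 0).card = 2 := by
      intro a b hne hab
      refine (congrArg Finset.card ?_).trans (Finset.card_pair hne)
      ext p
      rw [Finset.mem_filter, proj_arrayPoint_eq_zero, hab]
      simp
    unfold IsArrayDirection at key
    rintro (h | h)
    · refine key ⟨1, by omega⟩ ⟨2 * D + 2, by omega⟩ (by rw [Ne, Fin.mk.injEq]; omega) fun p => ?_
      have hp := array_cases p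
      have e1 : arraySlope D (D + 1) = -1 := by
        unfold arraySlope
        split_ifs <;> omega
      rw [h, e1, Fin.ext_iff, Fin.ext_iff]
      dsimp only
      omega
    · refine key ⟨0, by omega⟩ ⟨2 * D + 3, by omega⟩ (by rw [Ne, Fin.mk.injEq]; omega) fun p => ?_
      have hp := array_cases p
      have e1 : arraySlope D (D + 3) = 1 := by
        unfold arraySlope
        split_ifs <;> omega
      rw [h, e1, Fin.ext_iff, Fin.ext_iff]
      dsimp only
      omega

theorem arraySequence_centered_cases {i : ℤ}
    (h : ∃ I ∈ (arraySequence D).switches i, IsCentered I) :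
    i % (2 * D + 4) = 0 ∨ i % (2 * D + 4) = D + 1 ∨ i % (2 * D + 4) = D + 3 := by
  obtain ⟨p, hp⟩ := ((isAngleList_array D).exists_centered_iff arrayPoint_rev rev_ne_self).1 h
  exact arrayPoint_central_cases hp

theorem arraySequence_block (hD : 0 < D) {i : ℤ} (h : i % (2 * D + 4) = 0) :
    ∃ I ∈ (arraySequence D).switches i, IsCentered I ∧ (Finset.Icc I.1 I.2).card = 2 * D :=
  (isAngleList_array D).exists_centered_card arrayPoint_rev rev_ne_self (by omega)
    (card_central.1 h)

theorem arraySequence_transposition {i : ℤ}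
    (h : i % (2 * D + 4) = D + 1 ∨ i % (2 * D + 4) = D + 3) :
    ∃ I ∈ (arraySequence D).switches i, IsCentered I ∧ (Finset.Icc I.1 I.2).card = 2 * 1 :=
  (isAngleList_array D).exists_centered_card arrayPoint_rev rev_ne_self (by omega)
    (card_central.2 h)

/-- A side column has two points. Another line off the centre has at most one point in each column,
and three are excluded by the parity of the intercept. -/
theorem arraySequence_noncentralGeneralPosition (D : ℕ) :
    (arraySequence D).NoncentralGeneralPosition := by
  intro i I hI hc
  obtain ⟨p, hp, rfl⟩ := (isAngleList_array D).mem_switches.1 hI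
  rw [IsAngleList.isCentered_block arrayPoint_rev, proj_arrayPoint_eq_zero] at hc
  have hle : equalCount (fun q => proj (arrayAngle D i) (arrayPoint D q)) p ≤ 2 := by
    by_contra hlt
    unfold equalCount at hlt
    rw [not_le, Finset.two_lt_card] at hlt
    obtain ⟨a, ha, b, hb, c, hc', hab, hac, hbc⟩ := hlt
    replace ha := (proj_arrayPoint_eq_iff i a p).1 (Finset.mem_filter.1 ha).2
    replace hb := (proj_arrayPoint_eq_iff i b p).1 (Finset.mem_filter.1 hb).2
    replace hc' := (proj_arrayPoint_eq_iff i c p).1 (Finset.mem_filter.1 hc').2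
    unfold IsArrayDirection at *
    by_cases h0 : i % (2 * D + 4) = 0
    · have ha := ha.1 h0
      have hb := hb.1 h0
      have hc' := hc'.1 h0
      have hc : arrayX D p ≠ 0 := fun h => hc ⟨fun _ => h, fun h1 => absurd h0 h1⟩
      have xa := array_cases a
      have xb := array_cases b
      have xc := array_cases c
      rw [Ne, Fin.ext_iff] at hab hac hbc
      omega
    · have ha := ha.2 h0
      have hb := hb.2 h0
      have hc' := hc'.2 h0
      have hc : arrayY D p - arraySlope D (i % (2 * D + 4)) * arrayX D p ≠ 0 :=
        fun h => hc ⟨fun h1 => absurd h1 h0, fun _ => by linarith⟩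
      obtain ⟨s, hs⟩ : ∃ s, s = arraySlope D (i % (2 * D + 4)) := ⟨_, rfl⟩
      rw [← hs] at ha hb hc' hc
      obtain ⟨k, hk⟩ : ∃ k, k = arrayY D p - s * arrayX D p := ⟨_, rfl⟩
      rw [← hk] at hc
      have ya : arrayY D a = s * arrayX D a + k := by linarith
      have yb : arrayY D b = s * arrayX D b + k := by linarith
      have yc : arrayY D c = s * arrayX D c + k := by linarith
      have eab : arrayX D a ≠ arrayX D b := fun h => hab (array_ext h (by rw [ya, yb, h]))
      have eac : arrayX D a ≠ arrayX D c := fun h => hac (array_ext h (by rw [ya, yc, h]))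
      have ebc : arrayX D b ≠ arrayX D c := fun h => hbc (array_ext h (by rw [yb, yc, h]))
      have column : ∀ q, arrayY D q = s * arrayX D q + k →
          (arrayX D q = -1 ∧ (k = s - 1 ∨ k = s + 1)) ∨ (arrayX D q = 0 ∧ k % 2 = 0) ∨
          (arrayX D q = 1 ∧ (k = -1 - s ∨ k = 1 - s)) := by
        intro q hq
        rcases array_cases q with ⟨h1, h2⟩ | ⟨h1, h2⟩ | ⟨h1, h2⟩ <;> rw [h1] at hq ⊢ <;> omega
      have xa := column a ya
      have xb := column b yb
      have xc := column c yc
      clear column ya yb yc hk ha hb hc' hs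
      -- Points in both side columns force (s, k) = (0, ±1) or (±1, 0). A middle point requires k
      -- even, so k = 0, which `hc` excludes.
      omega
  have := IsAngleList.card_block (v := arrayPoint D) (arrayAngle D i) p
  have h1 := AllowableSequence.Icc_card (I := IsAngleList.block (arrayPoint D) (arrayAngle D i) p)
  have h2 := (arraySequence D).switches_lt i _ hI
  rw [Fin.lt_def] at h2
  omega

theorem arraySequence_shift_isDC (D : ℕ) (a : ℤ)
    (ha : ∃ I ∈ (arraySequence D).switches a, IsCentered I) {t : ℕ} {d m : Fin t → ℕ}
    (hm : StrictMono m) (hlt : ∀ j, m j < 2 * D + 4)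
    (hsize : ∀ j, ∃ I ∈ (arraySequence D).switches (m j + a), IsCentered I ∧
      (Finset.Icc I.1 I.2).card = 2 * d j)
    (hall : ∀ i : ℕ, i < 2 * D + 4 → ((i + a) % (2 * D + 4) = 0 ∨ (i + a) % (2 * D + 4) = D + 1 ∨
      (i + a) % (2 * D + 4) = D + 3) → ∃ j, m j = i) :
    ((arraySequence D).shift a).IsDC d where
  evenNearCritical := ⟨⟨D + 2, by ring⟩, rfl⟩
  centrallySymmetric p := by
    obtain ⟨q, hq⟩ := (isAngleList_array D).centrallySymmetric arrayPoint_rev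
      (((arraySequence D).perm a).symm p)
    refine ⟨(arraySequence D).perm a q, fun i => ?_⟩
    change (arraySequence D).perm (i + a) (((arraySequence D).perm a).symm _) = _
    rw [Equiv.symm_apply_apply]
    exact hq (i + a)
  noncentralGeneralPosition i := arraySequence_noncentralGeneralPosition D (i + a)
  centralSignature := ⟨m, hm, hlt, hsize, fun i hi hI => hall i hi
    (arraySequence_centered_cases hI)⟩
  perm_zero := by
    ext p
    change ((arraySequence D).perm (0 + a) (((arraySequence D).perm a).symm p) : ℕ) = p
    rw [zero_add, Equiv.apply_symm_apply]
  first_move := by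
    change ∃ I ∈ (arraySequence D).switches (0 + a), IsCentered I
    rwa [zero_add]

theorem IsCircularSequence.reindex {N : ℕ} {v : Fin N → ℝ × ℝ} {σ : ℤ → Equiv.Perm (Fin N)}
    (h : IsCircularSequence v σ) (π : Equiv.Perm (Fin N)) (a : ℤ) :
    IsCircularSequence (v ∘ π) fun i => π.trans (σ (i + a)) := by
  obtain ⟨θ, hθ, hrange, hord⟩ := h
  refine ⟨fun i => θ (i + a), hθ.comp fun i j hij => by omega, ?_, ?_⟩
  · have e : Set.range (fun i => θ (i + a)) = Set.range θ :=
      (Equiv.addRight a).surjective.range_comp θ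
    rw [e, hrange]
    ext φ
    constructor
    · rintro ⟨p, q, hpq, h⟩
      exact ⟨π.symm p, π.symm q, π.symm.injective.ne hpq, by simpa using h⟩
    · rintro ⟨p, q, hpq, h⟩
      exact ⟨π p, π q, π.injective.ne hpq, h⟩
  · intro i φ h1 h2 p q
    refine hord (i + a) φ h1 ?_ (π p) (π q)
    rwa [show i + a + 1 = i + 1 + a by ring]

/-- The crossings of the array are the moves 0, D+1 and D+3 modulo 2D+4. Starting at each of them
yields the three cyclic orders of (D, 1, 1). -/
theorem exists_isDC (d : Fin 3 → ℕ) (i : Fin 3) (hi : 2 ≤ d i) (hi1 : d (i + 1) = 1)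
    (hi2 : d (i + 2) = 1) :
    ∃ S : AllowableSequence (2 * d i + 4), S.IsDC d ∧
      ∃ v, Function.Injective v ∧ IsCircularSequence v S.perm := by
  have mem : ∀ {D : ℕ} {x : ℤ} (c : ℤ), 0 ≤ c → c < 2 * D + 4 →
      (x = c ∨ x = c + (2 * D + 4)) → x % (2 * D + 4) = c := by
    rintro D x c h0 h1 (rfl | rfl)
    · exact Int.emod_eq_of_lt h0 h1
    · rw [Int.add_emod_right, Int.emod_eq_of_lt h0 h1]
  have cases : ∀ {D : ℕ} {x c : ℤ}, 0 ≤ x → x < 2 * (2 * D + 4) → x % (2 * D + 4) = c →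
      (x = c ∨ x = c + (2 * D + 4)) := by
    rintro D x c h0 h1 rfl
    have h2 := Int.emod_add_mul_ediv x (2 * D + 4)
    have h3 : 0 ≤ x / (2 * D + 4) := Int.ediv_nonneg h0 (by omega)
    have h4 : x / (2 * D + 4) < 2 := Int.ediv_lt_of_lt_mul (by omega) h1
    obtain h5 | h5 : x / (2 * D + 4) = 0 ∨ x / (2 * D + 4) = 1 := by omega
    · rw [h5] at h2
      exact Or.inl (by linarith)
    · rw [h5] at h2
      exact Or.inr (by linarith)
  have build : ∀ (D : ℕ) (a m₁ m₂ : ℕ) (d : Fin 3 → ℕ), 2 ≤ D → a < 2 * D + 4 →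
      0 < m₁ → m₁ < m₂ → m₂ < 2 * D + 4 →
      (∀ x : ℤ, x = 0 ∨ x = m₁ ∨ x = m₂ → ∀ e : ℕ,
        (x = 0 → e = d 0) → (x = m₁ → e = d 1) → (x = m₂ → e = d 2) →
        (x + a = 0 ∨ x + a = 2 * D + 4) ∧ e = D ∨
        ((x + a = D + 1 ∨ x + a = D + 1 + (2 * D + 4)) ∨
          (x + a = D + 3 ∨ x + a = D + 3 + (2 * D + 4))) ∧ e = 1) →
      (∀ x : ℤ, 0 ≤ x → x < 2 * D + 4 → (x + a = 0 ∨ x + a = 2 * D + 4 ∨ x + a = D + 1 ∨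
        x + a = D + 1 + (2 * D + 4) ∨ x + a = D + 3 ∨ x + a = D + 3 + (2 * D + 4)) →
        x = 0 ∨ x = m₁ ∨ x = m₂) →
      ∃ S : AllowableSequence (2 * D + 4), S.IsDC d ∧
        ∃ v, Function.Injective v ∧ IsCircularSequence v S.perm := by
    intro D a m₁ m₂ d hD ha h0 h1 h2 hsize hall
    have size : ∀ (x : ℤ) (e : ℕ), ((x + a = 0 ∨ x + a = 2 * D + 4) ∧ e = D ∨
        ((x + a = D + 1 ∨ x + a = D + 1 + (2 * D + 4)) ∨
          (x + a = D + 3 ∨ x + a = D + 3 + (2 * D + 4))) ∧ e = 1) →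
        ∃ I ∈ (arraySequence D).switches (x + a), IsCentered I ∧
          (Finset.Icc I.1 I.2).card = 2 * e := by
      rintro x e (⟨h, rfl⟩ | ⟨h | h, rfl⟩)
      · exact arraySequence_block (by omega) (mem 0 le_rfl (by omega) (by rwa [zero_add]))
      · exact arraySequence_transposition (Or.inl (mem _ (by omega) (by omega) h))
      · exact arraySequence_transposition (Or.inr (mem _ (by omega) (by omega) h))
    have s0 := size _ _ (hsize 0 (Or.inl rfl) (d 0) (fun _ => rfl) (fun _ => by omega)
      (fun _ => by omega))
    have s1 := size _ _ (hsize m₁ (Or.inr (Or.inl rfl)) (d 1) (fun _ => by omega) (fun _ => rfl)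
      (fun _ => by omega))
    have s2 := size _ _ (hsize m₂ (Or.inr (Or.inr rfl)) (d 2) (fun _ => by omega)
      (fun _ => by omega) (fun _ => rfl))
    refine ⟨_, arraySequence_shift_isDC D a (m := ![0, m₁, m₂]) ?_ ?_ ?_ ?_ ?_, _,
      (isAngleList_array D).injective.comp ((arraySequence D).perm a).symm.injective,
      (isAngleList_array D).isCircularSequence.reindex ((arraySequence D).perm a).symm a⟩
    · obtain ⟨I, hI, hc, -⟩ := s0
      rw [zero_add] at hI
      exact ⟨I, hI, hc⟩
    · rw [Fin.strictMono_iff_lt_succ]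
      intro j
      fin_cases j
      · exact h0
      · exact h1
    · intro j
      fin_cases j
      · exact Nat.succ_pos _
      · exact h1.trans h2
      · exact h2
    · intro j
      fin_cases j
      · exact s0
      · exact s1
      · exact s2
    · intro x hx hx'
      have := hall x (by omega) (by omega) (by
        rcases hx' with h | h | h <;> have := cases (by omega) (by omega) h <;> omega)
      rcases this with h | h | h
      · exact ⟨0, by change 0 = x; omega⟩
      · exact ⟨1, by change m₁ = x; omega⟩
      · exact ⟨2, by change m₂ = x; omega⟩
  -- The starting moves 0, D+3 and D+1 give the signatures (D, 1, 1), (1, D, 1) and (1, 1, D).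
  fin_cases i
  · change 2 ≤ d 0 at hi
    change d 1 = 1 at hi1
    change d 2 = 1 at hi2
    exact build (d 0) 0 (d 0 + 1) (d 0 + 3) d hi (by omega) (by omega) (by omega) (by omega)
      (fun x hx e => by omega) (fun x h1 h2 => by omega)
  · change 2 ≤ d 1 at hi
    change d 2 = 1 at hi1
    change d 0 = 1 at hi2
    exact build (d 1) (d 1 + 3) (d 1 + 1) (2 * d 1 + 2) d hi (by omega) (by omega) (by omega)
      (by omega) (fun x hx e => by omega) (fun x h1 h2 => by omega)
  · change 2 ≤ d 2 at hi
    change d 0 = 1 at hi1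
    change d 1 = 1 at hi2
    exact build (d 2) (d 2 + 1) 2 (d 2 + 3) d hi (by omega) (by omega) (by omega)
      (by omega) (fun x hx e => by omega) (fun x h1 h2 => by omega)

end Array

/-! ### Transport of the realization, and the conclusion. -/

/-- By uniqueness the two sequences differ by a relabelling and a shift of the index, and both
preserve being a circular sequence. -/
theorem AllowableSequence.Pattern.exists_isCircularSequence {N : ℕ} {S S' : AllowableSequence N}
    {T T' : ℤ} {D : ℕ} (P : S.Pattern T D D) (P' : S'.Pattern T' D D) (hh : S.h = 2 * D + 4)
    (hh' : S'.h = 2 * D + 4) (hN : N = 2 * D + 4) {v : Fin N → ℝ × ℝ}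
    (hv : Function.Injective v) (hc : IsCircularSequence v S'.perm) :
    ∃ w, Function.Injective w ∧ IsCircularSequence w S.perm := by
  let π := (S.perm (T + 1)).trans (S'.perm (T' + 1)).symm
  refine ⟨v ∘ π, hv.comp π.injective, ?_⟩
  convert hc.reindex π (T' - T) using 2 with i
  ext p
  have h1 : S.coord (T + 1) p = S'.coord (T' + 1) (π p) := by
    unfold AllowableSequence.coord
    simp [π]
  have h2 := P.coord_eq_int P' hh hh' hN (i - T) h1
  rw [add_sub_cancel, show T' + (i - T) = i + (T' - T) by ring] at h2
  unfold AllowableSequence.coord at h2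
  change (S.perm i p : ℕ) = (S'.perm (i + (T' - T)) (π p) : ℕ)
  omega

theorem AllowableSequence.IsDC.eq_three {N : ℕ} {S : AllowableSequence N} {t : ℕ} [NeZero t]
    (ht : 3 ≤ t) {d : Fin t → ℕ} (hd : ∀ j, 0 < d j) {i : Fin t} (hi : 2 ≤ d i)
    (hi1 : d (i + 1) = 1) (hi2 : d (i + 2) = 1) (hS : S.IsDC d) {v : Fin N → ℝ × ℝ}
    (hv : S.HasDirections v) :
    t = 3 ∧ AffinelyEquivalent (Set.range v) (tricolumnarArrayStar 1 (d i) 0) := by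
  obtain ⟨T, e, P, ⟨h3, rfl, hh, hN⟩ | ⟨-, hlt⟩⟩ := hS.exists_pattern ht hd hi hi1 hi2
  · exact ⟨h3, P.affinelyEquivalent hh hN hv⟩
  · exact (P.no_fourth hlt hv).elim

theorem theorem4p7 (t : ℕ) [NeZero t] (ht : 3 ≤ t) (d : Fin t → ℕ) (hd : ∀ j, 0 < d j)
    (i : Fin t) (hi : 2 ≤ d i) (hi1 : d (i + 1) = 1) (hi2 : d (i + 2) = 1) :
    (∀ (N : ℕ) (S : AllowableSequence N), S.IsDC d → (GeometricallyRealizable S ↔ t = 3)) ∧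
    (t = 3 → ∃ (N : ℕ) (S : AllowableSequence N), S.IsDC d) ∧
    (∀ (N : ℕ) (S : AllowableSequence N), S.IsDC d → ∀ P : Set (ℝ × ℝ), Realizes P S →
      AffinelyEquivalent P (tricolumnarArrayStar 1 (d i) 0)) := by
  have main : ∀ (N : ℕ) (S : AllowableSequence N), S.IsDC d → ∀ P : Set (ℝ × ℝ), Realizes P S →
      t = 3 ∧ AffinelyEquivalent P (tricolumnarArrayStar 1 (d i) 0) := by
    rintro N S hS P ⟨v, hv, rfl, hc⟩
    exact hS.eq_three ht hd hi hi1 hi2 (AllowableSequence.hasDirections_of_isCircularSequence hv hc)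
  refine ⟨fun N S hS => ⟨fun ⟨P, hP⟩ => (main N S hS P hP).1, ?_⟩, ?_,
    fun N S hS P hP => (main N S hS P hP).2⟩
  · rintro rfl
    -- The given sequence is compared with that of the array, which has the same signature and is
    -- realized by construction.
    obtain ⟨S', hS', v, hv, hc⟩ := exists_isDC d i hi hi1 hi2
    obtain ⟨T, e, P, ⟨-, rfl, hh, rfl⟩ | ⟨h3, -⟩⟩ := hS.exists_pattern ht hd hi hi1 hi2
    · obtain ⟨T', e', P', ⟨-, rfl, hh', -⟩ | ⟨h3, -⟩⟩ := hS'.exists_pattern ht hd hi hi1 hi2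
      · obtain ⟨w, hw, hcw⟩ := P.exists_isCircularSequence P' hh hh' rfl hv hc
        exact ⟨_, w, hw, rfl, hcw⟩
      · exact absurd rfl h3
    · exact absurd rfl h3
  · rintro rfl
    obtain ⟨S, hS, -⟩ := exists_isDC d i hi hi1 hi2
    exact ⟨_, S, hS⟩
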